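/- Let $k$ be a finite field with $q$ elements and $v=q^{1/2}$. Let $Q$ be a finite quiver (finitely many vertices and arrows; loops and multiple arrows are allowed) and $kQ$ its path algebra. Let $\mathcal H(Q)$ be the Hall algebra of $kQ$: the $\mathbb Z[v,v^{-1}]$-algebra with basis the isomorphism classes $[X]$ of finite dimensional left $kQ$-modules and with multiplication $[M]\diamond[N]=\sum_{[X]}F^X_{M,N}[X]$, where $F^X_{M,N}$ is the number of submodules $U$ of $X$ with $U\cong N$ and $X/U\cong M$. For a module $M$ let $s(M)$ be the number of its indecomposable direct summands, and for $r\ge 1$ let $D_r(Q)$ be the $\mathbb Z[v,v^{-1}]$-span of all $[M]$ with $s(M)\ge r+1$; put $D(Q)=D_1(Q)$. Here an ideal is two-sided, and a subring need not contain the identity. Consider the following quivers: - $L_m$ ($m\ge 1$): $1\to 2\to\cdots\to m$; - $\Delta_n$ ($n\ge 0$): the oriented cycle $0\to 1\to\cdots\to n\to 0$ (a loop for $n=0$); - $V_{m,x}$ ($m\ge 3$, $2\le x\le m-1$): $1\to 2\to\cdots\to x\leftarrow\cdots\leftarrow m-1\leftarrow m$; - $\Lambda_{n,y}$ ($n\ge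 3$, $2\le y\le n-1$): $1\leftarrow 2\leftarrow\cdots\leftarrow y\to\cdots\to n-1\to n$. (i) $D_r(Q)$ is an ideal of $\mathcal H(Q)$ for all $r\ge 1$ if and only if $Q$ is a disjoint union of quivers of the form $L$ and $\Delta$. (ii) $D(Q)$ is a subring of $\mathcal H(Q)$ if and only if $Q$ is a disjoint union of quivers of the form $L$, $\Delta$, $V$ and $\Lambda$. (iii) The following conditions are equivalent: (a) $D_r(Q)$ is a subring of $\mathcal H(Q)$ for all $r\ge 1$; (b) $D_r(Q)$ is a subring of $\mathcal H(Q)$ for some $r\ge 2$; (c) $Q$ is a disjoint union of quivers of the form $L$, $\Delta$ and $V$, or a disjoint union of quivers of the form $L$, $\Delta$ and $\Lambda$. -/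

import Mathlib

open Quiver

universe u v w

/-! ## The path algebra of a quiver -/

/-- The path algebra `kQ` of a quiver with vertex set `Q`: the `k`-vector space with basis the set
of all paths (a path is a triple: starting vertex, terminating vertex, path between them; the
trivial paths are included). -/
def PathAlgebra (k : Type w) (Q : Type u) [Field k] [Quiver.{v} Q] : Type (max w u v) :=
  (Σ a b : Q, Path a b) →₀ k

namespace PathAlgebra

variable {k : Type w} {Q : Type u} [Field k] [Quiver.{v} Q]

noncomputable instance : AddCommGroup (PathAlgebra k Q) :=
  inferInstanceAs (AddCommGroup ((Σ a b : Q, Path a b) →₀ k))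

noncomputable instance : Module k (PathAlgebra k Q) :=
  inferInstanceAs (Module k ((Σ a b : Q, Path a b) →₀ k))

variable (k) in
/-- The basis element of `kQ` given by a path. -/
noncomputable def ofPath {a b : Q} (p : Path a b) : PathAlgebra k Q :=
  Finsupp.single (⟨a, b, p⟩ : Σ a b : Q, Path a b) (1 : k)

open Classical in
variable (k) in
/-- The product `αβ` of two paths: the composition "first `β`, then `α`" if `β` terminates where
`α` starts, and `0` otherwise. -/
noncomputable def pathMul (α β : Σ a b : Q, Path a b) : PathAlgebra k Q :=
  if h : β.2.1 = α.1 then ofPath k (β.2.2.comp (α.2.2.cast h.symm rfl)) else 0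

variable (k Q) in
/-- The bilinear extension of the product of paths. -/
noncomputable def mulBilin :
    PathAlgebra k Q →ₗ[k] PathAlgebra k Q →ₗ[k] PathAlgebra k Q :=
  Finsupp.lift (PathAlgebra k Q →ₗ[k] PathAlgebra k Q) k (Σ a b : Q, Path a b) fun α =>
    Finsupp.lift (PathAlgebra k Q) k (Σ a b : Q, Path a b) fun β => pathMul k α β

noncomputable instance : Mul (PathAlgebra k Q) := ⟨fun x y => mulBilin k Q x y⟩

noncomputable instance [Fintype Q] : One (PathAlgebra k Q) :=
  ⟨∑ a : Q, ofPath k (Path.nil : Path a a)⟩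

theorem mul_def (x y : PathAlgebra k Q) : x * y = mulBilin k Q x y := rfl

theorem one_def [Fintype Q] :
    (1 : PathAlgebra k Q) = ∑ a : Q, ofPath k (Path.nil : Path a a) := rfl

theorem hom_ext {M : Type*} [AddCommGroup M] [Module k M] {f g : PathAlgebra k Q →ₗ[k] M}
    (h : ∀ (a b : Q) (p : Path a b), f (ofPath k p) = g (ofPath k p)) : f = g := by
  refine Finsupp.lhom_ext' fun p => ?_
  ext
  exact h p.1 p.2.1 p.2.2

theorem mulBilin_ofPath {a b c d : Q} (p : Path a b) (q : Path c d) :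
    mulBilin k Q (ofPath k p) (ofPath k q) = pathMul k ⟨a, b, p⟩ ⟨c, d, q⟩ := by
  have h1 : mulBilin k Q (ofPath k p) =
      Finsupp.lift (PathAlgebra k Q) k (Σ a b : Q, Path a b) fun β => pathMul k ⟨a, b, p⟩ β := by
    refine (Finsupp.lift_apply _ _ _ _ _).trans ?_
    exact (Finsupp.sum_single_index (by exact zero_smul _ _)).trans (by exact one_smul _ _)
  rw [h1]
  refine (Finsupp.lift_apply _ _ _ _ _).trans ?_
  exact (Finsupp.sum_single_index (by exact zero_smul _ _)).trans (by exact one_smul _ _)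

theorem ofPath_mul_ofPath {a b c : Q} (p : Path b c) (q : Path a b) :
    ofPath k p * ofPath k q = ofPath k (q.comp p) := by
  rw [mul_def, mulBilin_ofPath]
  simp [pathMul]

theorem ofPath_mul_ofPath_of_ne {a b c d : Q} (p : Path c d) (q : Path a b) (h : b ≠ c) :
    ofPath k p * ofPath k q = 0 := by
  rw [mul_def, mulBilin_ofPath]
  simp [pathMul, h]

theorem mul_assoc_ofPath {a b c d e f : Q} (p : Path a b) (q : Path c d) (r : Path e f) :
    ofPath k p * ofPath k q * ofPath k r = ofPath k p * (ofPath k q * ofPath k r) := by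
  have hz : ∀ x : PathAlgebra k Q, 0 * x = 0 := fun x => by simp [mul_def]
  have hz' : ∀ x : PathAlgebra k Q, x * 0 = 0 := fun x => by simp [mul_def]
  by_cases h1 : d = a
  · subst h1
    by_cases h2 : f = c
    · subst h2
      simp only [ofPath_mul_ofPath, Path.comp_assoc]
    · simp only [ofPath_mul_ofPath, ofPath_mul_ofPath_of_ne _ _ h2, hz']
  · by_cases h2 : f = c
    · subst h2
      simp only [ofPath_mul_ofPath, ofPath_mul_ofPath_of_ne _ _ h1, hz]
    · simp only [ofPath_mul_ofPath_of_ne _ _ h1, ofPath_mul_ofPath_of_ne _ _ h2, hz, hz']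

protected theorem induction {P : PathAlgebra k Q → Prop} (x : PathAlgebra k Q) (h0 : P 0)
    (hadd : ∀ x y, P x → P y → P (x + y))
    (hpath : ∀ (c : k) (a b : Q) (p : Path a b), P (c • ofPath k p)) : P x := by
  refine Finsupp.induction_linear x h0 hadd fun p c => ?_
  have h : (Finsupp.single p c : (Σ a b : Q, Path a b) →₀ k) = c • Finsupp.single p 1 := by simp
  rw [h]
  exact hpath c p.1 p.2.1 p.2.2

noncomputable instance : NonUnitalRing (PathAlgebra k Q) where
  left_distrib x y z := by simp [mul_def]
  right_distrib x y z := by simp [mul_def]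
  zero_mul x := by simp [mul_def]
  mul_zero x := by simp [mul_def]
  mul_assoc x y z := by
    simp only [mul_def]
    induction x using PathAlgebra.induction with
    | h0 => simp
    | hadd x x' hx hx' => simp [hx, hx']
    | hpath c a b p =>
      induction y using PathAlgebra.induction with
      | h0 => simp
      | hadd y y' hy hy' => simp only [map_add, LinearMap.add_apply, hy, hy']
      | hpath c' a' b' q =>
        induction z using PathAlgebra.induction with
        | h0 => simp
        | hadd z z' hz hz' => simp only [map_add, hz, hz']
        | hpath c'' a'' b'' r =>
          simp only [map_smul, LinearMap.smul_apply]
          have h := mul_assoc_ofPath (k := k) p q r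
          simp only [mul_def] at h
          rw [h]

theorem smul_mul (c : k) (x y : PathAlgebra k Q) : c • x * y = c • (x * y) := by
  simp [mul_def]

theorem mul_smul (c : k) (x y : PathAlgebra k Q) : x * c • y = c • (x * y) := by
  simp [mul_def]

noncomputable instance [Fintype Q] : Ring (PathAlgebra k Q) where
  __ := (inferInstance : NonUnitalRing (PathAlgebra k Q))
  one := 1
  one_mul x := by
    induction x using PathAlgebra.induction with
    | h0 => simp
    | hadd x y hx hy => rw [mul_add, hx, hy]
    | hpath c a b p =>
      rw [mul_smul, one_def, Finset.sum_mul, Finset.sum_eq_single b, ofPath_mul_ofPath,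
        Path.comp_nil]
      · intro d _ hd
        exact ofPath_mul_ofPath_of_ne _ _ hd.symm
      · simp
  mul_one x := by
    induction x using PathAlgebra.induction with
    | h0 => simp
    | hadd x y hx hy => rw [add_mul, hx, hy]
    | hpath c a b p =>
      rw [smul_mul, one_def, Finset.mul_sum, Finset.sum_eq_single a, ofPath_mul_ofPath,
        Path.nil_comp]
      · intro d _ hd
        exact ofPath_mul_ofPath_of_ne _ _ hd
      · simp
  zsmul := (inferInstance : NonUnitalRing (PathAlgebra k Q)).zsmul
  zsmul_zero' := (inferInstance : NonUnitalRing (PathAlgebra k Q)).zsmul_zero'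
  zsmul_succ' := (inferInstance : NonUnitalRing (PathAlgebra k Q)).zsmul_succ'
  zsmul_neg' := (inferInstance : NonUnitalRing (PathAlgebra k Q)).zsmul_neg'

noncomputable instance [Fintype Q] : Algebra k (PathAlgebra k Q) :=
  Algebra.ofModule smul_mul mul_smul

/-- If `Q` has finitely many vertices and arrows then `kQ` is finitely generated: it is generated
by the trivial paths and the arrows. -/
instance [Fintype Q] [∀ a b : Q, Finite (a ⟶ b)] : Algebra.FiniteType k (PathAlgebra k Q) := by
  let f : Q ⊕ (Σ a b : Q, (a ⟶ b)) → PathAlgebra k Q :=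
    Sum.elim (fun a => ofPath k (Path.nil : Path a a)) (fun e => ofPath k e.2.2.toPath)
  have hfin : (Set.range f).Finite := Set.finite_range f
  refine ⟨⟨hfin.toFinset, ?_⟩⟩
  rw [Set.Finite.coe_toFinset, eq_top_iff]
  rintro x -
  induction x using PathAlgebra.induction with
  | h0 => exact zero_mem _
  | hadd x y hx hy => exact add_mem hx hy
  | hpath c a b p =>
    refine Subalgebra.smul_mem _ ?_ c
    induction p with
    | nil => exact Algebra.subset_adjoin ⟨Sum.inl a, rfl⟩
    | cons p e ih =>
      rw [← Path.comp_toPath_eq_cons, ← ofPath_mul_ofPath]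
      exact mul_mem (Algebra.subset_adjoin ⟨Sum.inr ⟨_, _, e⟩, rfl⟩) ih

end PathAlgebra

/-! ## Finite dimensional modules and the Hall algebra -/

/-- A finite dimensional left module over a `k`-algebra `A`. (The `k`-structure is the one
restricted from `A`. Up to isomorphism every finite dimensional module has its carrier in
the universe of `k`.) -/
structure FDMod (k : Type w) (A : Type u) [Field k] [Ring A] [Algebra k A] where
  carrier : Type w
  [addCommGroup : AddCommGroup carrier]
  [baseModule : Module k carrier]
  [module : Module A carrier]
  [isScalarTower : IsScalarTower k A carrier]
  [finite : Module.Finite k carrier]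

namespace FDMod

attribute [instance] addCommGroup baseModule module isScalarTower finite

variable {k : Type w} {A : Type u} [Field k] [Ring A] [Algebra k A]

instance : CoeSort (FDMod k A) (Type w) := ⟨carrier⟩

/-- Isomorphism of modules. -/
instance setoid : Setoid (FDMod k A) where
  r M N := Nonempty (M ≃ₗ[A] N)
  iseqv := ⟨fun _ => ⟨.refl _ _⟩, fun ⟨e⟩ => ⟨e.symm⟩, fun ⟨e⟩ ⟨f⟩ => ⟨e.trans f⟩⟩

end FDMod

/-- A module is indecomposable if it is nonzero and not the direct sum of two nonzero
submodules. -/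
def IsIndecomposableModule (A : Type u) (M : Type w) [Ring A] [AddCommGroup M] [Module A M] :
    Prop :=
  Nontrivial M ∧ ∀ U W : Submodule A M, IsCompl U W → U = ⊥ ∨ W = ⊥

/-- `M` is the internal direct sum of `n` indecomposable submodules. -/
def IsSumOfIndecomposables (A : Type u) (M : Type w) [Ring A] [AddCommGroup M] [Module A M]
    (n : ℕ) : Prop :=
  ∃ U : Fin n → Submodule A M, (∀ i, IsIndecomposableModule A (U i)) ∧ DirectSum.IsInternal U

/-- `s(M)`, the number of indecomposable direct summands of `M`. For a finite dimensional module
there is exactly one `n` for which `M` is a direct sum of `n` indecomposable submodules. -/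
noncomputable def numIndecomposables (A : Type u) (M : Type w) [Ring A] [AddCommGroup M]
    [Module A M] : ℕ :=
  sInf {n : ℕ | IsSumOfIndecomposables A M n}

section Hall

variable (k : Type w) (A : Type u) [Field k] [Ring A] [Algebra k A]

/-- The set of isomorphism classes of finite dimensional `A`-modules. -/
abbrev IsoClass := Quotient (FDMod.setoid (k := k) (A := A))

variable {k A} in
/-- The Hall number `F^X_{M,N}`: the number of submodules `U` of `X` with `U ≅ N` and
`X / U ≅ M`. -/
noncomputable def hallNumber (X M N : FDMod k A) : ℕ :=
  Nat.card {U : Submodule A X // Nonempty (U ≃ₗ[A] N) ∧ Nonempty ((X ⧸ U) ≃ₗ[A] M)}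

variable {k A} in
/-- The Hall number of three isomorphism classes. -/
noncomputable def hallNumberClass (X M N : IsoClass k A) : ℕ :=
  hallNumber X.out M.out N.out

variable {k A} in
theorem hallNumber_congr {X X' M M' N N' : FDMod k A} (hX : X ≈ X') (hM : M ≈ M') (hN : N ≈ N') :
    hallNumber X M N = hallNumber X' M' N' := by
  obtain ⟨e⟩ := hX
  obtain ⟨f⟩ := hM
  obtain ⟨g⟩ := hN
  refine Nat.card_congr ((Submodule.orderIsoMapComap e).toEquiv.subtypeEquiv fun U => ?_)
  have e1 : U ≃ₗ[A] Submodule.map (e : X →ₗ[A] X') U := e.submoduleMap U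
  have e2 : (X ⧸ U) ≃ₗ[A] (X' ⧸ Submodule.map (e : X →ₗ[A] X') U) :=
    Submodule.Quotient.equiv U _ e rfl
  exact and_congr
    ⟨fun ⟨h⟩ => ⟨e1.symm.trans (h.trans g)⟩, fun ⟨h⟩ => ⟨e1.trans (h.trans g.symm)⟩⟩
    ⟨fun ⟨h⟩ => ⟨e2.symm.trans (h.trans f)⟩, fun ⟨h⟩ => ⟨e2.trans (h.trans f.symm)⟩⟩

variable {k A} in
theorem hallNumberClass_mk (X M N : FDMod k A) :
    hallNumberClass (⟦X⟧ : IsoClass k A) ⟦M⟧ ⟦N⟧ = hallNumber X M N :=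
  hallNumber_congr (Quotient.mk_out X) (Quotient.mk_out M) (Quotient.mk_out N)

theorem finite_setOf_finrank_eq [Finite k] [Algebra.FiniteType k A] (d : ℕ) :
    {X : IsoClass k A | Module.finrank k X.out = d}.Finite := by
  obtain ⟨S, hS⟩ := Algebra.FiniteType.out (R := k) (A := A)
  let T := {X : IsoClass k A | Module.finrank k X.out = d}
  let e : ∀ X : T, X.1.out ≃ₗ[k] (Fin d → k) :=
    fun X => LinearEquiv.ofFinrankEq _ _ (X.2.trans (by simp))
  let act : T → S → (Fin d → k) → (Fin d → k) := fun X s x => e X ((s : A) • (e X).symm x)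
  have hact : Function.Injective act := by
    intro X Y hXY
    let φ : X.1.out ≃ₗ[k] Y.1.out := (e X).trans (e Y).symm
    have hφ : ∀ (a : A) (x : X.1.out), φ (a • x) = a • φ x := by
      intro a
      have ha : a ∈ Algebra.adjoin k (S : Set A) := hS ▸ Algebra.mem_top
      induction ha using Algebra.adjoin_induction with
      | mem a ha =>
        intro x
        have h := congrFun (congrFun hXY ⟨a, ha⟩) (e X x)
        simp only [act, LinearEquiv.symm_apply_apply] at h
        simp [φ, h]
      | algebraMap c => intro x; simp [algebraMap_smul]
      | add a b _ _ iha ihb => intro x; simp [add_smul, iha, ihb]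
      | mul a b _ _ iha ihb => intro x; simp only [mul_smul, iha, ihb]
    have : X.1 = Y.1 := by
      rw [← Quotient.out_eq X.1, ← Quotient.out_eq Y.1]
      exact Quotient.sound ⟨{ φ with map_smul' := hφ }⟩
    exact Subtype.ext this
  exact Set.finite_coe_iff.1 (Finite.of_injective act hact)

/-- Over a finite field and a finitely generated algebra only finitely many isomorphism classes
occur in a product of two isomorphism classes. -/
theorem finite_support_hallNumberClass [Finite k] [Algebra.FiniteType k A] (M N : IsoClass k A) :
    (Function.support fun X : IsoClass k A => hallNumberClass X M N).Finite := by
  refine (finite_setOf_finrank_eq k A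
    (Module.finrank k M.out + Module.finrank k N.out)).subset fun X hX => ?_
  have hne : Nonempty {U : Submodule A X.out //
      Nonempty (U ≃ₗ[A] N.out) ∧ Nonempty ((X.out ⧸ U) ≃ₗ[A] M.out)} := by
    by_contra h
    rw [not_nonempty_iff] at h
    exact hX Nat.card_of_isEmpty
  obtain ⟨U, ⟨f⟩, ⟨g⟩⟩ := hne
  have h1 : Module.finrank k (U.restrictScalars k) = Module.finrank k N.out :=
    LinearEquiv.finrank_eq (f.restrictScalars k)
  have h2 : Module.finrank k (X.out ⧸ U.restrictScalars k) = Module.finrank k M.out :=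
    LinearEquiv.finrank_eq
      ((Submodule.Quotient.restrictScalarsEquiv k U).trans (g.restrictScalars k))
  rw [Set.mem_ofPred_eq, ← h1, ← h2]
  exact (Submodule.finrank_quotient_add_finrank _).symm

/-- The coefficient ring `ℤ[v, v⁻¹]`, where `v = q^{1/2}` and `q` is the number of elements
of `k`. -/
abbrev HallCoeff : Subalgebra ℤ ℝ :=
  Algebra.adjoin ℤ {√(Nat.card k : ℝ), (√(Nat.card k : ℝ))⁻¹}

/-- The Hall algebra `H(A)`: the free `ℤ[v, v⁻¹]`-module on the isomorphism classes of finite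
dimensional `A`-modules. Its multiplication is defined below. -/
def HallAlgebra : Type (max (w + 1) u) :=
  IsoClass k A →₀ HallCoeff k

namespace HallAlgebra

noncomputable instance : AddCommGroup (HallAlgebra k A) :=
  inferInstanceAs (AddCommGroup (IsoClass k A →₀ HallCoeff k))

noncomputable instance : Module (HallCoeff k) (HallAlgebra k A) :=
  inferInstanceAs (Module (HallCoeff k) (IsoClass k A →₀ HallCoeff k))

variable {k A} in
/-- The basis element `[X]`. -/
noncomputable def cls (X : IsoClass k A) : HallAlgebra k A :=
  Finsupp.single X (1 : HallCoeff k)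

variable [Finite k] [Algebra.FiniteType k A]

variable {k A} in
/-- The product of two basis elements: `[M] ⋄ [N] = ∑_[X] F^X_{M,N} [X]`. -/
noncomputable def clsMul (M N : IsoClass k A) : HallAlgebra k A :=
  Finsupp.ofSupportFinite (fun X => (hallNumberClass X M N : HallCoeff k))
    ((finite_support_hallNumberClass k A M N).subset fun X hX h => hX (by simp [h]))

/-- The multiplication of the Hall algebra: the bilinear extension of the product of basis
elements. -/
noncomputable def mulBilin :
    HallAlgebra k A →ₗ[HallCoeff k] HallAlgebra k A →ₗ[HallCoeff k] HallAlgebra k A :=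
  Finsupp.lift (HallAlgebra k A →ₗ[HallCoeff k] HallAlgebra k A) (HallCoeff k) (IsoClass k A)
    fun M => Finsupp.lift (HallAlgebra k A) (HallCoeff k) (IsoClass k A) fun N => clsMul M N

noncomputable instance : NonUnitalNonAssocRing (HallAlgebra k A) where
  mul x y := mulBilin k A x y
  left_distrib x y z := map_add (mulBilin k A x) y z
  right_distrib x y z := by
    change mulBilin k A (x + y) z = mulBilin k A x z + mulBilin k A y z
    simp
  zero_mul x := by
    change mulBilin k A 0 x = 0
    simp
  mul_zero x := map_zero (mulBilin k A x)

variable {k A} in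
theorem cls_mul_cls (M N : IsoClass k A) : cls M * cls N = clsMul M N := by
  change mulBilin k A (cls M) (cls N) = clsMul M N
  have h1 : mulBilin k A (cls M) =
      Finsupp.lift (HallAlgebra k A) (HallCoeff k) (IsoClass k A) fun N => clsMul M N := by
    refine (Finsupp.lift_apply _ _ _ _ _).trans ?_
    exact (Finsupp.sum_single_index (by exact zero_smul _ _)).trans (by exact one_smul _ _)
  rw [h1]
  refine (Finsupp.lift_apply _ _ _ _ _).trans ?_
  exact (Finsupp.sum_single_index (by exact zero_smul _ _)).trans (by exact one_smul _ _)

end HallAlgebra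

/-- `D_r(A)`: the `ℤ[v, v⁻¹]`-submodule of `H(A)` spanned by the isomorphism classes of modules
with at least `r + 1` indecomposable direct summands. -/
noncomputable def hallD (r : ℕ) : Submodule (HallCoeff k) (HallAlgebra k A) :=
  Submodule.span (HallCoeff k)
    {x | ∃ X : IsoClass k A, r + 1 ≤ numIndecomposables A X.out ∧ x = HallAlgebra.cls X}

variable [Finite k] [Algebra.FiniteType k A]

/-- `D_r(A)` is a (two-sided) ideal of `H(A)`. -/
def HallDIsIdeal (r : ℕ) : Prop :=
  ∃ I : TwoSidedIdeal (HallAlgebra k A), (I : Set (HallAlgebra k A)) = hallD k A r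

/-- `D_r(A)` is a (not necessarily unital) subring of `H(A)`. -/
def HallDIsSubring (r : ℕ) : Prop :=
  ∃ S : NonUnitalSubring (HallAlgebra k A), (S : Set (HallAlgebra k A)) = hallD k A r

end Hall

/-! ## The quivers `L`, `Δ`, `V`, `Λ` and their disjoint unions -/

/-- The four families of quivers. -/
inductive QuiverKind
  | L
  | Δ
  | V
  | Λ

/-- The quivers `L_m` (`m ≥ 1`), `Δ_n` (`n ≥ 0`), `V_{m,x}` (`m ≥ 3`, `2 ≤ x ≤ m - 1`) and
`Λ_{n,y}` (`n ≥ 3`, `2 ≤ y ≤ n - 1`). -/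
inductive BasicQuiver
  | L (m : ℕ) (hm : 1 ≤ m)
  | Δ (n : ℕ)
  | V (m x : ℕ) (hm : 3 ≤ m) (hx : 2 ≤ x ∧ x ≤ m - 1)
  | Λ (n y : ℕ) (hn : 3 ≤ n) (hy : 2 ≤ y ∧ y ≤ n - 1)

namespace BasicQuiver

/-- The family to which a quiver belongs. -/
def kind : BasicQuiver → QuiverKind
  | L _ _ => .L
  | Δ _ => .Δ
  | V _ _ _ _ => .V
  | Λ _ _ _ _ => .Λ

/-- The set of (labels of) vertices: `1, …, m` for `L_m` and `V_{m,x}`, `0, …, n` for `Δ_n`, and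
`1, …, n` for `Λ_{n,y}`. -/
def vertices : BasicQuiver → Finset ℕ
  | L m _ => Finset.Icc 1 m
  | Δ n => Finset.Icc 0 n
  | V m _ _ _ => Finset.Icc 1 m
  | Λ n _ _ _ => Finset.Icc 1 n

/-- There is an arrow from the vertex `i` to the vertex `j`.
* `L_m` : `1 → 2 → ⋯ → m`;
* `Δ_n` : `0 → 1 → ⋯ → n → 0`;
* `V_{m,x}` : `1 → ⋯ → x ← ⋯ ← m`;
* `Λ_{n,y}` : `1 ← ⋯ ← y → ⋯ → n`. -/
def HasArrow : BasicQuiver → ℕ → ℕ → Prop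
  | L _ _, i, j => j = i + 1
  | Δ n, i, j => j = (i + 1) % (n + 1)
  | V _ x _ _, i, j => (j = i + 1 ∧ j ≤ x) ∨ (i = j + 1 ∧ x ≤ j)
  | Λ _ y _ _, i, j => (i = j + 1 ∧ i ≤ y) ∨ (j = i + 1 ∧ y ≤ i)

/-- The type of vertices. -/
structure Vertex (B : BasicQuiver) where
  val : ℕ
  mem : val ∈ B.vertices

/-- There is one arrow from `i` to `j` if `HasArrow i j`, and none otherwise. -/
instance (B : BasicQuiver) : Quiver.{0} B.Vertex where
  Hom i j := PLift (B.HasArrow i.val j.val)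

end BasicQuiver

/-- The arrows of the disjoint union of a family of quivers. -/
inductive DisjointUnionHom {ι : Type} (W : ι → Type) [∀ i, Quiver.{0} (W i)] :
    (Σ i, W i) → (Σ i, W i) → Type
  | mk {i : ι} {a b : W i} (e : a ⟶ b) : DisjointUnionHom W ⟨i, a⟩ ⟨i, b⟩

/-- The disjoint union of a family of quivers. -/
instance disjointUnionQuiver {ι : Type} (W : ι → Type) [∀ i, Quiver.{0} (W i)] :
    Quiver.{0} (Σ i, W i) where
  Hom := DisjointUnionHom W

/-- A morphism of quivers is an isomorphism if it is bijective on vertices and on arrows. -/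
def Prefunctor.IsIsomorphism {Q : Type u} {R : Type w} [Quiver Q] [Quiver R] (F : Q ⥤q R) : Prop :=
  Function.Bijective F.obj ∧
    ∀ a b : Q, Function.Bijective (F.map : (a ⟶ b) → (F.obj a ⟶ F.obj b))

/-- `Q` is (isomorphic to) a disjoint union of finitely many quivers from the given families. -/
def IsDisjointUnionOf (S : Set QuiverKind) (Q : Type u) [Quiver.{v} Q] : Prop :=
  ∃ (n : ℕ) (B : Fin n → BasicQuiver), (∀ i, (B i).kind ∈ S) ∧
    ∃ F : Q ⥤q (Σ i, (B i).Vertex), F.IsIsomorphism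

/-! The structure constants of the Hall algebra are natural numbers, so nothing cancels in a product
of basis elements. Hence `D_r` is a subring exactly when every module `X` with a submodule `U` such
that `s(U)` and `s(X / U)` are both at least `r + 1` satisfies `s(X) ≥ r + 1`; for an ideal it must
suffice that one of the two numbers is that large (`hallDIsSubring_iff`, `hallDIsIdeal_iff`). Only
the behaviour of `s` under submodules and quotients remains to be studied.

Sufficiency. If all indecomposables are uniform, a submodule of `X` embeds in a product of `s(X)`
uniform modules, and comparing with a direct sum of simple submodules gives `s(U) ≤ s(X)`. If all
are hollow, the dual count gives `s(X / U) ≤ s(X)`. The same hollow count, applied to the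
endomorphism ring as a left module over itself, shows that `s` is well defined and additive. An
indecomposable module lives on one connected component. On `V` it is uniform, on `Λ` hollow, on `L`
and `Δ` both (`IsDisjointUnionOf.exists_kind`). For `D_1` it is enough that each indecomposable has
one of the two properties.

Uniformity is proved by splitting off a string. One chooses vectors moved into each other by the
arrows, together with a dual system of functionals, such that the span of the vectors and the common
kernel of the functionals are both invariant; indecomposability then makes the vectors a basis, and
every nonzero submodule contains the last one. On a cycle this handles the nilpotent case.
Otherwise, by Fitting's lemma, the arrows act bijectively, and the monodromy at one vertex reduces
the claim to modules over `k[T]`. Hollowness follows by vector space duality.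

Necessity. Suppose an indecomposable `X` has a submodule `U` with `s(U), s(X / U) ≥ 2`. The direct
sum of `r` copies of it shows that `D_r` is not a subring. Such modules are written down explicitly,
as modules of small labelled graphs, for three arrows out of or into a vertex, for a branching
vertex with an arrow on the other side, and for walks with two turns (including parallel arrows). A
finite quiver avoiding all of these has only components of the four types
(`IsTame.exists_components`). Finally two arrows with a common source give `s(X) = 1`, `s(U) ≥ 2`,
`s(X / U) ≥ 1`, and two with a common target give the reverse. Each alone prevents `D_1` from being
an ideal, and both together prevent `D_r` from being a subring for every `r ≥ 2`. -/

/-! ## Uniform and hollow modules -/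

/-- Any two nonzero submodules intersect nontrivially. -/
def IsUniformModule (A : Type*) (M : Type*) [Ring A] [AddCommGroup M] [Module A M] : Prop :=
  ∀ U W : Submodule A M, U ⊓ W = ⊥ → U = ⊥ ∨ W = ⊥

/-- The sum of two proper submodules is a proper submodule. -/
def IsHollowModule (A : Type*) (M : Type*) [Ring A] [AddCommGroup M] [Module A M] : Prop :=
  ∀ U W : Submodule A M, U ⊔ W = ⊤ → U = ⊤ ∨ W = ⊤

section UniformHollow

variable {R M N : Type*} [Ring R] [AddCommGroup M] [Module R M] [AddCommGroup N] [Module R N]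

theorem IsHollowModule.of_surjective (h : IsHollowModule R M) (f : M →ₗ[R] N)
    (hf : Function.Surjective f) : IsHollowModule R N := by
  intro U W hUW
  have key : ∀ V : Submodule R N, V.comap f = ⊤ → V = ⊤ := fun V hV => by
    rw [← Submodule.map_comap_eq_of_surjective hf V, hV, Submodule.map_top,
      LinearMap.range_eq_top.2 hf]
  refine (h (U.comap f) (W.comap f) ?_).imp (key U) (key W)
  rw [eq_top_iff]
  rintro x -
  have hx : f x ∈ U ⊔ W := by simp [hUW]
  obtain ⟨a, ha, b, hb, hab⟩ := Submodule.mem_sup.1 hx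
  obtain ⟨a', rfl⟩ := hf a
  rw [← sub_add_cancel x a', add_comm]
  refine Submodule.add_mem_sup (show f a' ∈ U from ha) (show f (x - a') ∈ W from ?_)
  rw [map_sub, ← hab, add_sub_cancel_left]
  exact hb

theorem IsUniformModule.of_injective (h : IsUniformModule R M) (f : N →ₗ[R] M)
    (hf : Function.Injective f) : IsUniformModule R N := by
  intro U W hUW
  have key : ∀ V : Submodule R N, V.map f = ⊥ → V = ⊥ := fun V hV => by
    refine (Submodule.eq_bot_iff V).2 fun x hx => hf ?_
    rw [map_zero, ← Submodule.mem_bot R, ← hV]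
    exact Submodule.mem_map_of_mem hx
  refine (h (U.map f) (W.map f) ?_).imp (key U) (key W)
  rw [← Submodule.map_inf f hf, hUW, Submodule.map_bot]

/-- Complements exist in a semisimple module, so a nonzero proper submodule would give a
decomposition violating either condition. -/
theorem length_le_one_of_isSemisimpleModule [IsSemisimpleModule R M]
    (h : IsHollowModule R M ∨ IsUniformModule R M) : Module.length R M ≤ 1 := by
  rcases subsingleton_or_nontrivial M with hM | hM
  · simp [Module.length_eq_zero]
  · have : IsSimpleModule R M := by
      refine (isSimpleModule_iff R M).2 ⟨fun U => ?_⟩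
      obtain ⟨W, hW⟩ := exists_isCompl U
      rcases h with h | h
      · rcases h U W hW.sup_eq_top with h | h
        · exact .inr h
        · subst h
          exact .inl (by simpa using hW.inf_eq_bot)
      · rcases h U W hW.inf_eq_bot with h | h
        · exact .inl h
        · subst h
          exact .inr (by simpa using hW.sup_eq_top)
    exact (Module.length_eq_one R M).le

theorem length_pi_le_card {ι : Type*} [Fintype ι] (S : ι → Type*) [∀ i, AddCommGroup (S i)]
    [∀ i, Module R (S i)] (h : ∀ i, Module.length R (S i) ≤ 1) :
    Module.length R (∀ i, S i) ≤ Fintype.card ι := by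
  rw [Module.length_pi_of_fintype]
  refine (Finset.sum_le_sum fun i _ => h i).trans ?_
  simp

theorem length_pi_eq_card {ι : Type*} [Fintype ι] (S : ι → Type*) [∀ i, AddCommGroup (S i)]
    [∀ i, Module R (S i)] [∀ i, IsSimpleModule R (S i)] :
    Module.length R (∀ i, S i) = Fintype.card ι := by
  rw [Module.length_pi_of_fintype]
  simp [Module.length_eq_one]

/-- If `M` is a sum of `n` hollow submodules, and maps onto a product of `m` nonzero finitely
generated modules, then `m ≤ n`. -/
theorem card_le_card_of_isHollowModule {ι κ : Type*} [Fintype ι] [Fintype κ]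
    (X : ι → Submodule R M) (hX : ⨆ i, X i = ⊤) (hh : ∀ i, IsHollowModule R (X i))
    (Y : κ → Type*) [∀ j, AddCommGroup (Y j)] [∀ j, Module R (Y j)] [∀ j, Nontrivial (Y j)]
    [∀ j, Module.Finite R (Y j)] (f : M →ₗ[R] ∀ j, Y j) (hf : Function.Surjective f) :
    Fintype.card κ ≤ Fintype.card ι := by
  classical
  -- Simple quotients of the `Y j` turn the target into a semisimple module of length exactly `|κ|`.
  -- It is the sum of the images of the `X i`, and each image is semisimple and hollow, hence of
  -- length at most one.
  have hm : ∀ j, ∃ m : Submodule R (Y j), IsCoatom m := fun j => by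
    obtain ⟨m, hm, -⟩ := (eq_top_or_exists_le_coatom (⊥ : Submodule R (Y j))).resolve_left
      bot_ne_top
    exact ⟨m, hm⟩
  choose m hm using hm
  have : ∀ j, IsSimpleModule R (Y j ⧸ m j) := fun j => isSimpleModule_iff_isCoatom.2 (hm j)
  let g : M →ₗ[R] ∀ j, (Y j ⧸ m j) := (LinearMap.pi fun j => (m j).mkQ ∘ₗ LinearMap.proj j) ∘ₗ f
  have hg : Function.Surjective g := by
    intro y
    choose z hz using fun j => (m j).mkQ_surjective (y j)
    obtain ⟨x, hx⟩ := hf z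
    refine ⟨x, funext fun j => ?_⟩
    simp [g, hx, ← hz]
  let h : ∀ i, X i →ₗ[R] ∀ j, (Y j ⧸ m j) := fun i => g ∘ₗ (X i).subtype
  let t : (∀ i, LinearMap.range (h i)) →ₗ[R] ∀ j, (Y j ⧸ m j) :=
    ∑ i, (LinearMap.range (h i)).subtype ∘ₗ LinearMap.proj i
  have ht : Function.Surjective t := by
    rw [← LinearMap.range_eq_top, eq_top_iff, ← LinearMap.range_eq_top.2 hg,
      LinearMap.range_eq_map, ← hX, Submodule.map_iSup, iSup_le_iff]
    rintro i _ ⟨x, hx, rfl⟩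
    refine ⟨Pi.single i ⟨g x, ⟨⟨x, hx⟩, rfl⟩⟩, ?_⟩
    simp only [t, LinearMap.sum_apply, LinearMap.comp_apply, LinearMap.proj_apply]
    rw [Finset.sum_eq_single i]
    · simp
    · intro j _ hj
      simp [hj]
    · simp
  have h1 := Module.length_le_of_surjective t ht
  rw [length_pi_eq_card] at h1
  have h2 : Module.length R (∀ i, LinearMap.range (h i)) ≤ Fintype.card ι :=
    length_pi_le_card _ fun i => length_le_one_of_isSemisimpleModule
      (.inl ((hh i).of_surjective _ (h i).surjective_rangeRestrict))
  exact_mod_cast h1.trans h2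

/-- If `M` embeds in a product of `n` uniform modules, and contains a direct sum of `m` nonzero
artinian modules, then `m ≤ n`. -/
theorem card_le_card_of_isUniformModule {ι κ : Type*} [Fintype ι] [Fintype κ]
    (X : ι → Type*) [∀ i, AddCommGroup (X i)] [∀ i, Module R (X i)]
    (f : M →ₗ[R] ∀ i, X i) (hf : Function.Injective f) (hu : ∀ i, IsUniformModule R (X i))
    (Y : κ → Type*) [∀ j, AddCommGroup (Y j)] [∀ j, Module R (Y j)] [∀ j, Nontrivial (Y j)]
    [∀ j, IsArtinian R (Y j)] (g : (∀ j, Y j) →ₗ[R] M) (hg : Function.Injective g) :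
    Fintype.card κ ≤ Fintype.card ι := by
  classical
  -- Dually, simple submodules of the `Y j` give a semisimple module of length `|κ|` that embeds in
  -- the product of its images in the `X i`; each image is semisimple and uniform.
  have hm : ∀ j, ∃ m : Submodule R (Y j), IsAtom m := fun j => by
    obtain ⟨m, hm, -⟩ := (eq_bot_or_exists_atom_le (⊤ : Submodule R (Y j))).resolve_left
      top_ne_bot
    exact ⟨m, hm⟩
  choose m hm using hm
  have : ∀ j, IsSimpleModule R (m j) := fun j => isSimpleModule_iff_isAtom.2 (hm j)
  let s : (∀ j, m j) →ₗ[R] ∀ i, X i :=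
    f ∘ₗ g ∘ₗ LinearMap.pi fun j => (m j).subtype ∘ₗ LinearMap.proj j
  have hs : Function.Injective s := by
    refine hf.comp (hg.comp ?_)
    intro x y hxy
    ext j
    exact congrFun hxy j
  let h : ∀ i, (∀ j, m j) →ₗ[R] X i := fun i => LinearMap.proj i ∘ₗ s
  let t : (∀ j, m j) →ₗ[R] ∀ i, LinearMap.range (h i) := LinearMap.pi fun i => (h i).rangeRestrict
  have ht : Function.Injective t := by
    intro x y hxy
    refine hs (funext fun i => ?_)
    exact congrArg Subtype.val (congrFun hxy i)
  have h1 := Module.length_le_of_injective t ht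
  rw [length_pi_eq_card] at h1
  have h2 : Module.length R (∀ i, LinearMap.range (h i)) ≤ Fintype.card ι :=
    length_pi_le_card _ fun i => have := IsSemisimpleModule.range (h i)
      length_le_one_of_isSemisimpleModule (.inr ((hu i).of_injective _ (LinearMap.range (h i)).injective_subtype))
  exact_mod_cast h1.trans h2

end UniformHollow

/-! ## Decompositions into indecomposable modules -/

section Decompositions

variable {A : Type u} {M N : Type w} [Ring A] [AddCommGroup M] [Module A M]
  [AddCommGroup N] [Module A N]

theorem IsIndecomposableModule.congr (e : M ≃ₗ[A] N) (h : IsIndecomposableModule A M) :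
    IsIndecomposableModule A N := by
  obtain ⟨h1, h2⟩ := h
  refine ⟨e.symm.toEquiv.nontrivial, fun U W hUW => ?_⟩
  have key : ∀ V : Submodule A N, V.map (e.symm : N →ₗ[A] M) = ⊥ → V = ⊥ := fun V hV => by
    refine (Submodule.eq_bot_iff V).2 fun x hx => e.symm.injective ?_
    rw [map_zero, ← Submodule.mem_bot A, ← hV]
    exact Submodule.mem_map_of_mem hx
  exact (h2 _ _ (hUW.map (Submodule.orderIsoMapComap e.symm))).imp (key U) (key W)

/-- A complete family of orthogonal idempotent endomorphisms with indecomposable images. -/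
def IsPrimitiveFamily {ι : Type*} [Fintype ι] (e : ι → Module.End A M) : Prop :=
  CompleteOrthogonalIdempotents e ∧ ∀ i, IsIndecomposableModule A (LinearMap.range (e i))

theorem isInternal_range {ι : Type*} [Fintype ι] [DecidableEq ι] {e : ι → Module.End A M}
    (he : CompleteOrthogonalIdempotents e) :
    DirectSum.IsInternal fun i => LinearMap.range (e i) := by
  have hsum : ∀ x, ∑ i, e i x = x := fun x => by
    rw [← LinearMap.sum_apply, he.complete, Module.End.one_apply]
  constructor
  · rw [injective_iff_map_eq_zero]
    intro x hx
    classical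
    rw [DirectSum.coeAddMonoidHom_eq_dfinsuppSum, DFinsupp.sum_eq_sum_fintype _ fun _ => rfl]
      at hx
    replace hx : ∑ i, (x i : M) = 0 := hx
    ext j
    have h := congrArg (e j) hx
    rw [map_sum, Finset.sum_eq_single j, map_zero] at h
    · obtain ⟨y, hy⟩ := (x j).2
      rw [← hy, ← Module.End.mul_apply, (he.idem j).eq, hy] at h
      simpa using h
    · intro i _ hij
      obtain ⟨y, hy⟩ := (x i).2
      rw [← hy, ← Module.End.mul_apply, he.ortho hij.symm, LinearMap.zero_apply]
    · simp
  · intro x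
    refine ⟨∑ i, DirectSum.of (fun i => LinearMap.range (e i)) i ⟨e i x, x, rfl⟩, ?_⟩
    rw [map_sum]
    simp [hsum]

theorem IsPrimitiveFamily.isSumOfIndecomposables {n : ℕ} {e : Fin n → Module.End A M}
    (he : IsPrimitiveFamily e) : IsSumOfIndecomposables A M n :=
  ⟨fun i => LinearMap.range (e i), he.2, isInternal_range he.1⟩

/-- Translates decompositions into idempotents, so that the number of summands can be counted inside
the endomorphism ring. -/
theorem IsSumOfIndecomposables.exists_isPrimitiveFamily {n : ℕ}
    (h : IsSumOfIndecomposables A M n) :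
    ∃ e : Fin n → Module.End A M, IsPrimitiveFamily e := by
  obtain ⟨U, hU, hint⟩ := h
  let φ : (DirectSum (Fin n) fun i => U i) ≃ₗ[A] M :=
    LinearEquiv.ofBijective (DirectSum.coeLinearMap U) hint
  have hφ : ∀ i (x : U i), φ (DirectSum.lof A (Fin n) (fun i => U i) i x) = x := fun i x =>
    DirectSum.coeLinearMap_lof U i x
  have hφ' : ∀ i (x : U i), φ.symm x = DirectSum.lof A (Fin n) (fun i => U i) i x := fun i x => by
    rw [LinearEquiv.symm_apply_eq, hφ]
  let e : Fin n → Module.End A M := fun i =>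
    (U i).subtype ∘ₗ DirectSum.component A (Fin n) (fun i => U i) i ∘ₗ φ.symm.toLinearMap
  have he : ∀ i (x : U i), e i x = x := fun i x => by
    simp [e, hφ', DirectSum.component.lof_self]
  have he' : ∀ i j (x : U j), i ≠ j → e i x = 0 := fun i j x hij => by
    simp only [e, LinearMap.comp_apply, LinearEquiv.coe_coe, hφ']
    rw [DirectSum.component.of, dif_neg hij.symm, map_zero]
  have hmem : ∀ i x, e i x ∈ U i := fun i x => Submodule.coe_mem _
  refine ⟨e, ⟨⟨⟨fun i => ?_, fun i j hij => ?_⟩, ?_⟩, fun i => ?_⟩⟩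
  · exact LinearMap.ext fun x => he i ⟨_, hmem i x⟩
  · exact LinearMap.ext fun x => he' i j ⟨_, hmem j x⟩ hij
  · have : ∀ y : DirectSum (Fin n) fun i => U i, (∑ i, e i) (φ y) = φ y := by
      intro y
      induction y using DirectSum.induction_on with
      | zero => simp
      | of i x =>
        have h1 := hφ i x
        rw [DirectSum.lof_eq_of] at h1
        rw [h1, LinearMap.sum_apply, Finset.sum_eq_single i, he]
        · exact fun j _ hj => he' _ _ _ hj
        · simp
      | add x y hx hy => rw [map_add, map_add, hx, hy]
    ext x
    simpa using this (φ.symm x)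
  · have : LinearMap.range (e i) = U i := by
      apply le_antisymm
      · rintro _ ⟨x, rfl⟩
        exact hmem i x
      · exact fun x hx => ⟨x, he i ⟨x, hx⟩⟩
    rw [this]
    exact hU i

theorem IsPrimitiveFamily.equiv {ι κ : Type*} [Fintype ι] [Fintype κ] {e : ι → Module.End A M}
    (he : IsPrimitiveFamily e) (f : κ ≃ ι) : IsPrimitiveFamily (e ∘ f) :=
  ⟨(CompleteOrthogonalIdempotents.equiv f).2 he.1, fun i => he.2 (f i)⟩

/-- The endomorphism ring of an indecomposable module of finite length is local. -/
theorem IsIndecomposableModule.isUnit_or_isUnit_one_sub [IsArtinian A M] [IsNoetherian A M]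
    (h : IsIndecomposableModule A M) (x : Module.End A M) : IsUnit x ∨ IsUnit (1 - x) := by
  -- Fitting's lemma: kernel and range of a high power are complementary, so one of them is zero.
  -- The exponent `n + 1` below is positive, which lets one factor `x` be split off.
  obtain ⟨n, hn⟩ := Filter.eventually_atTop.1 x.eventually_isCompl_ker_pow_range_pow
  have hn' := hn (n + 1) (by omega)
  rcases h.2 _ _ hn' with h | h
  · left
    have hinj : Function.Injective x := by
      rw [LinearMap.ker_eq_bot, pow_succ, Module.End.mul_eq_comp, LinearMap.coe_comp] at h
      exact h.of_comp
    exact (Module.End.isUnit_iff x).2 (IsArtinian.bijective_of_injective_endomorphism x hinj)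
  · right
    exact IsNilpotent.isUnit_one_sub ⟨n + 1, LinearMap.range_eq_bot.1 h⟩

/-- The conditions on `x` place it in the corner ring of `e`, which is the endomorphism ring of the
range of `e` and therefore local: `x` or `e - x` is invertible there. -/
theorem exists_mul_eq_or_exists_mul_sub_eq [IsArtinian A M] [IsNoetherian A M]
    {e x : Module.End A M} (he : IsIdempotentElem e)
    (hi : IsIndecomposableModule A (LinearMap.range e)) (h1 : e * x = x) (h2 : x * e = x) :
    (∃ g, g * x = e) ∨ ∃ g, g * (e - x) = e := by
  have key : ∀ y : Module.End A M, e * y = y → y * e = y →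
      ∀ z : Module.End A (LinearMap.range e), (∀ t, (z t : M) = y t) → IsUnit z →
      ∃ g, g * y = e := by
    rintro y hy1 hy2 z hz ⟨z, rfl⟩
    refine ⟨(LinearMap.range e).subtype ∘ₗ (↑z⁻¹ : Module.End A (LinearMap.range e)) ∘ₗ
      e.rangeRestrict, LinearMap.ext fun m => ?_⟩
    have h3 : e.rangeRestrict (y m) = z.1 (e.rangeRestrict m) := by
      ext
      rw [hz]
      change (e * y) m = (y * e) m
      rw [hy1, hy2]
    change (((↑z⁻¹ : Module.End A (LinearMap.range e)) (e.rangeRestrict (y m)) :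
      LinearMap.range e) : M) = e m
    rw [h3, ← Module.End.mul_apply, Units.inv_mul]
    rfl
  have hx : ∀ t ∈ LinearMap.range e, x t ∈ LinearMap.range e := fun t _ =>
    ⟨x t, congrArg (fun f : Module.End A M => f t) h1⟩
  refine (hi.isUnit_or_isUnit_one_sub (x.restrict hx)).imp (fun h => ?_) fun h => ?_
  · exact key x h1 h2 _ (fun t => rfl) h
  · refine key (e - x) (by rw [mul_sub, he.eq, h1]) (by rw [sub_mul, he.eq, h2]) _ (fun t => ?_) h
    obtain ⟨t, s, rfl⟩ := t
    change e s - x (e s) = e (e s) - x (e s)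
    rw [← Module.End.mul_apply e e, he.eq]

/-- If `e = a + b` with `a` and `b` in two submodules of the left ideal generated by `e`, then `e *
a` and `e * b` lie in the local corner ring and add up to its identity. One of them is invertible,
so its submodule contains `e`. -/
theorem isHollowModule_span_singleton [IsArtinian A M] [IsNoetherian A M]
    {e : Module.End A M} (he : IsIdempotentElem e)
    (hi : IsIndecomposableModule A (LinearMap.range e)) :
    IsHollowModule (Module.End A M) (Submodule.span (Module.End A M) {e}) := by
  intro U W hUW
  have hself : e ∈ Submodule.span (Module.End A M) {e} := Submodule.mem_span_singleton_self e
  have htop : ∀ V : Submodule (Module.End A M) (Submodule.span (Module.End A M) {e}),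
      (⟨e, hself⟩ : Submodule.span (Module.End A M) {e}) ∈ V → V = ⊤ := by
    intro V hV
    rw [eq_top_iff]
    rintro ⟨y, hy⟩ -
    obtain ⟨a, rfl⟩ := Submodule.mem_span_singleton.1 hy
    exact V.smul_mem a hV
  have hmul : ∀ y : Submodule.span (Module.End A M) {e}, (y : Module.End A M) * e = y := by
    rintro ⟨y, hy⟩
    obtain ⟨a, rfl⟩ := Submodule.mem_span_singleton.1 hy
    change a * e * e = a * e
    rw [mul_assoc, he.eq]
  have hmem : (⟨e, hself⟩ : Submodule.span (Module.End A M) {e}) ∈ U ⊔ W := by simp [hUW]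
  obtain ⟨a, ha, b, hb, hab⟩ := Submodule.mem_sup.1 hmem
  have hab' : (a : Module.End A M) + b = e := congrArg Subtype.val hab
  have hb' : e * (b : Module.End A M) = e - e * (a : Module.End A M) := by
    rw [eq_sub_iff_add_eq', ← mul_add, hab', he.eq]
  rcases exists_mul_eq_or_exists_mul_sub_eq he hi (x := e * (a : Module.End A M))
    (by rw [← mul_assoc, he.eq]) (by rw [mul_assoc, hmul]) with ⟨g, hg⟩ | ⟨g, hg⟩
  · left
    refine htop U ?_
    convert U.smul_mem (g * e) ha using 1
    ext1
    change e = g * e * (a : Module.End A M)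
    rw [mul_assoc, hg]
  · right
    refine htop W ?_
    convert W.smul_mem (g * e) hb using 1
    ext1
    change e = g * e * (b : Module.End A M)
    rw [mul_assoc, hb', hg]

/-- The numerical part of Krull–Schmidt: the endomorphism ring is the sum of the hollow left ideals
of the `e i` and maps onto the product of the nonzero cyclic left ideals of the `f j`, so the hollow
count applies. -/
theorem card_le_of_isPrimitiveFamily [IsArtinian A M] [IsNoetherian A M] {ι κ : Type*}
    [Fintype ι] [Fintype κ] {e : ι → Module.End A M} (he : IsPrimitiveFamily e)
    {f : κ → Module.End A M} (hf : CompleteOrthogonalIdempotents f) (hf0 : ∀ j, f j ≠ 0) :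
    Fintype.card κ ≤ Fintype.card ι := by
  classical
  let E := Module.End A M
  have h0 : ∀ j, Nontrivial (Submodule.span E {f j}) := fun j =>
    Submodule.nontrivial_iff_ne_bot.2 fun h => hf0 j (Submodule.span_singleton_eq_bot.1 h)
  refine card_le_card_of_isHollowModule (R := E) (M := E) (fun i => Submodule.span E {e i}) ?_
    (fun i => isHollowModule_span_singleton (he.1.idem i) (he.2 i))
    (fun j => Submodule.span E {f j})
    (LinearMap.pi fun j => LinearMap.codRestrict _ (LinearMap.toSpanSingleton E E (f j))
      fun g => Submodule.mem_span_singleton.2 ⟨g, rfl⟩) ?_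
  · rw [eq_top_iff]
    rintro g -
    rw [← mul_one g, ← he.1.complete, Finset.mul_sum]
    refine Submodule.sum_mem _ fun i _ => ?_
    exact Submodule.mem_iSup_of_mem i (Submodule.mem_span_singleton.2 ⟨g, rfl⟩)
  · intro y
    choose a ha using fun j => Submodule.mem_span_singleton.1 (y j).2
    refine ⟨∑ i, a i * f i, funext fun j => Subtype.ext ?_⟩
    change (∑ i, a i * f i) * f j = y j
    rw [Finset.sum_mul, Finset.sum_eq_single j, mul_assoc, (hf.idem j).eq, ← ha j, smul_eq_mul]
    · intro i _ hij
      rw [mul_assoc, hf.ortho hij, mul_zero]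
    · simp

theorem IsPrimitiveFamily.ne_zero {ι : Type*} [Fintype ι] {e : ι → Module.End A M}
    (he : IsPrimitiveFamily e) (i : ι) : e i ≠ 0 := by
  intro h
  have := (he.2 i).1
  rw [h, LinearMap.range_zero] at this
  exact not_subsingleton (⊥ : Submodule A M) inferInstance

theorem IsPrimitiveFamily.isSumOfIndecomposables_card {ι : Type*} [Fintype ι]
    {e : ι → Module.End A M} (he : IsPrimitiveFamily e) :
    IsSumOfIndecomposables A M (Fintype.card ι) :=
  (he.equiv (Fintype.equivFin ι).symm).isSumOfIndecomposables

theorem IsPrimitiveFamily.numIndecomposables_eq [IsArtinian A M] [IsNoetherian A M] {ι : Type*}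
    [Fintype ι] {e : ι → Module.End A M} (he : IsPrimitiveFamily e) :
    numIndecomposables A M = Fintype.card ι := by
  refine le_antisymm (Nat.sInf_le he.isSumOfIndecomposables_card) ?_
  -- The set is nonempty, so the infimum is attained and is not the default value `0`.
  have hmem : numIndecomposables A M ∈ {n : ℕ | IsSumOfIndecomposables A M n} :=
    Nat.sInf_mem ⟨_, he.isSumOfIndecomposables_card⟩
  obtain ⟨f, hf⟩ := IsSumOfIndecomposables.exists_isPrimitiveFamily hmem
  simpa using card_le_of_isPrimitiveFamily hf he.1 he.ne_zero

theorem IsPrimitiveFamily.congr {ι : Type*} [Fintype ι] {e : ι → Module.End A M}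
    (he : IsPrimitiveFamily e) (φ : M ≃ₗ[A] N) :
    IsPrimitiveFamily fun i => φ.conjRingEquiv (e i) := by
  refine ⟨he.1.map φ.conjRingEquiv.toRingHom, fun i => (he.2 i).congr ?_⟩
  refine (φ.submoduleMap (LinearMap.range (e i))).trans (LinearEquiv.ofEq _ _ ?_)
  ext y
  constructor
  · rintro ⟨_, ⟨x, rfl⟩, rfl⟩
    exact ⟨φ x, by simp [LinearEquiv.conjRingEquiv]⟩
  · rintro ⟨x, rfl⟩
    exact ⟨e i (φ.symm x), ⟨_, rfl⟩, rfl⟩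

theorem IsPrimitiveFamily.prod {ι κ : Type*} [Fintype ι] [Fintype κ] {e : ι → Module.End A M}
    (he : IsPrimitiveFamily e) {f : κ → Module.End A N} (hf : IsPrimitiveFamily f) :
    IsPrimitiveFamily (Sum.elim (fun i => LinearMap.prodMap (e i) (0 : Module.End A N))
      fun j => LinearMap.prodMap (0 : Module.End A M) (f j)) := by
  have hmul : ∀ (a c : Module.End A M) (b d : Module.End A N),
      (LinearMap.prodMap a b : Module.End A (M × N)) * LinearMap.prodMap c d =
        LinearMap.prodMap (a * c) (b * d) := fun a c b d => by ext <;> simp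
  refine ⟨CompleteOrthogonalIdempotents.iff_ortho_complete.2 ⟨?_, ?_⟩, ?_⟩
  · rintro (i | i) (j | j) hij <;> simp only [Sum.elim_inl, Sum.elim_inr, hmul]
    · rw [he.1.ortho (fun h => hij (by rw [h])), mul_zero, LinearMap.prodMap_zero]
    · simp
    · simp
    · rw [hf.1.ortho (fun h => hij (by rw [h])), mul_zero, LinearMap.prodMap_zero]
  · rw [Fintype.sum_sum_type]
    refine LinearMap.ext fun x => Prod.ext ?_ ?_
    · have := congrArg (fun g : Module.End A M => g x.1) he.1.complete
      simpa [Prod.fst_sum] using this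
    · have := congrArg (fun g : Module.End A N => g x.2) hf.1.complete
      simpa [Prod.snd_sum] using this
  · have h1 : ∀ a : Module.End A M, LinearMap.range (LinearMap.prodMap a (0 : Module.End A N)) =
        (LinearMap.range a).map (LinearMap.inl A M N) := fun a => by
      ext ⟨x, y⟩
      simp [eq_comm]
    have h2 : ∀ a : Module.End A N, LinearMap.range (LinearMap.prodMap (0 : Module.End A M) a) =
        (LinearMap.range a).map (LinearMap.inr A M N) := fun a => by
      ext ⟨x, y⟩
      simp [eq_comm]
    rintro (i | i)
    · exact h1 (e i) ▸ (he.2 i).congr (Submodule.equivMapOfInjective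
        (LinearMap.inl A M N) LinearMap.inl_injective _)
    · exact h2 (f i) ▸ (hf.2 i).congr (Submodule.equivMapOfInjective
        (LinearMap.inr A M N) LinearMap.inr_injective _)

theorem isPrimitiveFamily_of_isIndecomposableModule (h : IsIndecomposableModule A M) :
    IsPrimitiveFamily fun _ : Unit => (1 : Module.End A M) := by
  refine ⟨CompleteOrthogonalIdempotents.unique_iff.2 rfl, fun _ => h.congr ?_⟩
  exact Submodule.topEquiv.symm.trans (LinearEquiv.ofEq _ _ LinearMap.range_id.symm)

theorem isPrimitiveFamily_of_subsingleton [Subsingleton M] :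
    IsPrimitiveFamily fun i : Empty => (i.elim : Module.End A M) :=
  ⟨CompleteOrthogonalIdempotents.of_subsingleton, fun i => i.elim⟩

variable (A M) in
theorem exists_isPrimitiveFamily [IsArtinian A M] :
    ∃ (n : ℕ) (e : Fin n → Module.End A M), IsPrimitiveFamily e := by
  -- Working with submodules of `M` makes the descending chain condition available: both parts of a
  -- decomposition of `U` are strictly smaller submodules of `M`.
  suffices h : ∀ U : Submodule A M, ∃ (n : ℕ) (e : Fin n → Module.End A U),
      IsPrimitiveFamily e by
    obtain ⟨n, e, he⟩ := h ⊤
    exact ⟨n, _, he.congr Submodule.topEquiv⟩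
  intro U
  induction U using WellFoundedLT.induction with
  | ind U ih =>
    by_cases hU : U = ⊥
    · subst hU
      exact ⟨_, _, isPrimitiveFamily_of_subsingleton.equiv (Fintype.equivFin Empty).symm⟩
    by_cases hi : IsIndecomposableModule A U
    · exact ⟨_, _, (isPrimitiveFamily_of_isIndecomposableModule hi).equiv
        (Fintype.equivFin Unit).symm⟩
    have hU' : Nontrivial U := Submodule.nontrivial_iff_ne_bot.2 hU
    simp only [IsIndecomposableModule, hU', true_and, not_forall, not_or] at hi
    obtain ⟨V, W, hVW, hV, hW⟩ := hi
    have hlt : ∀ V W : Submodule A U, IsCompl V W → W ≠ ⊥ → V.map U.subtype < U := by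
      intro V W hVW hW
      refine lt_of_le_of_ne (Submodule.map_subtype_le U V) fun h => hW ?_
      have hV : V = ⊤ := by
        refine Submodule.map_injective_of_injective U.injective_subtype ?_
        simpa using h
      subst hV
      simpa using hVW.inf_eq_bot
    obtain ⟨n, e, he⟩ := ih _ (hlt V W hVW hW)
    obtain ⟨m, f, hf⟩ := ih _ (hlt W V hVW.symm hV)
    have hVe := he.congr (U.equivSubtypeMap V).symm
    have hWe := hf.congr (U.equivSubtypeMap W).symm
    exact ⟨_, _, ((hVe.prod hWe).congr (Submodule.prodEquivOfIsCompl V W hVW)).equiv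
      (Fintype.equivFin (Fin n ⊕ Fin m)).symm⟩

theorem numIndecomposables_congr [IsArtinian A M] [IsNoetherian A M] (φ : M ≃ₗ[A] N) :
    numIndecomposables A M = numIndecomposables A N := by
  obtain ⟨n, e, he⟩ := exists_isPrimitiveFamily A M
  have : IsArtinian A N := isArtinian_of_linearEquiv φ
  have : IsNoetherian A N := isNoetherian_of_linearEquiv φ
  rw [he.numIndecomposables_eq, (he.congr φ).numIndecomposables_eq]

variable (A M N) in
theorem numIndecomposables_prod [IsArtinian A M] [IsNoetherian A M] [IsArtinian A N]
    [IsNoetherian A N] :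
    numIndecomposables A (M × N) = numIndecomposables A M + numIndecomposables A N := by
  obtain ⟨n, e, he⟩ := exists_isPrimitiveFamily A M
  obtain ⟨m, f, hf⟩ := exists_isPrimitiveFamily A N
  rw [he.numIndecomposables_eq, hf.numIndecomposables_eq, (he.prod hf).numIndecomposables_eq,
    Fintype.card_sum]

theorem numIndecomposables_of_isIndecomposableModule [IsArtinian A M] [IsNoetherian A M]
    (h : IsIndecomposableModule A M) : numIndecomposables A M = 1 :=
  (isPrimitiveFamily_of_isIndecomposableModule h).numIndecomposables_eq

theorem numIndecomposables_pos [IsArtinian A M] [IsNoetherian A M] [Nontrivial M] :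
    0 < numIndecomposables A M := by
  obtain ⟨n, e, he⟩ := exists_isPrimitiveFamily A M
  rw [he.numIndecomposables_eq, Fintype.card_pos_iff]
  by_contra h
  rw [not_nonempty_iff] at h
  have h1 := he.1.complete
  rw [Finset.univ_eq_empty, Finset.sum_empty] at h1
  exact zero_ne_one h1

theorem numIndecomposables_of_subsingleton [IsArtinian A M] [IsNoetherian A M] [Subsingleton M] :
    numIndecomposables A M = 0 :=
  (isPrimitiveFamily_of_subsingleton (A := A) (M := M)).numIndecomposables_eq

theorem two_le_numIndecomposables_of_isCompl [IsArtinian A M] [IsNoetherian A M]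
    {U W : Submodule A M} (h : IsCompl U W) (hU : U ≠ ⊥) (hW : W ≠ ⊥) :
    2 ≤ numIndecomposables A M := by
  rw [← numIndecomposables_congr (Submodule.prodEquivOfIsCompl U W h), numIndecomposables_prod]
  have := Submodule.nontrivial_iff_ne_bot.2 hU
  have := Submodule.nontrivial_iff_ne_bot.2 hW
  have h1 := numIndecomposables_pos (A := A) (M := U)
  have h2 := numIndecomposables_pos (A := A) (M := W)
  omega

theorem isIndecomposableModule_of_numIndecomposables [IsArtinian A M] [IsNoetherian A M]
    (h : numIndecomposables A M = 1) : IsIndecomposableModule A M := by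
  refine ⟨?_, fun U W hUW => ?_⟩
  · by_contra hn
    rw [not_nontrivial_iff_subsingleton] at hn
    rw [numIndecomposables_of_subsingleton] at h
    exact zero_ne_one h
  · by_contra! hn
    have := two_le_numIndecomposables_of_isCompl hUW hn.1 hn.2
    omega

theorem IsPrimitiveFamily.surjective {ι : Type*} [Fintype ι] {e : ι → Module.End A M}
    (he : CompleteOrthogonalIdempotents e) :
    Function.Surjective (LinearMap.pi fun i => (e i).rangeRestrict) := by
  intro y
  choose x hx using fun i => (y i).2
  refine ⟨∑ i, e i (x i), funext fun j => Subtype.ext ?_⟩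
  change e j (∑ i, e i (x i)) = y j
  rw [map_sum, Finset.sum_eq_single j, ← Module.End.mul_apply, (he.idem j).eq, hx]
  · intro i _ hij
    rw [← Module.End.mul_apply, he.ortho hij.symm, LinearMap.zero_apply]
  · simp

theorem IsPrimitiveFamily.injective {ι : Type*} [Fintype ι] {e : ι → Module.End A M}
    (he : CompleteOrthogonalIdempotents e) :
    Function.Injective (LinearMap.pi fun i => (e i).rangeRestrict) := by
  intro x y hxy
  have h : ∀ i, e i x = e i y := fun i => congrArg Subtype.val (congrFun hxy i)
  have h1 : ∀ x, ∑ i, e i x = x := fun x => by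
    rw [← LinearMap.sum_apply, he.complete, Module.End.one_apply]
  rw [← h1 x, ← h1 y]
  exact Finset.sum_congr rfl fun i _ => h i

/-- If the indecomposable summands of `X` are uniform, then a submodule of `X` does not have more
indecomposable summands than `X`. -/
theorem numIndecomposables_submodule_le [IsArtinian A M] [IsNoetherian A M]
    (h : ∀ U : Submodule A M, IsIndecomposableModule A U → IsUniformModule A U)
    (V : Submodule A M) : numIndecomposables A V ≤ numIndecomposables A M := by
  obtain ⟨n, e, he⟩ := exists_isPrimitiveFamily A M
  obtain ⟨m, f, hf⟩ := exists_isPrimitiveFamily A V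
  rw [he.numIndecomposables_eq, hf.numIndecomposables_eq]
  have : ∀ j, Nontrivial (LinearMap.range (f j)) := fun j => (hf.2 j).1
  let φ := LinearEquiv.ofBijective _
    ⟨IsPrimitiveFamily.injective hf.1, IsPrimitiveFamily.surjective hf.1⟩
  exact card_le_card_of_isUniformModule _ _ (IsPrimitiveFamily.injective he.1)
    (fun i => h _ (he.2 i)) (fun j => LinearMap.range (f j)) (V.subtype ∘ₗ φ.symm.toLinearMap)
    (V.injective_subtype.comp φ.symm.injective)

/-- If the indecomposable summands of `X` are hollow, then a quotient of `X` does not have more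
indecomposable summands than `X`. -/
theorem numIndecomposables_quotient_le [IsArtinian A M] [IsNoetherian A M]
    (h : ∀ U : Submodule A M, IsIndecomposableModule A U → IsHollowModule A U)
    (V : Submodule A M) : numIndecomposables A (M ⧸ V) ≤ numIndecomposables A M := by
  obtain ⟨n, e, he⟩ := exists_isPrimitiveFamily A M
  obtain ⟨m, f, hf⟩ := exists_isPrimitiveFamily A (M ⧸ V)
  rw [he.numIndecomposables_eq, hf.numIndecomposables_eq]
  have : ∀ j, Nontrivial (LinearMap.range (f j)) := fun j => (hf.2 j).1
  exact card_le_card_of_isHollowModule _ (isInternal_range he.1).submodule_iSup_eq_top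
    (fun i => h _ (he.2 i)) (fun j => LinearMap.range (f j))
    ((LinearMap.pi fun i => (f i).rangeRestrict) ∘ₗ V.mkQ)
    ((IsPrimitiveFamily.surjective hf.1).comp V.mkQ_surjective)

end Decompositions

/-! ## The submodules `D_r` of the Hall algebra -/

section HallCriterion

variable {k : Type w} {A : Type u} [Field k] [Ring A] [Algebra k A]

instance (X : FDMod k A) : IsNoetherian A X := isNoetherian_of_tower k inferInstance

instance (X : FDMod k A) : IsArtinian A X := isArtinian_of_tower k inferInstance

/-- A submodule of a finite dimensional module. -/
def FDMod.sub (X : FDMod k A) (U : Submodule A X) : FDMod k A where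
  carrier := U
  finite := inferInstanceAs (Module.Finite k (U.restrictScalars k))

/-- A quotient of a finite dimensional module. -/
def FDMod.quot (X : FDMod k A) (U : Submodule A X) : FDMod k A where
  carrier := X ⧸ U
  finite := Module.Finite.of_surjective (U.mkQ.restrictScalars k) U.mkQ_surjective

/-- The number of indecomposable direct summands of a finite dimensional module. -/
noncomputable abbrev FDMod.s (X : FDMod k A) : ℕ := numIndecomposables A X

theorem FDMod.s_out (X : FDMod k A) :
    numIndecomposables A (Quotient.out (⟦X⟧ : IsoClass k A)).carrier = X.s := by
  obtain ⟨e⟩ := Quotient.mk_out (s := FDMod.setoid) X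
  exact numIndecomposables_congr e

theorem mem_hallD_iff (r : ℕ) (x : HallAlgebra k A) :
    x ∈ hallD k A r ↔ ∀ X : IsoClass k A,
      (show IsoClass k A →₀ HallCoeff k from x) X ≠ 0 → r + 1 ≤ X.out.s := by
  have h : hallD k A r =
      (Finsupp.supported (HallCoeff k) (HallCoeff k) {X : IsoClass k A | r + 1 ≤ X.out.s} :
        Submodule (HallCoeff k) (IsoClass k A →₀ HallCoeff k)) := by
    rw [Finsupp.supported_eq_span_single]
    refine congrArg (Submodule.span (HallCoeff k)) ?_
    ext y
    exact ⟨fun ⟨X, h1, h2⟩ => ⟨X, h1, h2.symm⟩, fun ⟨X, h1, h2⟩ => ⟨X, h1, h2.symm⟩⟩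
  rw [h]
  refine (Finsupp.mem_supported _ _).trans ?_
  exact forall_congr' fun X => imp_congr_left Finsupp.mem_support_iff

theorem cls_mem_hallD {r : ℕ} {X : IsoClass k A} (h : r + 1 ≤ X.out.s) :
    HallAlgebra.cls X ∈ hallD k A r :=
  Submodule.subset_span ⟨X, h, rfl⟩

/-- A product of submodules is isomorphic to their external direct sum. -/
def Submodule.prodEquivProd {R M N : Type*} [Ring R] [AddCommGroup M] [Module R M]
    [AddCommGroup N] [Module R N] (U : Submodule R M) (W : Submodule R N) :
    U.prod W ≃ₗ[R] U × W where
  toFun x := (⟨x.1.1, x.2.1⟩, ⟨x.1.2, x.2.2⟩)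
  invFun x := ⟨(x.1, x.2), x.1.2, x.2.2⟩
  map_add' _ _ := rfl
  map_smul' _ _ := rfl

/-- The quotient by a product of submodules is the direct sum of the quotients. -/
noncomputable def Submodule.quotientProdEquivProd {R M N : Type*} [Ring R] [AddCommGroup M]
    [Module R M] [AddCommGroup N] [Module R N] (U : Submodule R M) (W : Submodule R N) :
    ((M × N) ⧸ U.prod W) ≃ₗ[R] (M ⧸ U) × (N ⧸ W) :=
  (Submodule.quotEquivOfEq _ _ (by ext; simp)).trans
    (LinearMap.quotKerEquivOfSurjective (LinearMap.prodMap U.mkQ W.mkQ)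
      (Function.Surjective.prodMap U.mkQ_surjective W.mkQ_surjective))

/-- A finite dimensional module `X` with a submodule `U` such that `s(X) = a`, `s(U) ≥ b` and
`s(X / U) ≥ c`. -/
def HasExtension (k : Type w) (A : Type u) [Field k] [Ring A] [Algebra k A] (a b c : ℕ) : Prop :=
  ∃ (X : FDMod k A) (U : Submodule A X), X.s = a ∧ b ≤ (X.sub U).s ∧ c ≤ (X.quot U).s

/-- Direct sums of extensions; `s` is additive on the middle term, the submodule and the quotient.
-/
theorem HasExtension.add {a b c a' b' c' : ℕ} (h : HasExtension k A a b c)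
    (h' : HasExtension k A a' b' c') : HasExtension k A (a + a') (b + b') (c + c') := by
  obtain ⟨X, U, h1, h2, h3⟩ := h
  obtain ⟨X', U', h1', h2', h3'⟩ := h'
  refine ⟨⟨X × X'⟩, U.prod U', ?_, ?_, ?_⟩
  · rw [← h1, ← h1']
    exact numIndecomposables_prod A X X'
  · refine (add_le_add h2 h2').trans_eq ?_
    refine (numIndecomposables_prod A (X.sub U) (X'.sub U')).symm.trans ?_
    exact numIndecomposables_congr (Submodule.prodEquivProd U U').symm
  · refine (add_le_add h3 h3').trans_eq ?_
    refine (numIndecomposables_prod A (X.quot U) (X'.quot U')).symm.trans ?_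
    exact numIndecomposables_congr (Submodule.quotientProdEquivProd U U').symm

theorem HasExtension.mul {a b c : ℕ} (h : HasExtension k A a b c) :
    ∀ n : ℕ, HasExtension k A (n * a) (n * b) (n * c)
  | 0 => ⟨⟨PUnit⟩, ⊥, by simpa using numIndecomposables_of_subsingleton, by simp, by simp⟩
  | n + 1 => by
    simp only [add_mul, one_mul]
    exact (HasExtension.mul h n).add h

variable [Finite k]

/-- `X` is a finite set, so the submodules counted are finitely many and `Nat.card` does not
degenerate to `0`. -/
theorem hallNumber_ne_zero_iff (X M N : FDMod k A) :
    hallNumber X M N ≠ 0 ↔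
      ∃ U : Submodule A X, Nonempty (U ≃ₗ[A] N) ∧ Nonempty ((X ⧸ U) ≃ₗ[A] M) := by
  have : Finite X := Module.finite_of_finite k
  have : Finite (Submodule A X) := Finite.of_injective _ SetLike.coe_injective
  rw [hallNumber, Ne, Nat.card_eq_zero, not_or, not_isEmpty_iff, nonempty_subtype]
  have hfin : Finite {U : Submodule A X //
      Nonempty (U ≃ₗ[A] N) ∧ Nonempty ((X ⧸ U) ≃ₗ[A] M)} := inferInstance
  exact and_iff_left (not_infinite_iff_finite.2 hfin)

variable [Algebra.FiniteType k A]

theorem cls_mul_cls_apply (M N X : IsoClass k A) :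
    (show IsoClass k A →₀ HallCoeff k from HallAlgebra.cls M * HallAlgebra.cls N) X =
      (hallNumberClass X M N : HallCoeff k) := by
  rw [HallAlgebra.cls_mul_cls]
  rfl

theorem HallAlgebra.smul_mul' (c : HallCoeff k) (x y : HallAlgebra k A) :
    (c • x) * y = c • (x * y) := by
  change HallAlgebra.mulBilin k A (c • x) y = c • HallAlgebra.mulBilin k A x y
  rw [map_smul, LinearMap.smul_apply]

theorem HallAlgebra.mul_smul' (c : HallCoeff k) (x y : HallAlgebra k A) :
    x * (c • y) = c • (x * y) :=
  map_smul (HallAlgebra.mulBilin k A x) c y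

theorem HallAlgebra.mem_span_cls (x : HallAlgebra k A) :
    x ∈ Submodule.span (HallCoeff k) (Set.range (HallAlgebra.cls : IsoClass k A → HallAlgebra k A)) := by
  have h : ∀ x : IsoClass k A →₀ HallCoeff k,
      x ∈ Submodule.span (HallCoeff k) (Set.range fun X : IsoClass k A =>
        Finsupp.single X (1 : HallCoeff k)) := by
    intro x
    rw [Finsupp.mem_span_range_iff_exists_finsupp]
    exact ⟨x, by simp⟩
  exact h x

theorem mul_mem_hallD_of_mem_span {r : ℕ} {S T : Set (IsoClass k A)}
    (h : ∀ M ∈ S, ∀ N ∈ T, HallAlgebra.cls M * HallAlgebra.cls N ∈ hallD k A r)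
    {x y : HallAlgebra k A} (hx : x ∈ Submodule.span (HallCoeff k) (HallAlgebra.cls '' S))
    (hy : y ∈ Submodule.span (HallCoeff k) (HallAlgebra.cls '' T)) : x * y ∈ hallD k A r := by
  induction hx using Submodule.span_induction with
  | zero => simp
  | add a b _ _ ha hb => rw [add_mul]; exact add_mem ha hb
  | smul c a _ ha => rw [HallAlgebra.smul_mul']; exact Submodule.smul_mem _ c ha
  | mem a ha =>
    obtain ⟨M, hM, rfl⟩ := ha
    induction hy using Submodule.span_induction with
    | zero => simp
    | add a b _ _ ha hb => rw [mul_add]; exact add_mem ha hb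
    | smul c a _ ha => rw [HallAlgebra.mul_smul']; exact Submodule.smul_mem _ c ha
    | mem a ha =>
      obtain ⟨N, hN, rfl⟩ := ha
      exact h M hM N hN

theorem hallD_eq_span_image (r : ℕ) :
    hallD k A r = Submodule.span (HallCoeff k)
      (HallAlgebra.cls '' {X : IsoClass k A | r + 1 ≤ X.out.s}) := by
  refine congrArg (Submodule.span (HallCoeff k)) ?_
  ext y
  exact ⟨fun ⟨X, h1, h2⟩ => ⟨X, h1, h2.symm⟩, fun ⟨X, h1, h2⟩ => ⟨X, h1, h2.symm⟩⟩

/-- The coefficients of the product are Hall numbers, that is, natural numbers in a ring of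
characteristic zero, so a class occurs as soon as one suitable submodule exists. -/
theorem cls_mul_cls_mem_hallD_iff {r : ℕ} (M N : IsoClass k A) :
    HallAlgebra.cls M * HallAlgebra.cls N ∈ hallD k A r ↔
      ∀ (X : FDMod k A) (U : Submodule A X), Nonempty (U ≃ₗ[A] N.out) →
        Nonempty ((X ⧸ U) ≃ₗ[A] M.out) → r + 1 ≤ X.s := by
  rw [mem_hallD_iff]
  simp only [cls_mul_cls_apply]
  constructor
  · intro h X U hN hM
    rw [← X.s_out]
    refine h ⟦X⟧ ?_
    rw [← M.out_eq, ← N.out_eq, hallNumberClass_mk]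
    exact_mod_cast (hallNumber_ne_zero_iff X M.out N.out).2 ⟨U, hN, hM⟩
  · intro h X hX
    obtain ⟨U, hN, hM⟩ := (hallNumber_ne_zero_iff X.out M.out N.out).1 (by exact_mod_cast hX)
    exact h _ U hN hM

variable (k A) in
/-- `D_r` is a subring if and only if it is closed under extensions. -/
theorem hallDIsSubring_iff (r : ℕ) :
    HallDIsSubring k A r ↔ ∀ (X : FDMod k A) (U : Submodule A X),
      r + 1 ≤ (X.sub U).s → r + 1 ≤ (X.quot U).s → r + 1 ≤ X.s := by
  constructor
  · rintro ⟨S, hS⟩ X U hN hM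
    have hmem : ∀ Y : FDMod k A, r + 1 ≤ Y.s → HallAlgebra.cls (⟦Y⟧ : IsoClass k A) ∈ S := by
      intro Y hY
      rw [← SetLike.mem_coe, hS]
      exact cls_mem_hallD (hY.trans_eq Y.s_out.symm)
    have h := mul_mem (hmem _ hM) (hmem _ hN)
    rw [← SetLike.mem_coe, hS] at h
    obtain ⟨e⟩ := Quotient.mk_out (s := FDMod.setoid) (X.sub U)
    obtain ⟨f⟩ := Quotient.mk_out (s := FDMod.setoid) (X.quot U)
    exact (cls_mul_cls_mem_hallD_iff _ _).1 h X U ⟨e.symm⟩ ⟨f.symm⟩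
  · intro h
    refine ⟨{ (hallD k A r).toAddSubgroup with mul_mem' := ?_ }, rfl⟩
    intro x y hx hy
    change x ∈ hallD k A r at hx
    change y ∈ hallD k A r at hy
    rw [hallD_eq_span_image] at hx hy
    refine mul_mem_hallD_of_mem_span (fun M hM N hN => ?_) hx hy
    refine (cls_mul_cls_mem_hallD_iff _ _).2 fun X U ⟨e⟩ ⟨f⟩ => h X U ?_ ?_
    · have : (X.sub U).s = N.out.s := numIndecomposables_congr (M := (X.sub U).carrier) e
      rw [this]
      exact hN
    · have : (X.quot U).s = M.out.s := numIndecomposables_congr (M := (X.quot U).carrier) f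
      rw [this]
      exact hM

variable (k A) in
/-- `D_r` is an ideal if and only if it is closed under extensions with arbitrary modules. -/
theorem hallDIsIdeal_iff (r : ℕ) :
    HallDIsIdeal k A r ↔ ∀ (X : FDMod k A) (U : Submodule A X),
      r + 1 ≤ (X.sub U).s ∨ r + 1 ≤ (X.quot U).s → r + 1 ≤ X.s := by
  constructor
  · rintro ⟨I, hI⟩ X U hNM
    have hmem : ∀ Y : FDMod k A, r + 1 ≤ Y.s → HallAlgebra.cls (⟦Y⟧ : IsoClass k A) ∈ I := by
      intro Y hY
      rw [← SetLike.mem_coe, hI]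
      exact cls_mem_hallD (hY.trans_eq Y.s_out.symm)
    have h : HallAlgebra.cls (⟦X.quot U⟧ : IsoClass k A) * HallAlgebra.cls ⟦X.sub U⟧ ∈ I :=
      hNM.elim (fun hN => I.mul_mem_left _ _ (hmem _ hN)) fun hM => I.mul_mem_right _ _ (hmem _ hM)
    rw [← SetLike.mem_coe, hI] at h
    obtain ⟨e⟩ := Quotient.mk_out (s := FDMod.setoid) (X.sub U)
    obtain ⟨f⟩ := Quotient.mk_out (s := FDMod.setoid) (X.quot U)
    exact (cls_mul_cls_mem_hallD_iff _ _).1 h X U ⟨e.symm⟩ ⟨f.symm⟩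
  · intro h
    have hspan : ∀ x : HallAlgebra k A, x ∈ Submodule.span (HallCoeff k)
        (HallAlgebra.cls '' (Set.univ : Set (IsoClass k A))) := by
      simpa using HallAlgebra.mem_span_cls
    have key : ∀ M N : IsoClass k A, r + 1 ≤ N.out.s ∨ r + 1 ≤ M.out.s →
        HallAlgebra.cls M * HallAlgebra.cls N ∈ hallD k A r := by
      intro M N hNM
      refine (cls_mul_cls_mem_hallD_iff _ _).2 fun X U ⟨e⟩ ⟨f⟩ => h X U ?_
      have h1 : (X.sub U).s = N.out.s := numIndecomposables_congr (M := (X.sub U).carrier) e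
      have h2 : (X.quot U).s = M.out.s := numIndecomposables_congr (M := (X.quot U).carrier) f
      rwa [h1, h2]
    refine ⟨TwoSidedIdeal.mk' (hallD k A r : Set (HallAlgebra k A)) (zero_mem _) add_mem neg_mem
      ?_ ?_, by ext x; exact TwoSidedIdeal.mem_mk' _ _ _ _ _ _ _⟩
    · intro x y hy
      rw [SetLike.mem_coe, hallD_eq_span_image] at hy
      exact mul_mem_hallD_of_mem_span (fun M _ N hN => key M N (.inl hN)) (hspan x) hy
    · intro x y hx
      rw [SetLike.mem_coe, hallD_eq_span_image] at hx
      exact mul_mem_hallD_of_mem_span (fun M hM N _ => key M N (.inr hM)) hx (hspan y)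

end HallCriterion

/-! ## Modules over path algebras -/

theorem PathAlgebra.ofPath_cons (k : Type w) {Q : Type u} [Field k] [Quiver.{v} Q] {a b c : Q}
    (p : Path a b) (e : b ⟶ c) :
    PathAlgebra.ofPath k (p.cons e) = PathAlgebra.ofPath k e.toPath * PathAlgebra.ofPath k p := by
  rw [PathAlgebra.ofPath_mul_ofPath, Path.comp_toPath_eq_cons]

/-- The data of a representation of a quiver on a single vector space. -/
structure QuiverAction (k : Type w) (Q : Type u) [Field k] [Quiver.{v} Q] [Fintype Q]
    (V : Type*) [AddCommGroup V] [Module k V] where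
  vert : Q → Module.End k V
  arrow : ∀ {a b : Q}, (a ⟶ b) → Module.End k V
  complete : CompleteOrthogonalIdempotents vert
  vert_mul_arrow : ∀ {a b : Q} (e : a ⟶ b), vert b * arrow e = arrow e
  arrow_mul_vert : ∀ {a b : Q} (e : a ⟶ b), arrow e * vert a = arrow e

namespace QuiverAction

variable {k : Type w} {Q : Type u} [Field k] [Quiver.{v} Q] [Fintype Q]
  {V : Type*} [AddCommGroup V] [Module k V] (ρ : QuiverAction k Q V)

/-- The action of a path. -/
def path {a : Q} : ∀ {b : Q}, Path a b → Module.End k V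
  | _, .nil => ρ.vert a
  | _, .cons p e => ρ.arrow e * path p

theorem vert_mul_path {a b : Q} (p : Path a b) : ρ.vert b * ρ.path p = ρ.path p := by
  cases p with
  | nil => exact ρ.complete.idem a
  | cons p e => rw [path, ← mul_assoc, vert_mul_arrow]

theorem path_mul_vert {a b : Q} (p : Path a b) : ρ.path p * ρ.vert a = ρ.path p := by
  induction p with
  | nil => exact ρ.complete.idem a
  | cons p e ih => rw [path, mul_assoc, ih]

theorem path_comp {a b c : Q} (p : Path a b) (q : Path b c) :
    ρ.path (p.comp q) = ρ.path q * ρ.path p := by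
  induction q with
  | nil => exact (ρ.vert_mul_path p).symm
  | cons q e ih => rw [Path.comp_cons, path, path, ih, mul_assoc]

theorem path_mul_path_of_ne {a b c d : Q} (p : Path c d) (q : Path a b) (h : b ≠ c) :
    ρ.path p * ρ.path q = 0 := by
  rw [← ρ.path_mul_vert p, ← ρ.vert_mul_path q, mul_assoc, ← mul_assoc (ρ.vert c),
    ρ.complete.ortho h.symm, zero_mul, mul_zero]

/-- The linear extension of the action of paths. -/
noncomputable def linearMap : PathAlgebra k Q →ₗ[k] Module.End k V :=
  Finsupp.lift (Module.End k V) k (Σ a b : Q, Path a b) fun p => ρ.path p.2.2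

theorem linearMap_ofPath {a b : Q} (p : Path a b) :
    ρ.linearMap (PathAlgebra.ofPath k p) = ρ.path p := by
  refine (Finsupp.lift_apply _ _ _ _ _).trans ?_
  exact (Finsupp.sum_single_index (by exact zero_smul _ _)).trans (by exact one_smul _ _)

theorem linearMap_mul (x y : PathAlgebra k Q) :
    ρ.linearMap (x * y) = ρ.linearMap x * ρ.linearMap y := by
  induction x using PathAlgebra.induction with
  | h0 => rw [zero_mul, map_zero, zero_mul]
  | hadd x x' hx hx' => rw [add_mul, map_add, hx, hx', map_add, add_mul]
  | hpath c a b p =>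
    rw [PathAlgebra.smul_mul, map_smul, map_smul, smul_mul_assoc]
    congr 1
    induction y using PathAlgebra.induction with
    | h0 => rw [mul_zero, map_zero, mul_zero]
    | hadd y y' hy hy' => rw [mul_add, map_add, hy, hy', map_add, mul_add]
    | hpath c' a' b' q =>
      rw [PathAlgebra.mul_smul, map_smul, map_smul, mul_smul_comm]
      congr 1
      rw [linearMap_ofPath, linearMap_ofPath]
      by_cases h : b' = a
      · subst h
        rw [PathAlgebra.ofPath_mul_ofPath, linearMap_ofPath, path_comp]
      · rw [PathAlgebra.ofPath_mul_ofPath_of_ne _ _ h, map_zero, ρ.path_mul_path_of_ne _ _ h]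

/-- The action of the path algebra. -/
noncomputable def algHom : PathAlgebra k Q →ₐ[k] Module.End k V :=
  AlgHom.ofLinearMap ρ.linearMap (by
    rw [PathAlgebra.one_def, map_sum, ← ρ.complete.complete]
    exact Finset.sum_congr rfl fun a _ => ρ.linearMap_ofPath _) ρ.linearMap_mul

/-- The module over the path algebra given by a representation. -/
noncomputable def toFDMod {V : Type w} [AddCommGroup V] [Module k V] [Module.Finite k V]
    (ρ : QuiverAction k Q V) : FDMod k (PathAlgebra k Q) :=
  letI : Module (PathAlgebra k Q) V := Module.compHom V ρ.algHom.toRingHom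
  { carrier := V
    isScalarTower := ⟨fun c x y => by
      change ρ.algHom (c • x) y = c • ρ.algHom x y
      rw [map_smul, LinearMap.smul_apply]⟩ }

theorem vert_smul {V : Type w} [AddCommGroup V] [Module k V] [Module.Finite k V]
    (ρ : QuiverAction k Q V) (a : Q) (x : ρ.toFDMod) :
    PathAlgebra.ofPath k (Path.nil : Path a a) • x = (show V from ρ.vert a (show V from x)) := by
  change ρ.linearMap _ _ = _
  rw [linearMap_ofPath]
  rfl

theorem arrow_smul {V : Type w} [AddCommGroup V] [Module k V] [Module.Finite k V]
    (ρ : QuiverAction k Q V) {a b : Q} (e : a ⟶ b) (x : ρ.toFDMod) :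
    PathAlgebra.ofPath k e.toPath • x = (show V from ρ.arrow e (show V from x)) := by
  change ρ.linearMap _ _ = _
  rw [linearMap_ofPath]
  change (ρ.arrow e * ρ.vert a) _ = _
  rw [ρ.arrow_mul_vert]

end QuiverAction

section Submodules

variable {k : Type w} {Q : Type u} [Field k] [Quiver.{v} Q] [Fintype Q]
  {X : Type*} [AddCommGroup X] [Module k X] [Module (PathAlgebra k Q) X]
  [IsScalarTower k (PathAlgebra k Q) X]

/-- A subspace closed under the action of the trivial paths and of the arrows is a submodule. -/
def Submodule.ofInvariant (U : Submodule k X)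
    (hv : ∀ a : Q, ∀ x ∈ U, PathAlgebra.ofPath k (Path.nil : Path a a) • x ∈ U)
    (ha : ∀ (a b : Q) (e : a ⟶ b), ∀ x ∈ U, PathAlgebra.ofPath k e.toPath • x ∈ U) :
    Submodule (PathAlgebra k Q) X :=
  { U with
    smul_mem' := fun r x hx => by
      change r • x ∈ U
      induction r using PathAlgebra.induction with
      | h0 => rw [zero_smul]; exact zero_mem _
      | hadd r s hr hs => rw [add_smul]; exact add_mem hr hs
      | hpath c a b p =>
        rw [smul_assoc]
        refine Submodule.smul_mem U c ?_
        induction p with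
        | nil => exact hv a x hx
        | cons p e ih =>
          rw [PathAlgebra.ofPath_cons, mul_smul]
          exact ha _ _ e _ ih }

end Submodules

/-! ### Recognising submodules and quotients with two summands -/

section TwoSummands

variable {A : Type u} {X : Type w} [Ring A] [AddCommGroup X] [Module A X] [IsArtinian A X]
  [IsNoetherian A X]

theorem two_le_numIndecomposables_sup {U W : Submodule A X} (h : Disjoint U W) (hU : U ≠ ⊥)
    (hW : W ≠ ⊥) : 2 ≤ numIndecomposables A ↥(U ⊔ W) := by
  have hmap : ∀ V ≤ U ⊔ W, (V.comap (U ⊔ W).subtype).map (U ⊔ W).subtype = V := fun V hV => by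
    rw [Submodule.map_comap_subtype, inf_eq_right.2 hV]
  have hinj := Submodule.map_injective_of_injective (U ⊔ W).injective_subtype
  refine two_le_numIndecomposables_of_isCompl (U := U.comap (U ⊔ W).subtype)
    (W := W.comap (U ⊔ W).subtype) ⟨?_, ?_⟩ ?_ ?_
  · rw [disjoint_iff, ← Submodule.comap_inf, h.eq_bot]
    exact Submodule.comap_bot _ |>.trans (Submodule.ker_subtype _)
  · rw [codisjoint_iff]
    apply hinj
    rw [Submodule.map_sup, hmap _ le_sup_left, hmap _ le_sup_right, Submodule.map_subtype_top]
  · intro h0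
    apply hU
    rw [← hmap U le_sup_left, h0, Submodule.map_bot]
  · intro h0
    apply hW
    rw [← hmap W le_sup_right, h0, Submodule.map_bot]

theorem two_le_numIndecomposables_quotient {U V W : Submodule A X} (h : V ⊔ W = ⊤)
    (hU : V ⊓ W = U) (hV : V ≠ U) (hW : W ≠ U) : 2 ≤ numIndecomposables A (X ⧸ U) := by
  have hUV : U ≤ V := hU ▸ inf_le_left
  have hUW : U ≤ W := hU ▸ inf_le_right
  have hcomap : ∀ Y : Submodule A X, U ≤ Y → (Y.map U.mkQ).comap U.mkQ = Y := fun Y hY => by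
    rw [Submodule.comap_map_mkQ, sup_eq_right.2 hY]
  have hinj := Submodule.comap_injective_of_surjective U.mkQ_surjective
  refine two_le_numIndecomposables_of_isCompl (U := V.map U.mkQ) (W := W.map U.mkQ) ⟨?_, ?_⟩ ?_ ?_
  · rw [disjoint_iff]
    apply hinj
    rw [Submodule.comap_inf, hcomap V hUV, hcomap W hUW, hU]
    exact (U.ker_mkQ).symm
  · rw [codisjoint_iff, ← Submodule.map_sup, h, Submodule.map_top, Submodule.range_mkQ]
  · intro h0
    apply hV
    rw [← hcomap V hUV, h0]
    exact U.ker_mkQ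
  · intro h0
    apply hW
    rw [← hcomap W hUW, h0]
    exact U.ker_mkQ

end TwoSummands

/-! ## Modules given by labelled graphs -/

/-- The arrows of a quiver. -/
abbrev Arrow (Q : Type u) [Quiver.{v} Q] := Σ a b : Q, (a ⟶ b)

/-- A directed graph with vertices labelled by the vertices and edges labelled by the arrows of a
quiver. -/
structure LabelledGraph (Q : Type u) [Quiver.{v} Q] (ι : Type) where
  vert : ι → Q
  edge : ι → ι → Option (Arrow Q)
  compat : ∀ {i j : ι} {e : Arrow Q}, edge i j = some e → vert i = e.1 ∧ vert j = e.2.1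

namespace LabelledGraph

variable {Q : Type u} [Quiver.{v} Q] {ι : Type} (G : LabelledGraph Q ι)

/-- There is no edge ending in `i`. -/
def IsTop (i : ι) : Prop := ∀ j, G.edge j i = none

/-- No edge leaves the set `I`. -/
def IsClosed (I : Set ι) : Prop := ∀ i j, G.edge i j ≠ none → i ∈ I → j ∈ I

variable [Fintype ι] [Fintype Q] (k : Type w) [Field k]

open Classical in
/-- The representation with basis the vertices of a labelled graph: an arrow `e` maps a basis
element `i` to the sum of all `j` with an edge `i → j` with label `e`. -/
noncomputable def action : QuiverAction k Q (ι → k) where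
  vert a := LinearMap.pi fun i => if G.vert i = a then LinearMap.proj i else 0
  arrow {a b} e := LinearMap.pi fun i =>
    ∑ j, if G.edge j i = some ⟨a, b, e⟩ then LinearMap.proj j else 0
  complete := by
    refine CompleteOrthogonalIdempotents.iff_ortho_complete.2 ⟨fun a b hab => ?_, ?_⟩
    · refine LinearMap.ext fun x => funext fun i => ?_
      by_cases ha : G.vert i = a
      · have hb : G.vert i ≠ b := fun h => hab (ha.symm.trans h)
        simp [ha, hab]
      · simp [ha]
    · refine LinearMap.ext fun x => funext fun i => ?_
      simp only [LinearMap.sum_apply, LinearMap.pi_apply, Finset.sum_apply]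
      rw [Finset.sum_eq_single (G.vert i)]
      · simp
      · intro a _ ha
        simp [ha.symm]
      · simp
  vert_mul_arrow {a b} e := by
    refine LinearMap.ext fun x => funext fun i => ?_
    by_cases h : G.vert i = b
    · simp [h]
    · have : ∀ j, G.edge j i ≠ some ⟨a, b, e⟩ := fun j hj => h (G.compat hj).2
      simp [h, this]
  arrow_mul_vert {a b} e := by
    refine LinearMap.ext fun x => funext fun i => ?_
    simp only [Module.End.mul_apply, LinearMap.pi_apply, LinearMap.sum_apply]
    refine Finset.sum_congr rfl fun j _ => ?_
    by_cases h : G.edge j i = some ⟨a, b, e⟩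
    · simp [h, (G.compat h).1]
    · simp [h]

open Classical in
theorem action_vert_apply (a : Q) (x : ι → k) (i : ι) :
    (G.action k).vert a x i = if G.vert i = a then x i else 0 := by
  by_cases h : G.vert i = a <;> simp [action, h]

open Classical in
theorem action_arrow_apply (e : Arrow Q) (x : ι → k) (i : ι) :
    (G.action k).arrow e.2.2 x i = ∑ j, if G.edge j i = some e then x j else 0 := by
  simp only [action, LinearMap.pi_apply, LinearMap.sum_apply]
  refine Finset.sum_congr rfl fun j _ => ?_
  by_cases h : G.edge j i = some e
  · rw [if_pos h, if_pos h]
    rfl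
  · rw [if_neg h, if_neg h]
    rfl

/-- The module with basis the vertices of a labelled graph. -/
noncomputable def mod : FDMod k (PathAlgebra k Q) := (G.action k).toFDMod

variable {k}

/-- The coordinates of an element. -/
def coord (x : G.mod k) : ι → k := x

/-- The element with given coordinates. -/
def ofCoord (x : ι → k) : G.mod k := x

open Classical in
/-- The basis. -/
noncomputable def basis (i : ι) : G.mod k := G.ofCoord (Pi.single i 1)

open Classical in
theorem coord_basis (i j : ι) :
    G.coord (G.basis i : G.mod k) j = if j = i then 1 else 0 := Pi.single_apply i 1 j

theorem coord_ext {x y : G.mod k} (h : ∀ i, G.coord x i = G.coord y i) : x = y := funext h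

theorem coord_add (x y : G.mod k) (i : ι) : G.coord (x + y) i = G.coord x i + G.coord y i := rfl

theorem coord_sub (x y : G.mod k) (i : ι) : G.coord (x - y) i = G.coord x i - G.coord y i := rfl

theorem coord_smul (c : k) (x : G.mod k) (i : ι) : G.coord (c • x) i = c * G.coord x i := rfl

theorem coord_zero (i : ι) : G.coord (0 : G.mod k) i = 0 := rfl

theorem coord_sum {κ : Type*} (s : Finset κ) (x : κ → G.mod k) (i : ι) :
    G.coord (∑ j ∈ s, x j) i = ∑ j ∈ s, G.coord (x j) i := Finset.sum_apply i s x

open Classical in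
theorem coord_vert_smul (a : Q) (x : G.mod k) (i : ι) :
    G.coord (PathAlgebra.ofPath k (Path.nil : Path a a) • x) i =
      if G.vert i = a then G.coord x i else 0 := by
  refine (congrArg (fun y : G.mod k => G.coord y i) ((G.action k).vert_smul a x)).trans ?_
  exact G.action_vert_apply k a x i

open Classical in
theorem coord_arrow_smul (e : Arrow Q) (x : G.mod k) (i : ι) :
    G.coord (PathAlgebra.ofPath k e.2.2.toPath • x) i =
      ∑ j, if G.edge j i = some e then G.coord x j else 0 := by
  refine (congrArg (fun y : G.mod k => G.coord y i) ((G.action k).arrow_smul e.2.2 x)).trans ?_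
  exact G.action_arrow_apply k e x i

theorem sum_coord_smul_basis (x : G.mod k) : ∑ i, G.coord x i • G.basis i = x := by
  refine G.coord_ext fun j => ?_
  rw [coord_sum, Finset.sum_eq_single j]
  · simp [coord_smul, coord_basis]
  · intro i _ hij
    simp [coord_smul, coord_basis, hij.symm]
  · simp

/-- The submodule spanned by the basis elements in a closed set. -/
noncomputable def span {I : Set ι} (hI : G.IsClosed I) : Submodule (PathAlgebra k Q) (G.mod k) :=
  Submodule.ofInvariant (Q := Q)
    { carrier := {x | ∀ i ∉ I, G.coord x i = 0}
      add_mem' := fun {x y} hx hy i hi => by rw [coord_add, hx i hi, hy i hi, add_zero]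
      zero_mem' := fun i _ => rfl
      smul_mem' := fun c x hx i hi => by rw [coord_smul, hx i hi, mul_zero] }
    (fun a x hx i hi => by rw [coord_vert_smul, hx i hi, ite_self])
    (fun a b e x hx i hi => by
      have h := G.coord_arrow_smul ⟨a, b, e⟩ x i
      refine h.trans (Finset.sum_eq_zero fun j _ => ?_)
      split_ifs with hj
      · exact hx j fun hjI => hi (hI j i (by simp [hj]) hjI)
      · rfl)

theorem mem_span {I : Set ι} {hI : G.IsClosed I} {x : G.mod k} :
    x ∈ G.span hI ↔ ∀ i ∉ I, G.coord x i = 0 := Iff.rfl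

theorem basis_mem_span {I : Set ι} {hI : G.IsClosed I} {i : ι} :
    (G.basis i : G.mod k) ∈ G.span hI ↔ i ∈ I := by
  rw [mem_span]
  constructor
  · intro h
    by_contra hi
    simpa [coord_basis] using h i hi
  · intro hi j hj
    rw [coord_basis, if_neg]
    rintro rfl
    exact hj hi

theorem span_inf {I J K : Set ι} {hI : G.IsClosed I} {hJ : G.IsClosed J} {hK : G.IsClosed K}
    (h : I ∩ J = K) : (G.span hI ⊓ G.span hJ : Submodule (PathAlgebra k Q) (G.mod k)) =
      G.span hK := by
  subst h
  ext x
  simp only [Submodule.mem_inf, mem_span, Set.mem_inter_iff, not_and_or]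
  exact ⟨fun h i hi => hi.elim (h.1 i) (h.2 i), fun h => ⟨fun i hi => h i (.inl hi),
    fun i hi => h i (.inr hi)⟩⟩

open Classical in
theorem span_sup {I J K : Set ι} {hI : G.IsClosed I} {hJ : G.IsClosed J} {hK : G.IsClosed K}
    (h : I ∪ J = K) : (G.span hI ⊔ G.span hJ : Submodule (PathAlgebra k Q) (G.mod k)) =
      G.span hK := by
  subst h
  apply le_antisymm
  · refine sup_le (fun x hx i hi => hx i fun h => hi (.inl h)) fun x hx i hi =>
      hx i fun h => hi (.inr h)
  · intro x hx
    refine Submodule.mem_sup.2 ⟨G.ofCoord fun i => if i ∈ I then G.coord x i else 0, ?_,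
      G.ofCoord fun i => if i ∈ I then 0 else G.coord x i, ?_, ?_⟩
    · exact fun i hi => if_neg hi
    · intro i hi
      by_cases h : i ∈ I
      · exact if_pos h
      · exact (if_neg h).trans (hx i fun h' => h'.elim h hi)
    · refine G.coord_ext fun i => ?_
      rw [coord_add]
      by_cases h : i ∈ I <;> simp [coord, ofCoord, h]

theorem span_ne_of_mem {I J : Set ι} {hI : G.IsClosed I} {hJ : G.IsClosed J} (i : ι) (h : i ∈ I)
    (h' : i ∉ J) : (G.span hI : Submodule (PathAlgebra k Q) (G.mod k)) ≠ G.span hJ := by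
  intro heq
  have : (G.basis i : G.mod k) ∈ G.span hI := G.basis_mem_span.2 h
  rw [heq] at this
  exact h' (G.basis_mem_span.1 this)

theorem span_ne_bot {I : Set ι} {hI : G.IsClosed I} (h : I.Nonempty) :
    (G.span hI : Submodule (PathAlgebra k Q) (G.mod k)) ≠ ⊥ := by
  obtain ⟨i, hi⟩ := h
  intro heq
  have : (G.basis i : G.mod k) ∈ G.span hI := G.basis_mem_span.2 hi
  rw [heq, Submodule.mem_bot] at this
  have h1 := congrArg (fun x => G.coord x i) this
  simp [coord_basis, coord_zero] at h1

theorem span_univ {I : Set ι} {hI : G.IsClosed I} (h : I = Set.univ) :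
    (G.span hI : Submodule (PathAlgebra k Q) (G.mod k)) = ⊤ := by
  rw [eq_top_iff]
  intro x _ i hi
  exact absurd (h ▸ Set.mem_univ i) hi

/-- The matrix of an endomorphism. -/
noncomputable def coef (f : Module.End (PathAlgebra k Q) (G.mod k)) (i j : ι) : k :=
  G.coord (f (G.basis j)) i

theorem coord_end_apply (f : Module.End (PathAlgebra k Q) (G.mod k)) (x : G.mod k) (i : ι) :
    G.coord (f x) i = ∑ j, G.coord x j * G.coef f i j := by
  conv_lhs => rw [← G.sum_coord_smul_basis x, map_sum, coord_sum]
  refine Finset.sum_congr rfl fun j _ => ?_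
  have : f (G.coord x j • G.basis j) = G.coord x j • f (G.basis j) :=
    LinearMap.map_smul_of_tower f _ _
  rw [this, coord_smul, coef]

-- The matrix entry at `(i, j)` of the identity saying that `f` commutes with the arrow `e`. It is
-- the source of the linear equations in the indecomposability proofs below.
open Classical in
theorem coef_comm (f : Module.End (PathAlgebra k Q) (G.mod k)) (e : Arrow Q) (i j : ι) :
    (∑ l, if G.edge l i = some e then G.coef f l j else 0) =
      ∑ l, if G.edge j l = some e then G.coef f i l else 0 := by
  have h' : G.coord (f (PathAlgebra.ofPath k e.2.2.toPath • G.basis j)) i =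
      ∑ l, if G.edge j l = some e then G.coef f i l else 0 := by
    rw [coord_end_apply]
    refine Finset.sum_congr rfl fun l _ => ?_
    rw [coord_arrow_smul, Finset.sum_eq_single j]
    · simp [coord_basis]
    · intro m _ hm
      simp [coord_basis, hm]
    · simp
  rw [← h', f.map_smul, coord_arrow_smul]
  rfl

theorem sum_coef_mul_coef {f : Module.End (PathAlgebra k Q) (G.mod k)} (hf : IsIdempotentElem f)
    (i j : ι) : ∑ l, G.coef f l j * G.coef f i l = G.coef f i j := by
  refine (G.coord_end_apply f (f (G.basis j)) i).symm.trans ?_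
  rw [← Module.End.mul_apply, hf.eq]
  rfl

variable (k) in
/-- The span of the images of all arrows. -/
noncomputable def rad : Submodule k (G.mod k) :=
  Submodule.span k {x | ∃ (e : Arrow Q) (y : G.mod k), x = PathAlgebra.ofPath k e.2.2.toPath • y}

theorem coord_of_mem_rad {x : G.mod k} (hx : x ∈ G.rad k) {i : ι} (hi : G.IsTop i) :
    G.coord x i = 0 := by
  induction hx using Submodule.span_induction with
  | zero => rfl
  | add x y _ _ hx hy => rw [coord_add, hx, hy, add_zero]
  | smul c x _ hx => rw [coord_smul, hx, mul_zero]
  | mem x hx =>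
    obtain ⟨e, y, rfl⟩ := hx
    rw [coord_arrow_smul]
    exact Finset.sum_eq_zero fun j _ => by simp [hi j]

theorem map_mem_rad (f : Module.End (PathAlgebra k Q) (G.mod k)) {x : G.mod k}
    (hx : x ∈ G.rad k) : f x ∈ G.rad k := by
  induction hx using Submodule.span_induction with
  | zero => rw [map_zero]; exact zero_mem _
  | add x y _ _ hx hy => rw [map_add]; exact add_mem hx hy
  | smul c x _ hx =>
    rw [LinearMap.map_smul_of_tower]
    exact Submodule.smul_mem _ c hx
  | mem x hx =>
    obtain ⟨e, y, rfl⟩ := hx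
    rw [map_smul]
    exact Submodule.subset_span ⟨e, f y, rfl⟩

/-- Conditions under which the basis elements which are not tops span the radical. -/
structure Graded (k : Type w) [Field k] where
  height : ι → ℕ
  height_lt : ∀ {i j}, G.edge i j ≠ none → height i < height j
  mem_rad : ∀ i, ¬ G.IsTop i → G.basis i ∈ G.rad k

variable {G}

/-- Endomorphisms preserve the span of the images of the arrows, and elements of that span have no
coordinates at tops. -/
theorem Graded.coef_eq_zero (hG : G.Graded k) (f : Module.End (PathAlgebra k Q) (G.mod k))
    {i j : ι} (hi : G.IsTop i) (hj : ¬ G.IsTop j) : G.coef f i j = 0 :=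
  G.coord_of_mem_rad (G.map_mem_rad f (hG.mem_rad j hj)) hi

theorem Graded.mem_rad_of_coord (hG : G.Graded k) {x : G.mod k}
    (h : ∀ i, G.IsTop i → G.coord x i = 0) : x ∈ G.rad k := by
  rw [← G.sum_coord_smul_basis x]
  refine Submodule.sum_mem _ fun i _ => ?_
  by_cases hi : G.IsTop i
  · rw [h i hi, zero_smul]
    exact zero_mem _
  · exact Submodule.smul_mem _ _ (hG.mem_rad i hi)

/-- Such an `f` maps everything into the radical, so each application of `f` raises the least height
at which coordinates can occur; an idempotent with this property vanishes. -/
theorem Graded.eq_zero (hG : G.Graded k) {f : Module.End (PathAlgebra k Q) (G.mod k)}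
    (hf : IsIdempotentElem f) (h : ∀ i j, G.IsTop i → G.coef f i j = 0) : f = 0 := by
  have hrad : ∀ x, f x ∈ G.rad k := fun x => hG.mem_rad_of_coord fun i hi => by
    rw [coord_end_apply]
    exact Finset.sum_eq_zero fun j _ => by rw [h i j hi, mul_zero]
  have key : ∀ n, ∀ x, ∀ i, hG.height i < n → G.coord (f x) i = 0 := by
    intro n
    induction n with
    | zero => intro x i hi; exact absurd hi (by omega)
    | succ n ih =>
      have aux : ∀ y ∈ G.rad k, ∀ i, hG.height i < n + 1 → G.coord (f y) i = 0 := by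
        intro y hy i hi
        induction hy using Submodule.span_induction with
        | zero => rw [map_zero]; rfl
        | add x y _ _ hx hy => rw [map_add, coord_add, hx, hy, add_zero]
        | smul c x _ hx => rw [LinearMap.map_smul_of_tower, coord_smul, hx, mul_zero]
        | mem x hx =>
          obtain ⟨e, y, rfl⟩ := hx
          rw [map_smul, coord_arrow_smul]
          refine Finset.sum_eq_zero fun j _ => ?_
          split_ifs with hj
          · have := hG.height_lt (i := j) (j := i) (by simp [hj])
            exact ih y j (by omega)
          · rfl
      intro x i hi
      -- Idempotence replaces `f x` by `f (f x)`, whose argument lies in the radical, where `aux`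
      -- gains one more height.
      rw [← hf.eq, Module.End.mul_apply]
      exact aux _ (hrad x) i hi
  refine LinearMap.ext fun x => G.coord_ext fun i => ?_
  exact key (hG.height i + 1) x i (Nat.lt_succ_self _)

/-- If each idempotent endomorphism acts on the top as a scalar, then the module is
indecomposable. -/
theorem Graded.isIndecomposableModule [Nonempty ι] (hG : G.Graded k)
    (h : ∀ f : Module.End (PathAlgebra k Q) (G.mod k), IsIdempotentElem f →
      ∃ c : k, ∀ i j, G.IsTop i → G.IsTop j → (i = j → G.coef f i j = c) ∧
        (i ≠ j → G.coef f i j = 0)) :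
    IsIndecomposableModule (PathAlgebra k Q) (G.mod k) := by
  classical
  refine ⟨⟨G.basis (Classical.arbitrary ι), 0, fun h0 => ?_⟩, fun U W hUW => ?_⟩
  · have h1 := congrArg (fun x => G.coord x (Classical.arbitrary ι)) h0
    simp [coord_basis, coord_zero] at h1
  -- `f` projects onto `U` along `W`. Its scalar on the top is an idempotent of the field, and
  -- `Graded.eq_zero` applies to `f` or to `1 - f`.
  obtain ⟨f, hf, hU, hW⟩ : ∃ f : Module.End (PathAlgebra k Q) (G.mod k), IsIdempotentElem f ∧
      (∀ x ∈ U, f x = x) ∧ ∀ x ∈ W, f x = 0 :=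
    ⟨_, Submodule.isIdempotentElem_projection hUW,
      fun x hx => Submodule.projection_apply_left hUW ⟨x, hx⟩,
      fun x hx => Submodule.projection_apply_right hUW ⟨x, hx⟩⟩
  have htop : ∀ g : Module.End (PathAlgebra k Q) (G.mod k), IsIdempotentElem g →
      (∀ i j, G.IsTop i → G.IsTop j → G.coef g i j = 0) → g = 0 := by
    intro g hg h0
    refine hG.eq_zero hg fun i j hi => ?_
    by_cases hj : G.IsTop j
    · exact h0 i j hi hj
    · exact hG.coef_eq_zero g hi hj
  obtain ⟨c, hc⟩ := h f hf
  by_cases hne : ∃ i, G.IsTop i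
  · obtain ⟨i, hi⟩ := hne
    have h1 := G.sum_coef_mul_coef hf i i
    rw [Finset.sum_eq_single i] at h1
    · rw [(hc i i hi hi).1 rfl] at h1
      rcases (IsIdempotentElem.iff_eq_zero_or_one (p := c)).1 h1 with h1 | h1
      rotate_left
      · right
        have h2 : 1 - f = 0 := by
          refine htop _ hf.one_sub fun i j hi hj => ?_
          have : G.coef (1 - f) i j = G.coord (G.basis j : G.mod k) i - G.coef f i j := rfl
          rw [this, coord_basis]
          by_cases hij : i = j
          · rw [(hc i j hi hj).1 hij, if_pos hij, h1, sub_self]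
          · rw [(hc i j hi hj).2 hij, if_neg hij, sub_self]
        rw [sub_eq_zero] at h2
        rw [eq_bot_iff]
        intro x hx
        have := hW x hx
        rw [← h2] at this
        exact this
      · left
        have h2 : f = 0 := htop _ hf fun i j hi hj => by
          by_cases hij : i = j
          · rw [(hc i j hi hj).1 hij, h1]
          · rw [(hc i j hi hj).2 hij]
        rw [eq_bot_iff]
        intro x hx
        rw [Submodule.mem_bot, ← hU x hx, h2, LinearMap.zero_apply]
    · intro l _ hl
      by_cases hl' : G.IsTop l
      · rw [(hc i l hi hl').2 hl.symm, mul_zero]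
      · rw [hG.coef_eq_zero f hi hl', mul_zero]
    · simp
  · left
    have h2 : f = 0 := htop _ hf fun i j hi hj => absurd ⟨i, hi⟩ hne
    rw [eq_bot_iff]
    intro x hx
    rw [Submodule.mem_bot, ← hU x hx, h2, LinearMap.zero_apply]

/-- Unions and intersections of closed sets become sums and intersections of submodules. The
submodule is spanned by `I₁ ∪ I₂ = J₁ ∩ J₂`: the `I`s decompose it and the `J`s decompose the
quotient. The alternatives with bound `1` only use that the module in question is nonzero. -/
theorem hasExtension [Nonempty ι] (h : IsIndecomposableModule (PathAlgebra k Q) (G.mod k))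
    {I₁ I₂ J₁ J₂ : Set ι} (hI₁ : G.IsClosed I₁) (hI₂ : G.IsClosed I₂) (hJ₁ : G.IsClosed J₁)
    (hJ₂ : G.IsClosed J₂) (hI : I₁ ∩ I₂ = ∅) (hIJ : I₁ ∪ I₂ = J₁ ∩ J₂) (hJ : J₁ ∪ J₂ = Set.univ)
    {b c : ℕ} (hb : b ≤ 1 ∧ I₁.Nonempty ∨ b ≤ 2 ∧ I₁.Nonempty ∧ I₂.Nonempty)
    (hc : c ≤ 1 ∧ J₁ ≠ Set.univ ∧ J₂ = Set.univ ∨ c ≤ 2 ∧ J₁ ≠ Set.univ ∧ J₂ ≠ Set.univ) :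
    HasExtension k (PathAlgebra k Q) 1 b c := by
  have hI' : G.IsClosed (I₁ ∪ I₂) := fun i j hij hi =>
    hi.imp (hI₁ i j hij) (hI₂ i j hij)
  have he : G.IsClosed ∅ := fun i j _ hi => hi
  have hu : G.IsClosed Set.univ := fun i j _ _ => Set.mem_univ j
  have hsup := G.span_sup (k := k) (hI := hI₁) (hJ := hI₂) (hK := hI') rfl
  have hdisj : Disjoint (G.span (k := k) hI₁) (G.span hI₂) := by
    rw [disjoint_iff, G.span_inf (hK := he) hI]
    refine (Submodule.eq_bot_iff _).2 fun x hx => G.coord_ext fun i => ?_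
    exact hx i (Set.notMem_empty i)
  have hinf := G.span_inf (k := k) (hI := hJ₁) (hJ := hJ₂) (hK := hI') hIJ.symm
  have htop : G.span (k := k) hJ₁ ⊔ G.span hJ₂ = ⊤ := by
    rw [G.span_sup (hK := hu) hJ, G.span_univ rfl]
  refine ⟨G.mod k, G.span hI', numIndecomposables_of_isIndecomposableModule h, ?_, ?_⟩
  · rcases hb with ⟨hb, h1⟩ | ⟨hb, h1, h2⟩
    · have : Nontrivial (G.span (k := k) hI') := Submodule.nontrivial_iff_ne_bot.2
        (G.span_ne_bot (h1.mono Set.subset_union_left))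
      exact hb.trans (numIndecomposables_pos (A := PathAlgebra k Q) (M := G.span (k := k) hI'))
    · refine hb.trans ?_
      have := two_le_numIndecomposables_sup hdisj (G.span_ne_bot h1) (G.span_ne_bot h2)
      rwa [hsup] at this
  · have key : ∀ {J J' : Set ι} (hJ : G.IsClosed J) (hJ' : J' ≠ Set.univ), J ∪ J' = Set.univ →
        J ∩ J' = I₁ ∪ I₂ → G.span (k := k) hJ ≠ G.span hI' := by
      intro J J' hJ hJ' hu hi
      obtain ⟨x, hx⟩ := (Set.ne_univ_iff_exists_notMem J').1 hJ'
      refine G.span_ne_of_mem x ((hu ▸ Set.mem_univ x : x ∈ J ∪ J').resolve_right hx) ?_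
      rw [← hi]
      exact fun h => hx h.2
    rcases hc with ⟨hc, h1, h2⟩ | ⟨hc, h1, h2⟩
    · have : Nontrivial (G.mod k ⧸ G.span (k := k) hI') := by
        refine Submodule.Quotient.nontrivial_iff.2 ?_
        rw [← G.span_univ (hI := hu) rfl]
        obtain ⟨x, hx⟩ := (Set.ne_univ_iff_exists_notMem _).1 h1
        exact (G.span_ne_of_mem x (Set.mem_univ _) fun h => hx (hIJ ▸ h).1).symm
      exact hc.trans (numIndecomposables_pos (A := PathAlgebra k Q)
        (M := G.mod k ⧸ G.span (k := k) hI'))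
    · refine hc.trans (two_le_numIndecomposables_quotient htop hinf ?_ ?_)
      · exact key hJ₁ h2 hJ hIJ.symm
      · exact key hJ₂ h1 (by rw [Set.union_comm, hJ]) (by rw [Set.inter_comm, hIJ])

end LabelledGraph

/-! ## Extensions of decomposable modules with indecomposable middle term -/

namespace LabelledGraph

section Small

variable {Q : Type u} [Quiver.{v} Q] {n : ℕ}

theorem isTop_def {ι : Type} (G : LabelledGraph Q ι) (i : ι) :
    G.IsTop i ↔ ∀ j, G.edge j i = none := Iff.rfl

variable [Fintype Q] {ι : Type} [Fintype ι] (G : LabelledGraph Q ι) {k : Type w} [Field k]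

open Classical in
/-- A basis element which is the image of another basis element under an arrow lies in the
radical. -/
theorem basis_mem_rad {i j : ι} {e : Arrow Q} (h : ∀ l, G.edge j l = some e ↔ l = i) :
    (G.basis i : G.mod k) ∈ G.rad k := by
  refine Submodule.subset_span ⟨e, G.basis j, G.coord_ext fun l => ?_⟩
  rw [coord_arrow_smul, Finset.sum_eq_single j]
  · simp [coord_basis, h]
  · intro m _ hm
    simp [coord_basis, hm]
  · simp

/-- An idempotent matrix which is lower triangular with constant diagonal is a scalar. -/
theorem _root_.eq_zero_of_idempotent_triangular {K : Type*} [Field K] {b c : K}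
    (hc : c * c = c) (hb : c * b + b * c = b) : b = 0 := by
  rcases (IsIdempotentElem.iff_eq_zero_or_one (p := c)).1 hc with rfl | rfl
  · simpa using hb.symm
  · simpa using hb

/-- A criterion for indecomposability if the top is two-dimensional. -/
theorem Graded.isIndecomposableModule_of_two_tops {G : LabelledGraph Q ι} (hG : G.Graded k)
    {s t : ι} (hst : s ≠ t) (htop : ∀ i, G.IsTop i ↔ i = s ∨ i = t)
    (h : ∀ f : Module.End (PathAlgebra k Q) (G.mod k),
      G.coef f s t = 0 ∧ G.coef f t t = G.coef f s s) :
    IsIndecomposableModule (PathAlgebra k Q) (G.mod k) := by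
  classical
  have : Nonempty ι := ⟨s⟩
  refine hG.isIndecomposableModule fun f hf => ⟨G.coef f s s, fun i j hi hj => ?_⟩
  obtain ⟨h1, h2⟩ := h f
  have hs := (htop s).2 (.inl rfl)
  have ht := (htop t).2 (.inr rfl)
  have hsum : ∀ i j, G.IsTop i →
      G.coef f s j * G.coef f i s + G.coef f t j * G.coef f i t = G.coef f i j := by
    intro i j hi
    rw [← G.sum_coef_mul_coef hf i j, ← Finset.sum_pair hst
      (f := fun l => G.coef f l j * G.coef f i l)]
    refine Finset.sum_subset (Finset.subset_univ _) fun l _ hl => ?_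
    rw [hG.coef_eq_zero f hi, mul_zero]
    rw [htop]
    simpa using hl
  -- Only entries between the two tops survive in `hsum`. This block is triangular with constant
  -- diagonal, so idempotence removes the one off-diagonal entry not known to vanish.
  have i1 := hsum s s hs
  have i2 := hsum t s ht
  rw [h1, mul_zero, add_zero] at i1
  rw [h2] at i2
  have h3 := eq_zero_of_idempotent_triangular i1 i2
  rcases (htop i).1 hi with rfl | rfl <;> rcases (htop j).1 hj with rfl | rfl <;>
    simp [h1, h2, h3, hst, hst.symm]

/-- When only one edge labelled `e` enters `i` and only one leaves `j`, both sums in `coef_comm`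
have a single term. -/
theorem coef_eq_coef (f : Module.End (PathAlgebra k Q) (G.mod k)) (e : Arrow Q) {i j s t : ι}
    (hs : ∀ l, G.edge l i = some e ↔ l = s) (ht : ∀ l, G.edge j l = some e ↔ l = t) :
    G.coef f s j = G.coef f i t := by
  classical
  simpa [hs, ht] using G.coef_comm f e i j

theorem coef_eq_zero_of_forall_ne (f : Module.End (PathAlgebra k Q) (G.mod k)) (e : Arrow Q)
    {i j s : ι} (hs : ∀ l, G.edge l i = some e ↔ l = s) (ht : ∀ l, G.edge j l ≠ some e) :
    G.coef f s j = 0 := by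
  classical
  simpa [hs, ht] using G.coef_comm f e i j

end Small

section Examples

variable {Q : Type u} [Quiver.{v} Q]

/-- Two arrows with the same source. -/
def peak (e₁ e₂ : Arrow Q) (h : e₁.1 = e₂.1) : LabelledGraph Q (Fin 3) where
  vert := ![e₁.1, e₁.2.1, e₂.2.1]
  edge := ![![none, some e₁, some e₂], ![none, none, none], ![none, none, none]]
  compat {i j e} := by
    fin_cases i <;> fin_cases j <;> simp <;> rintro rfl <;> simp [h]

/-- Two arrows with the same target. -/
def deep (e₁ e₂ : Arrow Q) (h : e₁.2.1 = e₂.2.1) : LabelledGraph Q (Fin 3) where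
  vert := ![e₁.1, e₂.1, e₁.2.1]
  edge := ![![none, none, some e₁], ![none, none, some e₂], ![none, none, none]]
  compat {i j e} := by
    fin_cases i <;> fin_cases j <;> simp <;> rintro rfl <;> simp [h]

/-- The four-subspace type graph of three arrows with the same source. -/
def threeOut (e₁ e₂ e₃ : Arrow Q) (h₂ : e₁.1 = e₂.1) (h₃ : e₁.1 = e₃.1) :
    LabelledGraph Q (Fin 5) where
  vert := ![e₁.1, e₁.1, e₁.2.1, e₂.2.1, e₃.2.1]
  edge := ![![none, none, some e₁, none, some e₃], ![none, none, none, some e₂, some e₃],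
    fun _ => none, fun _ => none, fun _ => none]
  compat {i j e} := by
    fin_cases i <;> fin_cases j <;> simp <;> rintro rfl <;> simp [h₂] <;> simp [← h₂, h₃]

/-- Three arrows with the same target. -/
def threeIn (e₁ e₂ e₃ : Arrow Q) (h₂ : e₁.2.1 = e₂.2.1) (h₃ : e₁.2.1 = e₃.2.1) :
    LabelledGraph Q (Fin 5) where
  vert := ![e₁.1, e₂.1, e₃.1, e₁.2.1, e₁.2.1]
  edge := ![![none, none, none, some e₁, none], ![none, none, none, none, some e₂],
    ![none, none, none, some e₃, some e₃], fun _ => none, fun _ => none]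
  compat {i j e} := by
    fin_cases i <;> fin_cases j <;> simp <;> rintro rfl <;> simp [h₂] <;> simp [← h₂, h₃]

/-- Two arrows ending where a third one starts. -/
def twoInOneOut (b₁ b₂ a : Arrow Q) (h₂ : b₁.2.1 = b₂.2.1) (h₃ : b₁.2.1 = a.1) :
    LabelledGraph Q (Fin 5) where
  vert := ![b₁.1, b₂.1, b₁.2.1, b₁.2.1, a.2.1]
  edge := ![![none, none, some b₁, some b₁, none], ![none, none, none, some b₂, none],
    fun _ => none, ![none, none, none, none, some a], fun _ => none]
  compat {i j e} := by
    fin_cases i <;> fin_cases j <;> simp <;> rintro rfl <;> simp [h₂] <;> simp [← h₂, h₃]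

/-- Two arrows starting where a third one ends. -/
def oneInTwoOut (b a₁ a₂ : Arrow Q) (h₁ : b.2.1 = a₁.1) (h₂ : b.2.1 = a₂.1) :
    LabelledGraph Q (Fin 5) where
  vert := ![b.1, b.2.1, b.2.1, a₁.2.1, a₂.2.1]
  edge := ![![none, some b, none, none, none], ![none, none, none, some a₁, some a₂],
    ![none, none, none, none, some a₂], fun _ => none, fun _ => none]
  compat {i j e} := by
    fin_cases i <;> fin_cases j <;> simp <;> rintro rfl <;> simp [h₁] <;> simp [← h₁, h₂]

variable [Fintype Q] (k : Type w) [Field k]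

/-- The top is one-dimensional, so the module is indecomposable; the two images of its generator
span the submodule. Only `e₁ ≠ e₂` is needed, so loops and parallel arrows are allowed. -/
theorem hasExtension_of_peak {e₁ e₂ : Arrow Q} (h : e₁.1 = e₂.1) (hne : e₁ ≠ e₂) :
    HasExtension k (PathAlgebra k Q) 1 2 1 := by
  let G := peak e₁ e₂ h
  have hG : G.Graded k :=
    { height := ![0, 1, 1]
      height_lt := fun {i j} => by fin_cases i <;> fin_cases j <;> simp [G, peak]
      mem_rad := fun i hi => by
        fin_cases i
        · exact absurd (by simp [isTop_def, G, peak, Fin.forall_fin_succ]) hi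
        · exact G.basis_mem_rad (j := 0) (e := e₁)
            (by simp [G, peak, Fin.forall_fin_succ, hne.symm])
        · exact G.basis_mem_rad (j := 0) (e := e₂)
            (by simp [G, peak, Fin.forall_fin_succ, hne]) }
  have hind : IsIndecomposableModule (PathAlgebra k Q) (G.mod k) := by
    refine hG.isIndecomposableModule fun f hf => ⟨G.coef f 0 0, fun i j hi hj => ?_⟩
    have h0 : ∀ i, G.IsTop i → i = 0 := by
      simp [isTop_def, G, peak, Fin.forall_fin_succ]
    rw [h0 i hi, h0 j hj]
    simp
  refine hasExtension hind (I₁ := {1}) (I₂ := {2}) (J₁ := {1, 2}) (J₂ := Set.univ)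
    ?_ ?_ ?_ ?_ ?_ ?_ ?_ (.inr ⟨le_rfl, ⟨1, rfl⟩, ⟨2, rfl⟩⟩) (.inl ⟨le_rfl, ?_, rfl⟩)
  all_goals simp [IsClosed, Fin.forall_fin_succ, Set.ext_iff, G, peak]

/-- The two tops are told apart by the arrow that does not kill them and are tied together by their
common image, so every endomorphism is a scalar on the top. The submodule is the line spanned by
that image. -/
theorem hasExtension_of_deep {e₁ e₂ : Arrow Q} (h : e₁.2.1 = e₂.2.1) (hne : e₁ ≠ e₂) :
    HasExtension k (PathAlgebra k Q) 1 1 2 := by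
  classical
  let G := deep e₁ e₂ h
  have hG : G.Graded k :=
    { height := ![0, 0, 1]
      height_lt := fun {i j} => by fin_cases i <;> fin_cases j <;> simp [G, deep]
      mem_rad := fun i hi => by
        fin_cases i
        · exact absurd (by simp [isTop_def, G, deep, Fin.forall_fin_succ]) hi
        · exact absurd (by simp [isTop_def, G, deep, Fin.forall_fin_succ]) hi
        · exact G.basis_mem_rad (j := 0) (e := e₁) (by simp [G, deep, Fin.forall_fin_succ]) }
  have hind : IsIndecomposableModule (PathAlgebra k Q) (G.mod k) := by
    refine hG.isIndecomposableModule fun f hf => ⟨G.coef f 2 2, fun i j hi hj => ?_⟩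
    have h0 : ∀ i, G.IsTop i → i = 0 ∨ i = 1 := by
      simp [isTop_def, G, deep, Fin.forall_fin_succ]
    have c := G.coef_comm f
    have c1 := c e₁ 2 0
    have c2 := c e₂ 2 1
    have c3 := c e₁ 2 1
    have c4 := c e₂ 2 0
    simp [G, deep, Fin.sum_univ_succ, hne, hne.symm] at c1 c2 c3 c4
    rcases h0 i hi with rfl | rfl <;> rcases h0 j hj with rfl | rfl <;>
      simp [G, deep, c1, c2, c3, c4]
  refine hasExtension hind (I₁ := {2}) (I₂ := ∅) (J₁ := {0, 2}) (J₂ := {1, 2})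
    ?_ ?_ ?_ ?_ ?_ ?_ ?_ (.inl ⟨le_rfl, ⟨2, rfl⟩⟩) (.inr ⟨le_rfl, ?_, ?_⟩)
  all_goals simp [IsClosed, Fin.forall_fin_succ, Set.ext_iff, G, deep]

/-- The arrows `e₁` and `e₂` force the off-diagonal entries on the two tops to vanish, and the
common image under `e₃` equates the diagonal ones. -/
theorem hasExtension_of_threeOut {e₁ e₂ e₃ : Arrow Q} (h₂ : e₁.1 = e₂.1) (h₃ : e₁.1 = e₃.1)
    (n₁₂ : e₁ ≠ e₂) (n₁₃ : e₁ ≠ e₃) (n₂₃ : e₂ ≠ e₃) :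
    HasExtension k (PathAlgebra k Q) 1 2 2 := by
  classical
  let G := threeOut e₁ e₂ e₃ h₂ h₃
  have hG : G.Graded k :=
    { height := ![0, 0, 1, 1, 1]
      height_lt := fun {i j} => by fin_cases i <;> fin_cases j <;> simp [G, threeOut]
      mem_rad := fun i hi => by
        fin_cases i
        · exact absurd (by simp [isTop_def, G, threeOut, Fin.forall_fin_succ]) hi
        · exact absurd (by simp [isTop_def, G, threeOut, Fin.forall_fin_succ]) hi
        · exact G.basis_mem_rad (j := 0) (e := e₁)
            (by simp [G, threeOut, Fin.forall_fin_succ, n₁₃.symm])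
        · exact G.basis_mem_rad (j := 1) (e := e₂)
            (by simp [G, threeOut, Fin.forall_fin_succ, n₂₃.symm])
        · exact G.basis_mem_rad (j := 0) (e := e₃)
            (by simp [G, threeOut, Fin.forall_fin_succ, n₁₃]) }
  have hind : IsIndecomposableModule (PathAlgebra k Q) (G.mod k) := by
    refine hG.isIndecomposableModule fun f hf => ⟨G.coef f 4 4, fun i j hi hj => ?_⟩
    have h0 : ∀ i, G.IsTop i → i = 0 ∨ i = 1 := by
      simp [isTop_def, G, threeOut, Fin.forall_fin_succ]
    have c1 := G.coef_comm f e₁ 2 1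
    have c2 := G.coef_comm f e₂ 3 0
    have c3 := G.coef_comm f e₃ 4 0
    have c4 := G.coef_comm f e₃ 4 1
    simp [G, threeOut, Fin.sum_univ_succ, n₁₂, n₁₂.symm, n₁₃, n₁₃.symm, n₂₃, n₂₃.symm]
      at c1 c2 c3 c4
    rw [c2, add_zero] at c3
    rw [c1, zero_add] at c4
    rcases h0 i hi with rfl | rfl <;> rcases h0 j hj with rfl | rfl <;>
      simp [G, threeOut, c1, c2, c3, c4]
  refine hasExtension hind (I₁ := {2}) (I₂ := {3, 4}) (J₁ := {0, 2, 3, 4}) (J₂ := {1, 2, 3, 4})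
    ?_ ?_ ?_ ?_ ?_ ?_ ?_ (.inr ⟨le_rfl, ⟨2, rfl⟩, ⟨3, .inl rfl⟩⟩) (.inr ⟨le_rfl, ?_, ?_⟩)
  all_goals simp [IsClosed, Fin.forall_fin_succ, Set.ext_iff, G, threeOut]

/-- The label of its outgoing edges distinguishes each top from the others. Since `b₃` sends the
third top to the sum of the images of the first two, all three diagonal entries agree. -/
theorem hasExtension_of_threeIn {b₁ b₂ b₃ : Arrow Q} (h₂ : b₁.2.1 = b₂.2.1)
    (h₃ : b₁.2.1 = b₃.2.1) (n₁₂ : b₁ ≠ b₂) (n₁₃ : b₁ ≠ b₃) (n₂₃ : b₂ ≠ b₃) :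
    HasExtension k (PathAlgebra k Q) 1 2 2 := by
  classical
  let G := threeIn b₁ b₂ b₃ h₂ h₃
  have hG : G.Graded k :=
    { height := ![0, 0, 0, 1, 1]
      height_lt := fun {i j} => by fin_cases i <;> fin_cases j <;> simp [G, threeIn]
      mem_rad := fun i hi => by
        fin_cases i
        · exact absurd (by simp [isTop_def, G, threeIn, Fin.forall_fin_succ]) hi
        · exact absurd (by simp [isTop_def, G, threeIn, Fin.forall_fin_succ]) hi
        · exact absurd (by simp [isTop_def, G, threeIn, Fin.forall_fin_succ]) hi
        · exact G.basis_mem_rad (j := 0) (e := b₁) (by simp [G, threeIn, Fin.forall_fin_succ])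
        · exact G.basis_mem_rad (j := 1) (e := b₂) (by simp [G, threeIn, Fin.forall_fin_succ]) }
  have hind : IsIndecomposableModule (PathAlgebra k Q) (G.mod k) := by
    refine hG.isIndecomposableModule fun f hf => ⟨G.coef f 2 2, fun i j hi hj => ?_⟩
    have h0 : ∀ i, G.IsTop i → i = 0 ∨ i = 1 ∨ i = 2 := by
      simp [isTop_def, G, threeIn, Fin.forall_fin_succ]
    have c1 := G.coef_comm f b₁ 3 0
    have c2 := G.coef_comm f b₁ 3 1
    have c3 := G.coef_comm f b₁ 3 2
    have c4 := G.coef_comm f b₂ 4 0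
    have c5 := G.coef_comm f b₂ 4 1
    have c6 := G.coef_comm f b₂ 4 2
    have c7 := G.coef_comm f b₃ 3 0
    have c8 := G.coef_comm f b₃ 3 1
    have c9 := G.coef_comm f b₃ 3 2
    have d1 := G.coef_comm f b₃ 4 2
    have d2 := G.coef_comm f b₂ 3 1
    have d3 := G.coef_comm f b₁ 4 0
    simp [G, threeIn, Fin.sum_univ_succ, n₁₂, n₁₂.symm, n₁₃, n₁₃.symm, n₂₃, n₂₃.symm]
      at c1 c2 c3 c4 c5 c6 c7 c8 c9 d1 d2 d3
    rw [← d2, add_zero, ← c1] at c9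
    rw [← d3, zero_add, ← c5] at d1
    rcases h0 i hi with rfl | rfl | rfl <;> rcases h0 j hj with rfl | rfl | rfl <;>
      simp [G, threeIn, c2, c3, c4, c6, c7, c8, c9.symm, d1.symm]
  refine hasExtension hind (I₁ := {3}) (I₂ := {4}) (J₁ := {0, 3, 4}) (J₂ := {1, 2, 3, 4})
    ?_ ?_ ?_ ?_ ?_ ?_ ?_ (.inr ⟨le_rfl, ⟨3, rfl⟩, ⟨4, rfl⟩⟩) (.inr ⟨le_rfl, ?_, ?_⟩)
  all_goals simp [IsClosed, Fin.forall_fin_succ, Set.ext_iff, G, threeIn]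

/-- The arrow `b₁` hits the sum of the basis elements `2` and `3`. As `a` kills `2` but not `3`, the
entry `(3, 2)` vanishes, and comparing `b₁` with `b₂` at `3` equates the diagonal entries on the
tops. -/
theorem hasExtension_of_twoInOneOut {b₁ b₂ a : Arrow Q} (h₂ : b₁.2.1 = b₂.2.1)
    (h₃ : b₁.2.1 = a.1) (n : b₁ ≠ b₂) : HasExtension k (PathAlgebra k Q) 1 2 2 := by
  classical
  let G := twoInOneOut b₁ b₂ a h₂ h₃
  have hG : G.Graded k :=
    { height := ![0, 0, 1, 1, 2]
      height_lt := fun {i j} => by fin_cases i <;> fin_cases j <;> simp [G, twoInOneOut]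
      mem_rad := fun i hi => by
        have h3 : (G.basis 3 : G.mod k) ∈ G.rad k :=
          G.basis_mem_rad (j := 1) (e := b₂) (by simp [G, twoInOneOut, Fin.forall_fin_succ])
        fin_cases i
        · exact absurd (by simp [isTop_def, G, twoInOneOut, Fin.forall_fin_succ]) hi
        · exact absurd (by simp [isTop_def, G, twoInOneOut, Fin.forall_fin_succ]) hi
        -- The basis element `2` is not itself the image of a basis element; it is a difference of
        -- two elements of the radical.
        · have h2 : (G.basis 2 : G.mod k) =
              PathAlgebra.ofPath k b₁.2.2.toPath • G.basis 0 - G.basis 3 := by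
            refine G.coord_ext fun l => ?_
            rw [coord_sub, coord_arrow_smul]
            fin_cases l <;> simp [coord_basis, Fin.sum_univ_succ, G, twoInOneOut]
          exact h2 ▸ sub_mem (Submodule.subset_span ⟨b₁, G.basis 0, rfl⟩) h3
        · exact h3
        · exact G.basis_mem_rad (j := 3) (e := a)
            (by simp [G, twoInOneOut, Fin.forall_fin_succ]) }
  have hind : IsIndecomposableModule (PathAlgebra k Q) (G.mod k) := by
    refine hG.isIndecomposableModule fun f hf => ⟨G.coef f 3 3, fun i j hi hj => ?_⟩
    have h0 : ∀ i, G.IsTop i → i = 0 ∨ i = 1 := by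
      simp [isTop_def, G, twoInOneOut, Fin.forall_fin_succ]
    have c1 := G.coef_comm f b₁ 2 1
    have c2 := G.coef_comm f b₂ 3 0
    have c3 := G.coef_comm f b₁ 3 0
    have c4 := G.coef_comm f b₂ 3 1
    have c5 := G.coef_comm f a 4 2
    simp [G, twoInOneOut, Fin.sum_univ_succ, n, n.symm] at c1 c2 c3 c4 c5
    rw [c5, zero_add] at c3
    rcases h0 i hi with rfl | rfl <;> rcases h0 j hj with rfl | rfl <;>
      simp [G, twoInOneOut, c1, c2, c3, c4]
  refine hasExtension hind (I₁ := {2}) (I₂ := {3, 4}) (J₁ := {0, 2, 3, 4}) (J₂ := {1, 2, 3, 4})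
    ?_ ?_ ?_ ?_ ?_ ?_ ?_ (.inr ⟨le_rfl, ⟨2, rfl⟩, ⟨3, .inl rfl⟩⟩) (.inr ⟨le_rfl, ?_, ?_⟩)
  all_goals simp [IsClosed, Fin.forall_fin_succ, Set.ext_iff, G, twoInOneOut]

/-- The tops are `0` and `2`. The entry `(2, 0)` is not forced to vanish for general endomorphisms,
hence the triangular criterion. The basis elements `1` and `2` have a common component `4` in their
images under `a₂`, which together with `b` equates the diagonal entries. -/
theorem hasExtension_of_oneInTwoOut_of_ne {b a₁ a₂ : Arrow Q} (h₁ : b.2.1 = a₁.1)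
    (h₂ : b.2.1 = a₂.1) (n : a₁ ≠ a₂) (hb : b ≠ a₂) :
    HasExtension k (PathAlgebra k Q) 1 2 2 := by
  classical
  let G := oneInTwoOut b a₁ a₂ h₁ h₂
  have hG : G.Graded k :=
    { height := ![0, 1, 0, 2, 2]
      height_lt := fun {i j} => by fin_cases i <;> fin_cases j <;> simp [G, oneInTwoOut]
      mem_rad := fun i hi => by
        fin_cases i
        · exact absurd (by simp [isTop_def, G, oneInTwoOut, Fin.forall_fin_succ]) hi
        · exact G.basis_mem_rad (j := 0) (e := b) (by simp [G, oneInTwoOut, Fin.forall_fin_succ])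
        · exact absurd (by simp [isTop_def, G, oneInTwoOut, Fin.forall_fin_succ]) hi
        · exact G.basis_mem_rad (j := 1) (e := a₁)
            (by simp [G, oneInTwoOut, Fin.forall_fin_succ, n.symm])
        · exact G.basis_mem_rad (j := 2) (e := a₂)
            (by simp [G, oneInTwoOut, Fin.forall_fin_succ]) }
  have hind : IsIndecomposableModule (PathAlgebra k Q) (G.mod k) := by
    have h0 : ∀ i, G.IsTop i ↔ i = 0 ∨ i = 2 := by
      simp [isTop_def, G, oneInTwoOut, Fin.forall_fin_succ]
    refine hG.isIndecomposableModule_of_two_tops (s := 0) (t := 2) (by decide) h0 fun f => ?_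
    have c1 := G.coef_comm f b 1 2
    have c2 := G.coef_comm f b 1 0
    have c3 := G.coef_comm f a₂ 4 2
    have c4 := G.coef_comm f a₂ 4 1
    have c5 := G.coef_comm f a₁ 3 2
    simp [G, oneInTwoOut, Fin.sum_univ_succ, n, n.symm, hb.symm] at c1 c2 c3 c4 c5
    -- Not a commutation relation: `2` is a top, while `1` lies in the radical.
    have z4 : G.coef f 2 1 = 0 := hG.coef_eq_zero f ((h0 2).2 (.inr rfl)) (by simp [h0])
    refine ⟨c1, ?_⟩
    change G.coef f 1 2 = 0 at c5
    change G.coef f 0 0 = G.coef f 1 1 at c2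
    change G.coef f 1 2 + G.coef f 2 2 = G.coef f 4 4 at c3
    change G.coef f 1 1 + G.coef f 2 1 = G.coef f 4 4 at c4
    rw [c2, ← add_zero (G.coef f 1 1), ← z4, c4, ← c3, c5, zero_add]
  refine hasExtension hind (I₁ := {3}) (I₂ := {4}) (J₁ := {0, 1, 3, 4}) (J₂ := {2, 3, 4})
    ?_ ?_ ?_ ?_ ?_ ?_ ?_ (.inr ⟨le_rfl, ⟨3, rfl⟩, ⟨4, rfl⟩⟩) (.inr ⟨le_rfl, ?_, ?_⟩)
  all_goals simp [IsClosed, Fin.forall_fin_succ, Set.ext_iff, G, oneInTwoOut]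

/-- If `b` is a loop equal to `a₂`, then it differs from `a₁` and the roles of `a₁` and `a₂` can be
exchanged. -/
theorem hasExtension_of_oneInTwoOut {b a₁ a₂ : Arrow Q} (h₁ : b.2.1 = a₁.1)
    (h₂ : b.2.1 = a₂.1) (n : a₁ ≠ a₂) : HasExtension k (PathAlgebra k Q) 1 2 2 := by
  by_cases hb : b = a₂
  · exact hasExtension_of_oneInTwoOut_of_ne k h₂ h₁ n.symm fun h => n (h.symm.trans hb)
  · exact hasExtension_of_oneInTwoOut_of_ne k h₁ h₂ n hb

/-- A walk `y ← x₀ → x₁ → ⋯ → x_{m + 1} ← z`. -/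
def zigzag (m : ℕ) (p : ℕ → Arrow Q) (a b : Arrow Q) (hp : ∀ i < m, (p i).2.1 = (p (i + 1)).1)
    (ha : a.1 = (p 0).1) (hb : b.2.1 = (p m).2.1) : LabelledGraph Q (Bool ⊕ Fin (m + 2)) where
  vert
    | .inl true => a.2.1
    | .inl false => b.1
    | .inr i => if i.val ≤ m then (p i).1 else (p m).2.1
  edge
    | .inr i, .inl true => if i.val = 0 then some a else none
    | .inl false, .inr i => if i.val = m + 1 then some b else none
    | .inr i, .inr j => if j.val = i.val + 1 then some (p i) else none
    | _, _ => none
  compat {i j e} := by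
    rcases i with (_ | _) | i <;> rcases j with (_ | _) | j <;> simp
    · rintro h rfl
      simp [h, hb]
    · rintro h rfl
      simp [h, ha]
    · rintro h rfl
      have := j.2
      refine ⟨by rw [if_pos (by omega)], ?_⟩
      by_cases h' : i.val < m
      · rw [if_pos (by omega), hp _ h', h]
      · rw [if_neg (by omega), show i.val = m by omega]

/-- The tops are `x₀` and `z`. Walking along the `p i` and back along `b` equates their diagonal
entries. Vertices and arrows of the walk may repeat; only the two turns must be genuine, so `m = 0`
covers parallel arrows. -/
theorem hasExtension_of_zigzag {m : ℕ} {p : ℕ → Arrow Q} {a b : Arrow Q}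
    (hp : ∀ i < m, (p i).2.1 = (p (i + 1)).1) (ha : a.1 = (p 0).1) (hb : b.2.1 = (p m).2.1)
    (hap : a ≠ p 0) (hbp : b ≠ p m) : HasExtension k (PathAlgebra k Q) 1 2 2 := by
  let G := zigzag m p a b hp ha hb
  have htop : ∀ i, G.IsTop i ↔ i = .inr 0 ∨ i = .inl false := by
    intro i
    rw [isTop_def]
    rcases i with (_ | _) | i
    · simp [G, zigzag]
    · simp only [reduceCtorEq, Sum.inl.injEq, Bool.true_eq_false, or_self, iff_false]
      exact fun h => by simpa [G, zigzag] using h (.inr 0)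
    · simp only [Sum.inr.injEq, reduceCtorEq, or_false]
      constructor
      · intro h
        by_contra hi
        have hi' : i.val ≠ 0 := fun h => hi (Fin.ext h)
        have := h (.inr ⟨i.val - 1, by omega⟩)
        simp [G, zigzag, show i.val - 1 + 1 = i.val by omega] at this
      · rintro rfl
        rintro ((_ | _) | j) <;> simp [G, zigzag]
  have into : ∀ (i : ℕ) (hi : i < m + 1) (l), G.edge l (.inr ⟨i + 1, by omega⟩) = some (p i) ↔
      l = .inr ⟨i, by omega⟩ := by
    intro i hi l
    rcases l with (_ | _) | l
    · simp only [G, zigzag, reduceCtorEq, iff_false]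
      split_ifs with h
      · have : i = m := by omega
        subst this
        simpa using hbp
      · simp
    · simp [G, zigzag]
    · simp only [G, zigzag, Sum.inr.injEq, Fin.ext_iff, add_left_inj]
      split_ifs with h
      · simp [h]
      · simp [Ne.symm h]
  have out : ∀ (i : ℕ) (hi : i < m + 1) (l), G.edge (.inr ⟨i, by omega⟩) l = some (p i) ↔
      l = .inr ⟨i + 1, by omega⟩ := by
    intro i hi l
    rcases l with (_ | _) | l
    · simp [G, zigzag]
    · simp only [G, zigzag, reduceCtorEq, iff_false]
      split_ifs with h
      · subst h
        simpa using hap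
      · simp
    · simp only [G, zigzag, Sum.inr.injEq, Fin.ext_iff]
      split_ifs with h
      · simp [h]
      · simp [h]
  have hG : G.Graded k :=
    { height := Sum.elim (fun c => if c then m + 1 else 0) fun i => i.val
      height_lt := fun {i j} => by
        rcases i with (_ | _) | i <;> rcases j with (_ | _) | j <;> simp [G, zigzag]
        · intro h
          rw [Fin.lt_def, h]
          simp
        · rintro rfl
          simp
        · omega
      mem_rad := fun i hi => by
        rw [htop] at hi
        rcases i with (_ | _) | i
        · simp at hi
        · refine G.basis_mem_rad (j := .inr 0) (e := a) fun l => ?_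
          rcases l with (_ | _) | l
          · simp [G, zigzag]
          · simp [G, zigzag]
          · simp only [G, zigzag, reduceCtorEq, iff_false]
            split_ifs with h
            · simpa using hap.symm
            · simp
        · have hi' : i.val ≠ 0 := fun h => hi (.inl (congrArg _ (Fin.ext h)))
          have h1 := out (i.val - 1) (by omega)
          have h2 : (⟨i.val - 1 + 1, by omega⟩ : Fin (m + 2)) = i := Fin.ext (by simp; omega)
          rw [h2] at h1
          exact G.basis_mem_rad h1 }
  have hind : IsIndecomposableModule (PathAlgebra k Q) (G.mod k) := by
    refine hG.isIndecomposableModule_of_two_tops (by simp) htop fun f => ⟨?_, ?_⟩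
    -- If `b = p 0`, the arrow `p 0` does not kill `z`, so the entry is first moved one step along
    -- the walk; there `p 1` forces it to vanish, because no edge leaves `x_{m + 1}`.
    · by_cases hbp0 : b = p 0
      · have hm : m ≠ 0 := fun h => hbp (h ▸ hbp0)
        have h1 : G.coef f (.inr 0) (.inl false) = G.coef f (.inr ⟨1, by omega⟩)
            (.inr ⟨m + 1, by omega⟩) := by
          refine G.coef_eq_coef f (p 0) (into 0 (by omega)) fun l => ?_
          rcases l with (_ | _) | l
          · simp [G, zigzag]
          · simp [G, zigzag]
          · simp only [G, zigzag, Sum.inr.injEq, Fin.ext_iff, hbp0]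
            split_ifs with h <;> simp [h]
        rw [h1]
        refine G.coef_eq_zero_of_forall_ne f (p 1) (into 1 (by omega)) fun l => ?_
        rcases l with (_ | _) | l
        · simp [G, zigzag]
        · simp [G, zigzag]
        · have := l.2
          simp [G, zigzag]
          omega
      · refine G.coef_eq_zero_of_forall_ne f (p 0) (into 0 (by omega)) fun l => ?_
        rcases l with (_ | _) | l
        · simp [G, zigzag]
        · simp [G, zigzag]
        · simp [G, zigzag, hbp0]
    · have h1 : ∀ (i : ℕ) (hi : i < m + 2), G.coef f (.inr ⟨i, hi⟩) (.inr ⟨i, hi⟩) =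
          G.coef f (.inr 0) (.inr 0) := by
        intro i
        induction i with
        | zero => exact fun _ => rfl
        | succ i ih =>
          intro hi
          rw [← ih (by omega)]
          exact (G.coef_eq_coef f (p i) (into i (by omega)) (out i (by omega))).symm
      rw [← h1 (m + 1) (by omega)]
      refine G.coef_eq_coef f b (fun l => ?_) fun l => ?_
      · rcases l with (_ | _) | l
        · simp [G, zigzag]
        · simp [G, zigzag]
        · simp only [G, zigzag, reduceCtorEq, iff_false]
          split_ifs with h
          · rw [show l.val = m by omega]
            simpa using hbp.symm
          · simp
      · rcases l with (_ | _) | l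
        · simp [G, zigzag]
        · simp [G, zigzag]
        · simp only [G, zigzag, Sum.inr.injEq, Fin.ext_iff]
          split_ifs with h <;> simp [h]
  -- Without the two tops the graph falls apart into `y` and the path from `x₁` to `x_{m + 1}`; the
  -- quotient is spanned by the two tops.
  refine hasExtension hind (I₁ := {.inl true}) (I₂ := {i | ∃ j : Fin (m + 2), j ≠ 0 ∧ i = .inr j})
    (J₁ := {i | i ≠ .inl false}) (J₂ := {i | i ≠ .inr 0})
    ?_ ?_ ?_ ?_ ?_ ?_ ?_ (.inr ⟨le_rfl, ⟨.inl true, rfl⟩, ⟨.inr 1, 1, by simp, rfl⟩⟩)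
    (.inr ⟨le_rfl, ?_, ?_⟩)
  · rintro i ((_ | _) | j) hij rfl <;> simp [G, zigzag] at hij ⊢
  · rintro _ ((_ | _) | j) hij ⟨i, hi, rfl⟩
    · simp [G, zigzag] at hij
    · simp [G, zigzag] at hij
      exact absurd hij hi
    · refine ⟨j, ?_, rfl⟩
      rintro rfl
      simp [G, zigzag] at hij
  · rintro i ((_ | _) | j) hij hi <;> simp at hi ⊢
    rcases i with (_ | _) | i <;> simp [G, zigzag] at hij
  · rintro i ((_ | _) | j) hij hi <;> simp at hi ⊢
    rintro rfl
    rcases i with (_ | _) | i <;> simp [G, zigzag] at hij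
  · ext i
    rcases i with (_ | _) | i <;> simp
  · ext i
    rcases i with (_ | _) | i <;> simp
  · ext i
    rcases i with (_ | _) | i <;> simp
  · exact fun h => (Set.ext_iff.1 h (.inl false)).2 trivial rfl
  · exact fun h => (Set.ext_iff.1 h (.inr 0)).2 trivial rfl

end Examples

end LabelledGraph

/-! ## Quivers of small degree without zigzags -/

section Combinatorics

variable {Q : Type u}

/-- The vertices `v i` form a connected component of the relation `R`, isomorphic to a basic
quiver. -/
structure IsComponent (R : Q → Q → Prop) (B : BasicQuiver) (v : ℕ → Q) : Prop where
  injOn : Set.InjOn v B.vertices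
  rel_iff : ∀ i ∈ B.vertices, ∀ j ∈ B.vertices, R (v i) (v j) ↔ B.HasArrow i j
  out : ∀ i ∈ B.vertices, ∀ b, R (v i) b → ∃ j ∈ B.vertices, v j = b
  into : ∀ i ∈ B.vertices, ∀ a, R a (v i) → ∃ j ∈ B.vertices, v j = a

/-- Some vertex has two successors. -/
def HasPeak (R : Q → Q → Prop) : Prop := ∃ a b c, b ≠ c ∧ R a b ∧ R a c

/-- Each vertex has at most two neighbours, and there is no walk with two turns. -/
structure IsTame (R : Q → Q → Prop) : Prop where
  out_le_two : ∀ {a b b' c}, R a b → R a b' → b ≠ b' → R a c → c = b ∨ c = b'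
  in_le_two : ∀ {a b b' c}, R b a → R b' a → b ≠ b' → R c a → c = b ∨ c = b'
  not_in : ∀ {a b b' z}, R a b → R a b' → b ≠ b' → ¬ R z a
  not_out : ∀ {a b b' z}, R b a → R b' a → b ≠ b' → ¬ R a z
  no_zigzag : ∀ (m : ℕ) (v : ℕ → Q) (b z : Q), (∀ i ≤ m, R (v i) (v (i + 1))) → R (v 0) b →
    b ≠ v 1 → R z (v (m + 1)) → z = v m

/-- The list of conditions is self-dual; a zigzag is read backwards. -/
theorem IsTame.flip {R : Q → Q → Prop} (h : IsTame R) : IsTame (flip R) where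
  out_le_two := h.in_le_two
  in_le_two := h.out_le_two
  not_in := h.not_out
  not_out := h.not_in
  no_zigzag m v b z hv hb hne hz := by
    by_contra hzv
    refine hne (h.no_zigzag m (fun i => v (m + 1 - i)) z b (fun i hi => ?_) hz ?_ ?_ |>.trans ?_)
    · have := hv (m - i) (by omega)
      rw [show m + 1 - i = m - i + 1 by omega, show m + 1 - (i + 1) = m - i by omega]
      exact this
    · exact hzv
    · rw [Nat.sub_self]
      exact hb
    · congr 1
      omega

/-- A maximal path starting with `s → b`. -/
structure IsMaximalChain (R : Q → Q → Prop) (s b : Q) (m : ℕ) (v : ℕ → Q) : Prop where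
  zero : v 0 = s
  one : v 1 = b
  rel : ∀ i ≤ m, R (v i) (v (i + 1))
  not_out : ∀ c, ¬ R (v (m + 1)) c
  eq_of_rel : ∀ i ≤ m, ∀ z, R z (v (i + 1)) → z = v i
  eq_of_rel' : ∀ i < m, ∀ c, R (v (i + 1)) c → c = v (i + 2)
  not_in : ∀ z, ¬ R z (v 0)

/-- Predecessors along the chain are unique, so a coincidence can be traced back to the first
vertex, which has no predecessor. -/
theorem IsMaximalChain.injOn {R : Q → Q → Prop} {s b : Q} {m : ℕ} {v : ℕ → Q}
    (h : IsMaximalChain R s b m v) {i j : ℕ} (hi : i ≤ m + 1) (hj : j ≤ m + 1)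
    (hij : v i = v j) : i = j := by
  induction i generalizing j with
  | zero =>
    cases j with
    | zero => rfl
    | succ j =>
      have := h.rel j (by omega)
      rw [← hij] at this
      exact absurd this (h.not_in _)
  | succ i ih =>
    cases j with
    | zero =>
      have := h.rel i (by omega)
      rw [hij] at this
      exact absurd this (h.not_in _)
    | succ j =>
      have := h.rel j (by omega)
      rw [← hij] at this
      rw [ih (by omega) (by omega) (h.eq_of_rel i (by omega) _ this).symm]

/-- After the prescribed first step one follows chosen successors. The uniqueness hypotheses are
only demanded along walks starting with `s → b`, since that is where tameness provides them. -/
theorem exists_isMaximalChain [Finite Q] {R : Q → Q → Prop} {s b : Q} (hsb : R s b)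
    (hs : ∀ z, ¬ R z s)
    (hin : ∀ (n : ℕ) (v : ℕ → Q), v 0 = s → v 1 = b → (∀ i ≤ n, R (v i) (v (i + 1))) →
      ∀ z, R z (v (n + 1)) → z = v n)
    (hout : ∀ (n : ℕ) (v : ℕ → Q), v 0 = s → v 1 = b → (∀ i ≤ n, R (v i) (v (i + 1))) →
      ∀ c c', R (v (n + 1)) c → R (v (n + 1)) c' → c = c') :
    ∃ m v, IsMaximalChain R s b m v := by
  classical
  let next : Q → Q := fun a => if h : ∃ c, R a c then h.choose else a
  have hnext : ∀ a, (∃ c, R a c) → R a (next a) := fun a h => by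
    simp only [next, dif_pos h]
    exact h.choose_spec
  let v : ℕ → Q := fun i => i.casesOn s fun i => next^[i] b
  have hv : ∀ i, v (i + 2) = next (v (i + 1)) := fun i => Function.iterate_succ_apply' next i b
  have hrel : ∀ n, (∀ i < n, ∃ c, R (v (i + 1)) c) → ∀ i ≤ n, R (v i) (v (i + 1)) := by
    intro n hn i hi
    cases i with
    | zero => exact hsb
    | succ i =>
      rw [hv]
      exact hnext _ (hn i (by omega))
  -- A walk that never stops would be injective, again by tracing coincidences back to the source,
  -- contradicting finiteness.
  have hex : ∃ m, ¬ ∃ c, R (v (m + 1)) c := by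
    by_contra! hall
    have hr : ∀ i, R (v i) (v (i + 1)) := fun i => hrel i (fun j _ => hall j) i le_rfl
    refine not_injective_infinite_finite v fun i => ?_
    induction i with
    | zero =>
      intro j hj
      cases j with
      | zero => rfl
      | succ j =>
        have := hr j
        rw [← hj] at this
        exact absurd this (hs _)
    | succ i ih =>
      intro j hj
      cases j with
      | zero =>
        have := hr i
        rw [hj] at this
        exact absurd this (hs _)
      | succ j =>
        have := hr j
        rw [← hj] at this
        rw [ih (hin i v rfl rfl (fun i _ => hr i) _ this).symm]
  have hmin : ∀ i < Nat.find hex, ∃ c, R (v (i + 1)) c := fun i hi => by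
    simpa using Nat.find_min hex hi
  have hr := hrel _ hmin
  refine ⟨Nat.find hex, v, rfl, rfl, hr, not_exists.1 (Nat.find_spec hex), ?_, ?_, hs⟩
  · exact fun i hi => hin i v rfl rfl fun j hj => hr j (by omega)
  · intro i hi c hc
    exact hout i v rfl rfl (fun j hj => hr j (by omega)) _ _ hc (hr (i + 1) (by omega))

/-- The chain has `m + 2` vertices, numbered from `0`, whereas the vertices of `L` are numbered from
`1`. -/
theorem IsMaximalChain.isComponent {R : Q → Q → Prop} {s b : Q} {m : ℕ} {v : ℕ → Q}
    (h : IsMaximalChain R s b m v) (hs : ∀ c, R s c → c = b) :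
    IsComponent R (.L (m + 2) (by omega)) fun i => v (i - 1) where
  injOn i hi j hj hij := by
    simp only [BasicQuiver.vertices, Finset.coe_Icc, Set.mem_Icc] at hi hj
    have := h.injOn (by omega) (by omega) hij
    omega
  rel_iff i hi j hj := by
    simp only [BasicQuiver.vertices, Finset.mem_Icc] at hi hj
    simp only [BasicQuiver.HasArrow]
    constructor
    · intro hij
      obtain ⟨j, rfl⟩ : ∃ j', j = j' + 1 := ⟨j - 1, by omega⟩
      rw [Nat.add_sub_cancel] at hij
      cases j with
      | zero => exact absurd hij (h.not_in _)
      | succ j =>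
        have := h.injOn (by omega) (by omega) (h.eq_of_rel j (by omega) _ hij)
        omega
    · rintro rfl
      have := h.rel (i - 1) (by omega)
      rwa [show i - 1 + 1 = i by omega] at this
  out i hi c hc := by
    simp only [BasicQuiver.vertices, Finset.mem_Icc] at hi ⊢
    obtain ⟨i, rfl⟩ : ∃ j', i = j' + 1 := ⟨i - 1, by omega⟩
    rw [Nat.add_sub_cancel] at hc
    cases i with
    | zero =>
      rw [h.zero] at hc
      exact ⟨2, by omega, h.one.trans (hs c hc).symm⟩
    | succ i =>
      have hi' : i ≠ m := by
        rintro rfl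
        exact h.not_out c hc
      exact ⟨i + 3, by omega, (h.eq_of_rel' i (by omega) c hc).symm⟩
  into i hi a ha := by
    simp only [BasicQuiver.vertices, Finset.mem_Icc] at hi ⊢
    obtain ⟨i, rfl⟩ : ∃ j', i = j' + 1 := ⟨i - 1, by omega⟩
    rw [Nat.add_sub_cancel] at ha
    cases i with
    | zero => exact absurd ha (h.not_in _)
    | succ i => exact ⟨i + 1, by omega, (h.eq_of_rel i (by omega) a ha).symm⟩

theorem isComponent_singleton {R : Q → Q → Prop} {s : Q} (h : ∀ c, ¬ R s c) (h' : ∀ c, ¬ R c s) :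
    IsComponent R (.L 1 le_rfl) fun _ => s where
  injOn i hi j hj _ := by
    simp only [BasicQuiver.vertices, Finset.coe_Icc, Set.mem_Icc] at hi hj
    omega
  rel_iff i hi j hj := by
    simp only [BasicQuiver.vertices, Finset.mem_Icc] at hi hj
    simp only [BasicQuiver.HasArrow, h, false_iff]
    omega
  out i _ b hb := absurd hb (h b)
  into i _ b hb := absurd hb (h' b)

/-- A common vertex of the two chains can be traced back in both at once; this ends at the source or
at the first steps, which differ. -/
theorem IsMaximalChain.eq_zero_of_eq {R : Q → Q → Prop} {s b c : Q} {m n : ℕ} {v w : ℕ → Q}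
    (hv : IsMaximalChain R s b m v) (hw : IsMaximalChain R s c n w) (hbc : b ≠ c) {i j : ℕ}
    (hi : i ≤ m + 1) (hj : j ≤ n + 1) (hij : v i = w j) : i = 0 ∧ j = 0 := by
  induction i generalizing j with
  | zero =>
    cases j with
    | zero => exact ⟨rfl, rfl⟩
    | succ j =>
      have := hw.rel j (by omega)
      rw [← hij] at this
      exact absurd this (hv.not_in _)
  | succ i ih =>
    cases j with
    | zero =>
      have := hv.rel i (by omega)
      rw [hij] at this
      exact absurd this (hw.not_in _)
    | succ j =>
      have := hw.rel j (by omega)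
      rw [← hij] at this
      obtain ⟨rfl, rfl⟩ := ih (by omega) (by omega) (hv.eq_of_rel i (by omega) _ this).symm
      rw [zero_add, hv.one, hw.one] at hij
      exact absurd hij hbc

/-- The first chain, read backwards, occupies the labels `1, …, m + 2`, ending at the source; the
second continues from there. The source is shared, hence `(m + 2) + (n + 2) - 1` vertices. -/
theorem IsMaximalChain.isComponent_of_peak {R : Q → Q → Prop} {s b c : Q} {m n : ℕ}
    {v w : ℕ → Q} (hv : IsMaximalChain R s b m v) (hw : IsMaximalChain R s c n w) (hbc : b ≠ c)
    (hs : ∀ x, R s x → x = b ∨ x = c) :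
    IsComponent R (.Λ (m + n + 3) (m + 2) (by omega) (by omega))
      fun i => if i ≤ m + 2 then v (m + 2 - i) else w (i - (m + 2)) where
  injOn i hi j hj hij := by
    simp only [BasicQuiver.vertices, Finset.coe_Icc, Set.mem_Icc] at hi hj
    dsimp only at hij
    split_ifs at hij with h1 h2 h2
    · have := hv.injOn (by omega) (by omega) hij
      omega
    · have := hv.eq_zero_of_eq hw hbc (by omega) (by omega) hij
      omega
    · have := hv.eq_zero_of_eq hw hbc (by omega) (by omega) hij.symm
      omega
    · have := hw.injOn (by omega) (by omega) hij
      omega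
  rel_iff i hi j hj := by
    simp only [BasicQuiver.vertices, Finset.mem_Icc] at hi hj
    simp only [BasicQuiver.HasArrow]
    constructor
    · intro hij
      by_cases h2 : j ≤ m + 2
      · rw [if_pos h2] at hij
        by_cases h3 : j = m + 2
        · rw [h3, Nat.sub_self] at hij
          exact absurd hij (hv.not_in _)
        rw [show m + 2 - j = m + 1 - j + 1 by omega] at hij
        have h4 := hv.eq_of_rel _ (by omega) _ hij
        split_ifs at h4 with h1
        · have := hv.injOn (by omega) (by omega) h4
          omega
        · have := hv.eq_zero_of_eq hw hbc (by omega) (by omega) h4.symm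
          omega
      · rw [if_neg h2, show j - (m + 2) = j - (m + 3) + 1 by omega] at hij
        have h4 := hw.eq_of_rel _ (by omega) _ hij
        split_ifs at h4 with h1
        · have := hv.eq_zero_of_eq hw hbc (by omega) (by omega) h4
          omega
        · have := hw.injOn (by omega) (by omega) h4
          omega
    · rintro (⟨rfl, h1⟩ | ⟨rfl, h1⟩)
      · rw [if_pos h1, if_pos (by omega)]
        have := hv.rel (m + 2 - (j + 1)) (by omega)
        rwa [show m + 2 - (j + 1) + 1 = m + 2 - j by omega] at this
      · rw [if_neg (show ¬ i + 1 ≤ m + 2 by omega)]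
        have := hw.rel (i - (m + 2)) (by omega)
        rw [show i - (m + 2) + 1 = i + 1 - (m + 2) by omega] at this
        split_ifs with h2
        · obtain rfl : i = m + 2 := by omega
          rw [Nat.sub_self] at this ⊢
          rwa [hv.zero, ← hw.zero]
        · exact this
  out i hi x hx := by
    simp only [BasicQuiver.vertices, Finset.mem_Icc] at hi ⊢
    by_cases h3 : i = m + 2
    · subst h3
      rw [if_pos le_rfl, Nat.sub_self, hv.zero] at hx
      rcases hs x hx with rfl | rfl
      · refine ⟨m + 1, by omega, ?_⟩
        rw [if_pos (by omega), show m + 2 - (m + 1) = 1 by omega, hv.one]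
      · refine ⟨m + 3, by omega, ?_⟩
        rw [if_neg (by omega), show m + 3 - (m + 2) = 1 by omega, hw.one]
    · split_ifs at hx with h1
      · have hi' : i ≠ 1 := by
          rintro rfl
          exact hv.not_out x hx
        rw [show m + 2 - i = m + 1 - i + 1 by omega] at hx
        refine ⟨i - 1, by omega, ?_⟩
        rw [if_pos (by omega), hv.eq_of_rel' _ (by omega) x hx]
        congr 1
        omega
      · have hi' : i ≠ m + n + 3 := by
          rintro rfl
          rw [show m + n + 3 - (m + 2) = n + 1 by omega] at hx
          exact hw.not_out x hx
        rw [show i - (m + 2) = i - (m + 3) + 1 by omega] at hx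
        refine ⟨i + 1, by omega, ?_⟩
        rw [if_neg (by omega), hw.eq_of_rel' _ (by omega) x hx]
        congr 1
        omega
  into i hi x hx := by
    simp only [BasicQuiver.vertices, Finset.mem_Icc] at hi ⊢
    split_ifs at hx with h1
    · by_cases h3 : i = m + 2
      · rw [h3, Nat.sub_self] at hx
        exact absurd hx (hv.not_in _)
      rw [show m + 2 - i = m + 1 - i + 1 by omega] at hx
      refine ⟨i + 1, by omega, ?_⟩
      rw [if_pos (by omega), hv.eq_of_rel _ (by omega) x hx]
      congr 1
      omega
    · rw [show i - (m + 2) = i - (m + 3) + 1 by omega] at hx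
      rw [hw.eq_of_rel _ (by omega) x hx]
      refine ⟨i - 1, by omega, ?_⟩
      split_ifs with h2
      · rw [show m + 2 - (i - 1) = 0 by omega, show i - (m + 3) = 0 by omega, hv.zero, hw.zero]
      · congr 1
        omega

/-- A second predecessor along the chain would complete a zigzag with the other branch `s → c`; a
second successor would give a branching vertex with an incoming arrow. -/
theorem IsTame.exists_isMaximalChain [Finite Q] {R : Q → Q → Prop} (h : IsTame R) {s b c : Q}
    (hb : R s b) (hc : R s c) (hbc : b ≠ c) : ∃ m v, IsMaximalChain R s b m v := by
  refine _root_.exists_isMaximalChain hb (fun z => h.not_in hb hc hbc) ?_ ?_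
  · rintro n v rfl rfl hv z hz
    exact h.no_zigzag n v c z hv hc hbc.symm hz
  · rintro n v rfl rfl hv x y hx hy
    by_contra hne
    exact h.not_in hx hy hne (hv n le_rfl)

theorem IsComponent.flip {R : Q → Q → Prop} {m y : ℕ} {hm : 3 ≤ m} {hy : 2 ≤ y ∧ y ≤ m - 1}
    {v : ℕ → Q} (h : IsComponent (flip R) (.Λ m y hm hy) v) : IsComponent R (.V m y hm hy) v where
  injOn := h.injOn
  rel_iff i hi j hj := h.rel_iff j hj i hi
  out := h.into
  into := h.out

/-- Choosing predecessors is injective because successors are unique, hence bijective on the finite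
set `U`. The inverse `σ` is the successor map, and any of its orbits is a cycle and a component. -/
theorem exists_isComponent_cycle [Finite Q] {R : Q → Q → Prop} {U : Set Q} (hne : U.Nonempty)
    (hU : ∀ a b, R a b → (a ∈ U ↔ b ∈ U)) (hpeak : ∀ a ∈ U, ∀ b c, R a b → R a c → b = c)
    (hdeep : ∀ a ∈ U, ∀ b c, R b a → R c a → b = c) (hin : ∀ a ∈ U, ∃ b, R b a) :
    ∃ n v, IsComponent R (.Δ n) v ∧ ∀ i ∈ (BasicQuiver.Δ n).vertices, v i ∈ U := by
  have hpred : ∀ a : U, ∃ b : U, R b a := fun a => by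
    obtain ⟨b, hb⟩ := hin a a.2
    exact ⟨⟨b, (hU b a hb).2 a.2⟩, hb⟩
  choose pred hpred using hpred
  have hinj : Function.Injective pred := fun a b hab => by
    have := hpred b
    rw [← hab] at this
    exact Subtype.ext (hpeak _ (pred a).2 _ _ (hpred a) this)
  let σ : U ≃ U := (Equiv.ofBijective pred (Finite.injective_iff_bijective.1 hinj)).symm
  have hσ : ∀ a : U, R a (σ a) := fun a => by
    have := hpred (σ a)
    rwa [show pred (σ a) = a from Equiv.apply_symm_apply
      (Equiv.ofBijective pred (Finite.injective_iff_bijective.1 hinj)) a] at this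
  obtain ⟨a, ha⟩ := hne
  let s : U := ⟨a, ha⟩
  have hper : 0 < Function.minimalPeriod σ s :=
    Function.minimalPeriod_pos_of_mem_periodicPts (σ.injective.mem_periodicPts s)
  obtain ⟨n, hn⟩ : ∃ n, Function.minimalPeriod σ s = n + 1 := ⟨_, (Nat.succ_pred_eq_of_pos hper).symm⟩
  have hit : ∀ i j, i < n + 1 → j < n + 1 → (σ^[i] s = σ^[j] s ↔ i = j) := fun i j hi hj =>
    Function.iterate_eq_iterate_iff_of_lt_minimalPeriod (hn ▸ hi) (hn ▸ hj)
  have hmod : ∀ i, σ^[i % (n + 1)] s = σ^[i] s := fun i => by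
    rw [← hn]
    exact Function.iterate_mod_minimalPeriod_eq
  refine ⟨n, fun i => σ^[i] s, ⟨?_, ?_, ?_, ?_⟩, fun i _ => Subtype.coe_prop _⟩
  · intro i hi j hj hij
    simp only [BasicQuiver.vertices, Finset.coe_Icc, Set.mem_Icc] at hi hj
    exact (hit i j (by omega) (by omega)).1 (Subtype.ext hij)
  · intro i hi j hj
    simp only [BasicQuiver.vertices, Finset.mem_Icc] at hi hj
    simp only [BasicQuiver.HasArrow]
    rw [← hit j _ (by omega) (Nat.mod_lt _ (by omega)), hmod, Function.iterate_succ_apply']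
    constructor
    · exact fun h => Subtype.ext (hpeak _ (Subtype.coe_prop _) _ _ h (hσ _))
    · intro h
      rw [h]
      exact hσ _
  · intro i hi b hb
    refine ⟨(i + 1) % (n + 1), ?_, ?_⟩
    · have := Nat.mod_lt (i + 1) (show 0 < n + 1 by omega)
      simp only [BasicQuiver.vertices, Finset.mem_Icc]
      omega
    · rw [hmod, Function.iterate_succ_apply']
      exact hpeak _ (Subtype.coe_prop _) _ _ (hσ _) hb
  -- The period is `n + 1`, so the predecessor of the vertex `i` is obtained by `i + n` applications
  -- of `σ` to `s`.
  · intro i hi b hb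
    refine ⟨(i + n) % (n + 1), ?_, ?_⟩
    · have := Nat.mod_lt (i + n) (show 0 < n + 1 by omega)
      simp only [BasicQuiver.vertices, Finset.mem_Icc]
      omega
    · rw [hmod]
      refine hdeep _ (Subtype.coe_prop _) _ _ (hσ _) ?_
      rwa [← Function.iterate_succ_apply' σ, ← hmod, show (i + n).succ = i + (n + 1) by omega,
        Nat.add_mod_right, hmod]

theorem mem_of_chain {R : Q → Q → Prop} {U : Set Q} (hU : ∀ a b, R a b → (a ∈ U ↔ b ∈ U))
    {v : ℕ → Q} (h0 : v 0 ∈ U) {n : ℕ} (hv : ∀ i ≤ n, R (v i) (v (i + 1))) :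
    ∀ i ≤ n + 1, v i ∈ U := by
  intro i
  induction i with
  | zero => exact fun _ => h0
  | succ i ih => exact fun hi => (hU _ _ (hv i (by omega))).1 (ih (by omega))

theorem IsTame.exists_isComponent_of_peak [Finite Q] {R : Q → Q → Prop} (h : IsTame R) {U : Set Q}
    (hU : ∀ a b, R a b → (a ∈ U ↔ b ∈ U)) {s b c : Q} (hs : s ∈ U) (hb : R s b) (hc : R s c)
    (hbc : b ≠ c) :
    ∃ (m y : ℕ) (hm : 3 ≤ m) (hy : 2 ≤ y ∧ y ≤ m - 1) (v : ℕ → Q),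
      IsComponent R (.Λ m y hm hy) v ∧ ∀ i ∈ Finset.Icc 1 m, v i ∈ U := by
  obtain ⟨m, v, hv⟩ := h.exists_isMaximalChain hb hc hbc
  obtain ⟨n, w, hw⟩ := h.exists_isMaximalChain hc hb hbc.symm
  refine ⟨_, _, _, _, _, hv.isComponent_of_peak hw hbc fun x hx => h.out_le_two hb hc hbc hx, ?_⟩
  intro i hi
  rw [Finset.mem_Icc] at hi
  split_ifs with h1
  · exact mem_of_chain hU (hv.zero ▸ hs) hv.rel _ (by omega)
  · exact mem_of_chain hU (hw.zero ▸ hs) hw.rel _ (by omega)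

/-- A vertex with two successors lies on a `Λ`, dually a vertex with two predecessors on a `V`.
Otherwise successors and predecessors in `U` are unique: a source starts an `L`, and without sources
there is a cycle. -/
theorem IsTame.exists_isComponent [Finite Q] {R : Q → Q → Prop} (h : IsTame R) {U : Set Q}
    (hne : U.Nonempty) (hU : ∀ a b, R a b → (a ∈ U ↔ b ∈ U)) :
    ∃ B v, IsComponent R B v ∧ (∀ i ∈ B.vertices, v i ∈ U) ∧ (B.kind = .Λ → HasPeak R) ∧
      (B.kind = .V → HasPeak (_root_.flip R)) := by
  by_cases hpeak : ∃ s ∈ U, ∃ b c, b ≠ c ∧ R s b ∧ R s c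
  · obtain ⟨s, hs, b, c, hbc, hb, hc⟩ := hpeak
    obtain ⟨m, y, hm, hy, v, hv, hvU⟩ := h.exists_isComponent_of_peak hU hs hb hc hbc
    exact ⟨_, v, hv, hvU, fun _ => ⟨s, b, c, hbc, hb, hc⟩, (fun h => by cases h)⟩
  by_cases hdeep : ∃ s ∈ U, ∃ b c, b ≠ c ∧ R b s ∧ R c s
  · obtain ⟨s, hs, b, c, hbc, hb, hc⟩ := hdeep
    obtain ⟨m, y, hm, hy, v, hv, hvU⟩ := h.flip.exists_isComponent_of_peak
      (fun a b hab => (hU b a hab).symm) hs hb hc hbc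
    exact ⟨_, v, hv.flip, hvU, (fun h => by cases h), fun _ => ⟨s, b, c, hbc, hb, hc⟩⟩
  have hout : ∀ a ∈ U, ∀ b c, R a b → R a c → b = c := fun a ha b c hb hc => by
    by_contra hbc
    exact hpeak ⟨a, ha, b, c, hbc, hb, hc⟩
  have hin : ∀ a ∈ U, ∀ b c, R b a → R c a → b = c := fun a ha b c hb hc => by
    by_contra hbc
    exact hdeep ⟨a, ha, b, c, hbc, hb, hc⟩
  by_cases hsource : ∃ s ∈ U, ∀ z, ¬ R z s
  · obtain ⟨s, hs, hsz⟩ := hsource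
    by_cases hsb : ∃ b, R s b
    · obtain ⟨b, hb⟩ := hsb
      obtain ⟨m, v, hv⟩ := _root_.exists_isMaximalChain hb hsz
        (by
          rintro n v rfl rfl hv z hz
          exact hin _ (mem_of_chain hU hs hv _ le_rfl) _ _ hz (hv n le_rfl))
        (by
          rintro n v rfl rfl hv x y hx hy
          exact hout _ (mem_of_chain hU hs hv _ le_rfl) _ _ hx hy)
      refine ⟨_, _, hv.isComponent fun c hc => hout s hs _ _ hc hb, fun i hi => ?_,
        (fun h => by cases h), (fun h => by cases h)⟩
      simp only [BasicQuiver.vertices, Finset.mem_Icc] at hi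
      exact mem_of_chain hU (hv.zero ▸ hs) hv.rel _ (by omega)
    · exact ⟨_, _, isComponent_singleton (not_exists.1 hsb) hsz, fun _ _ => hs,
        (fun h => by cases h), (fun h => by cases h)⟩
  · push Not at hsource
    obtain ⟨n, v, hv, hvU⟩ := exists_isComponent_cycle hne hU hout hin hsource
    exact ⟨_, v, hv, hvU, (fun h => by cases h), (fun h => by cases h)⟩

/-- A tame relation on a finite set is a disjoint union of basic quivers. -/
theorem IsTame.exists_components [Finite Q] {R : Q → Q → Prop} (h : IsTame R) (U : Set Q)
    (hU : ∀ a b, R a b → (a ∈ U ↔ b ∈ U)) :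
    ∃ (n : ℕ) (B : Fin n → BasicQuiver) (v : Fin n → ℕ → Q),
      (∀ i, IsComponent R (B i) (v i) ∧ ((B i).kind = .Λ → HasPeak R) ∧
        ((B i).kind = .V → HasPeak (_root_.flip R))) ∧
      (∀ i, ∀ p ∈ (B i).vertices, v i p ∈ U) ∧
      (∀ x ∈ U, ∃ i, ∃ p ∈ (B i).vertices, v i p = x) ∧
      ∀ i j, ∀ p ∈ (B i).vertices, ∀ q ∈ (B j).vertices, v i p = v j q → i = j := by
  induction hn : U.ncard using Nat.strong_induction_on generalizing U with
  | _ n ih =>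
    subst hn
    rcases U.eq_empty_or_nonempty with rfl | hne
    · exact ⟨0, Fin.elim0, Fin.elim0, fun i => i.elim0, fun i => i.elim0,
        fun x hx => absurd hx (Set.notMem_empty x), fun i => i.elim0⟩
    obtain ⟨B₀, v₀, hc, hvU, hk⟩ := h.exists_isComponent hne hU
    have hne₀ : B₀.vertices.Nonempty := by
      cases B₀ <;> simp only [BasicQuiver.vertices, Finset.nonempty_Icc] <;> omega
    -- The component is removed; the rest of `U` is still closed under neighbours and has fewer
    -- elements.
    let C : Set Q := v₀ '' B₀.vertices
    have hCU : C ⊆ U := by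
      rintro _ ⟨p, hp, rfl⟩
      exact hvU p hp
    have hCne : C.Nonempty := (Finset.coe_nonempty.2 hne₀).image _
    have hcard : (U \ C).ncard < U.ncard := by
      refine Set.ncard_lt_ncard ⟨Set.sdiff_subset, fun hsub => ?_⟩ (Set.toFinite U)
      obtain ⟨x, hx⟩ := hCne
      exact (hsub (hCU hx)).2 hx
    have hC : ∀ a b, R a b → (a ∈ C ↔ b ∈ C) := by
      intro a b hab
      constructor
      · rintro ⟨p, hp, rfl⟩
        exact hc.out p hp b hab
      · rintro ⟨p, hp, rfl⟩
        exact hc.into p hp a hab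
    obtain ⟨n, B, v, h1, h2, h3, h4⟩ := ih _ hcard (U \ C)
      (fun a b hab => by rw [Set.mem_sdiff, Set.mem_sdiff, hU a b hab, hC a b hab]) rfl
    refine ⟨n + 1, Fin.cons B₀ B, Fin.cons v₀ v, ?_, ?_, ?_, ?_⟩
    · exact Fin.cases ⟨hc, hk⟩ h1
    · exact Fin.cases hvU fun i p hp => (h2 i p hp).1
    · intro x hx
      by_cases hxC : x ∈ C
      · obtain ⟨p, hp, rfl⟩ := hxC
        exact ⟨0, p, hp, rfl⟩
      · obtain ⟨i, p, hp, hpx⟩ := h3 x ⟨hx, hxC⟩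
        exact ⟨i.succ, p, hp, hpx⟩
    · refine Fin.cases (Fin.cases (fun _ _ _ _ _ => rfl) fun j p hp q hq hpq => ?_) fun i =>
        Fin.cases (fun p hp q hq hpq => ?_) fun j p hp q hq hpq => ?_
      · exact absurd ⟨p, hp, hpq⟩ (h2 j q hq).2
      · exact absurd ⟨q, hq, hpq.symm⟩ (h2 i p hp).2
      · rw [h4 i j p hp q hq hpq]

end Combinatorics

/-! ### From tame relations to disjoint unions of quivers -/

section DisjointUnion

theorem disjointUnionHom_subsingleton {n : ℕ} (B : Fin n → BasicQuiver)
    (x y : Σ i, (B i).Vertex) : Subsingleton (x ⟶ y) := by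
  refine ⟨fun e f => ?_⟩
  change DisjointUnionHom (fun i => (B i).Vertex) x y at e f
  cases e with
  | mk e =>
    cases f with
    | mk f =>
      obtain ⟨e⟩ := e
      obtain ⟨f⟩ := f
      rfl

theorem nonempty_disjointUnionHom_iff {n : ℕ} (B : Fin n → BasicQuiver) {i j : Fin n}
    {p : (B i).Vertex} {q : (B j).Vertex} :
    Nonempty ((⟨i, p⟩ : Σ i, (B i).Vertex) ⟶ ⟨j, q⟩) ↔ i = j ∧ (B i).HasArrow p.val q.val := by
  constructor
  · rintro ⟨e⟩
    change DisjointUnionHom (fun i => (B i).Vertex) _ _ at e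
    cases e with
    | mk e => exact ⟨rfl, e.down⟩
  · rintro ⟨rfl, h⟩
    exact ⟨DisjointUnionHom.mk (W := fun i => (B i).Vertex) (PLift.up h)⟩

/-- A finite quiver without parallel arrows whose arrow relation is tame is a disjoint union of
basic quivers. -/
theorem isDisjointUnionOf_of_isTame {Q : Type u} [Quiver.{v} Q] [Finite Q]
    (hsub : ∀ a b : Q, Subsingleton (a ⟶ b)) (h : IsTame fun a b : Q => Nonempty (a ⟶ b))
    (S : Set QuiverKind) (hL : .L ∈ S) (hΔ : .Δ ∈ S)
    (hΛ : .Λ ∈ S ∨ ¬ HasPeak fun a b : Q => Nonempty (a ⟶ b))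
    (hV : .V ∈ S ∨ ¬ HasPeak fun b a : Q => Nonempty (a ⟶ b)) : IsDisjointUnionOf S Q := by
  obtain ⟨n, B, v, h1, -, h3, h4⟩ := h.exists_components Set.univ fun a b _ => by simp
  let φ : (Σ i, (B i).Vertex) → Q := fun x => v x.1 x.2.val
  have hφ : Function.Bijective φ := by
    constructor
    · rintro ⟨i, p, hp⟩ ⟨j, q, hq⟩ hpq
      obtain rfl := h4 i j p hp q hq hpq
      obtain rfl := (h1 i).1.injOn hp hq hpq
      rfl
    · intro x
      obtain ⟨i, p, hp, hpx⟩ := h3 x trivial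
      exact ⟨⟨i, p, hp⟩, hpx⟩
  have hrel : ∀ x y, Nonempty (φ x ⟶ φ y) ↔ Nonempty (x ⟶ y) := by
    rintro ⟨i, p, hp⟩ ⟨j, q, hq⟩
    rw [nonempty_disjointUnionHom_iff]
    constructor
    · intro h
      obtain ⟨q', hq', h'⟩ := (h1 i).1.out p hp _ h
      obtain rfl := h4 i j q' hq' q hq h'
      exact ⟨rfl, ((h1 i).1.rel_iff p hp q hq).1 h⟩
    · rintro ⟨rfl, h⟩
      exact ((h1 i).1.rel_iff p hp q hq).2 h
  let σ := Equiv.ofBijective φ hφ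
  have hσ : ∀ a b : Q, Nonempty (a ⟶ b) ↔ Nonempty (σ.symm a ⟶ σ.symm b) := fun a b => by
    rw [← hrel]
    change _ ↔ Nonempty (σ (σ.symm a) ⟶ σ (σ.symm b))
    rw [σ.apply_symm_apply, σ.apply_symm_apply]
  refine ⟨n, B, fun i => ?_, ⟨σ.symm, fun {a b} e => ((hσ a b).1 ⟨e⟩).some⟩, σ.symm.bijective,
    fun a b => ⟨fun e f _ => (hsub a b).elim e f, fun e => ?_⟩⟩
  · obtain ⟨-, hk1, hk2⟩ := h1 i
    cases hk : (B i).kind with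
    | L => exact hL
    | Δ => exact hΔ
    | V => exact hV.resolve_right fun h => h (hk2 hk)
    | Λ => exact hΛ.resolve_right fun h => h (hk1 hk)
  · exact ⟨((hσ a b).2 ⟨e⟩).some, (disjointUnionHom_subsingleton B _ _).elim _ _⟩

end DisjointUnion

/-! ### Indecomposability, uniformity and duality for families of operators -/

section InvariantSubspaces

variable {k X : Type*} [Field k] [AddCommGroup X] [Module k X]

/-- The subspaces that are mapped into themselves by all operators from a given set. -/
def invariantSubspaces (O : Set (Module.End k X)) : Set (Submodule k X) :=
  {U | ∀ f ∈ O, ∀ x ∈ U, f x ∈ U}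

theorem apply_mem_span_of_forall {s : Set X} {f : Module.End k X}
    (hf : ∀ x ∈ s, f x ∈ Submodule.span k s) : ∀ z ∈ Submodule.span k s, f z ∈ Submodule.span k s :=
  Submodule.span_le (p := (Submodule.span k s).comap f).2 hf

/-- The space is nonzero and not the direct sum of two nonzero members of a family of subspaces. -/
def IsIndecomposableFor (𝓛 : Set (Submodule k X)) : Prop :=
  Nontrivial X ∧ ∀ U ∈ 𝓛, ∀ W ∈ 𝓛, IsCompl U W → U = ⊥ ∨ W = ⊥

/-- Any two nonzero members of a family of subspaces meet. -/
def IsUniformFor (𝓛 : Set (Submodule k X)) : Prop :=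
  ∀ U ∈ 𝓛, ∀ W ∈ 𝓛, U ⊓ W = ⊥ → U = ⊥ ∨ W = ⊥

/-- The sum of two proper members of a family of subspaces is proper. -/
def IsHollowFor (𝓛 : Set (Submodule k X)) : Prop :=
  ∀ U ∈ 𝓛, ∀ W ∈ 𝓛, U ⊔ W = ⊤ → U = ⊤ ∨ W = ⊤

/-- Coannihilators turn an invariant decomposition of the dual space into one of `X`. If one
coannihilator is zero, its subspace is everything by dimension, and the other summand is zero. -/
theorem IsIndecomposableFor.dual [FiniteDimensional k X] {O : Set (Module.End k X)}
    (h : IsIndecomposableFor (invariantSubspaces O)) :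
    IsIndecomposableFor (invariantSubspaces (LinearMap.dualMap '' O)) := by
  obtain ⟨hX, h⟩ := h
  refine ⟨inferInstance, fun Φ hΦ Ψ hΨ hc => ?_⟩
  have hinv : ∀ Φ ∈ invariantSubspaces (LinearMap.dualMap '' O),
      Φ.dualCoannihilator ∈ invariantSubspaces O := by
    intro Φ hΦ f hf x hx
    rw [Submodule.mem_dualCoannihilator] at hx ⊢
    exact fun φ hφ => hx _ (hΦ _ ⟨f, hf, rfl⟩ φ hφ)
  let e := (Subspace.orderIsoFiniteDimensional (K := k) (V := X)).symm
  have hc' : IsCompl Φ.dualCoannihilator Ψ.dualCoannihilator :=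
    (e.isCompl (x := OrderDual.toDual Φ) (y := OrderDual.toDual Ψ) hc.dual)
  have hcompl := h _ (hinv Φ hΦ) _ (hinv Ψ hΨ) hc'
  have hbot : ∀ Φ Ψ : Submodule k (Module.Dual k X), IsCompl Φ Ψ → Φ.dualCoannihilator = ⊥ →
      Ψ = ⊥ := by
    intro Φ Ψ hc h0
    have h1 : Φ = ⊤ := by
      have := Subspace.finrank_add_finrank_dualCoannihilator_eq Φ
      rw [h0, finrank_bot, add_zero, ← Subspace.dual_finrank_eq] at this
      exact Submodule.eq_top_of_finrank_eq this
    rw [h1] at hc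
    exact top_disjoint.1 hc.disjoint
  exact hcompl.symm.imp (fun h0 => hbot _ _ hc.symm h0) fun h0 => hbot _ _ hc h0

/-- Annihilators of invariant subspaces are invariant under the transposed operators, and the
annihilator of a sum is the intersection of the annihilators. -/
theorem IsUniformFor.isHollowFor {O : Set (Module.End k X)}
    (h : IsUniformFor (invariantSubspaces (LinearMap.dualMap '' O))) :
    IsHollowFor (invariantSubspaces O) := by
  have hinv : ∀ U ∈ invariantSubspaces O,
      U.dualAnnihilator ∈ invariantSubspaces (LinearMap.dualMap '' O) := by
    rintro U hU _ ⟨f, hf, rfl⟩ φ hφ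
    rw [Submodule.mem_dualAnnihilator] at hφ ⊢
    exact fun x hx => hφ _ (hU f hf x hx)
  intro U hU W hW hUW
  refine (h _ (hinv U hU) _ (hinv W hW) ?_).imp Submodule.dualAnnihilator_eq_bot_iff.1
    Submodule.dualAnnihilator_eq_bot_iff.1
  rw [← Submodule.dualAnnihilator_sup_eq, hUW, Submodule.dualAnnihilator_top]

theorem isHollowFor_of_dual [FiniteDimensional k X] {O : Set (Module.End k X)}
    (hX : IsIndecomposableFor (invariantSubspaces O))
    (h : IsIndecomposableFor (invariantSubspaces (LinearMap.dualMap '' O)) →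
      IsUniformFor (invariantSubspaces (LinearMap.dualMap '' O))) :
    IsHollowFor (invariantSubspaces O) :=
  (h hX.dual).isHollowFor

/-- An idempotent operator commuting with the given operators is trivial on an indecomposable
space. -/
theorem IsIndecomposableFor.eq_zero_or_eq_one {O : Set (Module.End k X)}
    (h : IsIndecomposableFor (invariantSubspaces O)) {ε : Module.End k X} (hε : ε * ε = ε)
    (hO : ∀ f ∈ O, f * ε = ε * f) : ε = 0 ∨ ε = 1 := by
  have hcomm : ∀ f ∈ O, ∀ x, f (ε x) = ε (f x) := fun f hf x => LinearMap.congr_fun (hO f hf) x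
  have hidem : ∀ x, ε (ε x) = ε x := fun x => LinearMap.congr_fun hε x
  rcases h.2 (LinearMap.range ε) (by
      rintro f hf _ ⟨x, rfl⟩
      exact ⟨f x, (hcomm f hf x).symm⟩) (LinearMap.ker ε) (by
      intro f hf x hx
      rw [LinearMap.mem_ker] at hx ⊢
      rw [← hcomm f hf, hx, map_zero]) ⟨by
        rw [Submodule.disjoint_def]
        rintro _ ⟨x, rfl⟩ hx
        rwa [LinearMap.mem_ker, hidem] at hx, by
        rw [codisjoint_iff, eq_top_iff]
        intro x _
        refine Submodule.mem_sup.2 ⟨ε x, ⟨x, rfl⟩, x - ε x, ?_, by abel⟩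
        rw [LinearMap.mem_ker, map_sub, hidem, sub_self]⟩ with h0 | h0
  · exact Or.inl (LinearMap.range_eq_bot.1 h0)
  · right
    ext x
    have : x - ε x ∈ LinearMap.ker ε := by rw [LinearMap.mem_ker, map_sub, hidem, sub_self]
    rw [h0, Submodule.mem_bot, sub_eq_zero] at this
    exact this.symm

/-- If the span of a dual system of vectors and the common kernel of its functionals are invariant
then the vectors form a basis of an indecomposable space. -/
theorem IsIndecomposableFor.eq_sum {𝓛 : Set (Submodule k X)} (h : IsIndecomposableFor 𝓛)
    {ι : Type*} {s : Finset ι} (hs : s.Nonempty) {x : ι → X} {ψ : ι → X →ₗ[k] k}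
    (h1 : ∀ i ∈ s, ψ i (x i) = 1) (h0 : ∀ i ∈ s, ∀ j ∈ s, i ≠ j → ψ i (x j) = 0)
    (hx : Submodule.span k (x '' s) ∈ 𝓛) (hψ : (⨅ i ∈ s, LinearMap.ker (ψ i)) ∈ 𝓛) (y : X) :
    y = ∑ i ∈ s, ψ i y • x i := by
  classical
  have hmem : ∀ y : X, ∑ i ∈ s, ψ i y • x i ∈ Submodule.span k (x '' s) := fun y =>
    Submodule.sum_mem _ fun i hi => Submodule.smul_mem _ _ (Submodule.subset_span ⟨i, hi, rfl⟩)
  have hdual : ∀ (c : ι → k), ∀ i ∈ s, ψ i (∑ j ∈ s, c j • x j) = c i := by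
    intro c i hi
    rw [map_sum, Finset.sum_eq_single_of_mem i hi, map_smul, h1 i hi, smul_eq_mul, mul_one]
    intro j hj hji
    rw [map_smul, h0 i hi j hj hji.symm, smul_zero]
  have hker : ∀ y, y - ∑ i ∈ s, ψ i y • x i ∈ ⨅ i ∈ s, LinearMap.ker (ψ i) := by
    intro y
    simp only [Submodule.mem_iInf, LinearMap.mem_ker]
    intro i hi
    rw [map_sub, hdual _ i hi, sub_self]
  have hspan : ∀ y ∈ Submodule.span k (x '' s), y = ∑ i ∈ s, ψ i y • x i := by
    intro y hy
    induction hy using Submodule.span_induction with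
    | mem y hy =>
      obtain ⟨j, hj, rfl⟩ := hy
      rw [Finset.sum_eq_single_of_mem j hj, h1 j hj, one_smul]
      intro i hi hij
      rw [h0 i hi j hj hij, zero_smul]
    | zero => simp
    | add y z _ _ hy hz =>
      simp only [map_add, add_smul, Finset.sum_add_distrib]
      rw [← hy, ← hz]
    | smul c y _ hy =>
      simp only [map_smul, smul_assoc]
      rw [← Finset.smul_sum, ← hy]
  -- The span and the common kernel are complementary. The span is nonzero, as `s` is nonempty, so
  -- the kernel must vanish.
  rcases h.2 _ hx _ hψ ⟨by
      rw [Submodule.disjoint_def]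
      intro y hy hy'
      simp only [Submodule.mem_iInf, LinearMap.mem_ker] at hy'
      rw [hspan y hy]
      exact Finset.sum_eq_zero fun i hi => by rw [hy' i hi, zero_smul], by
      rw [codisjoint_iff, eq_top_iff]
      exact fun y _ => Submodule.mem_sup.2 ⟨_, hmem y, _, hker y, by abel⟩⟩ with hb | hb
  · obtain ⟨i, hi⟩ := hs
    have hz : x i = 0 := by
      rw [← Submodule.mem_bot k, ← hb]
      exact Submodule.subset_span ⟨i, hi, rfl⟩
    have := h1 i hi
    rw [hz, map_zero] at this
    exact absurd this zero_ne_one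
  · have := hker y
    rw [hb, Submodule.mem_bot, sub_eq_zero] at this
    exact this

end InvariantSubspaces

/-- Used for extremal choices, such as the length of a nonzero string, without having to know that
`P` is monotone. -/
theorem exists_and_not_succ {P : ℕ → Prop} (h0 : P 0) {N : ℕ} (hN : ¬ P N) :
    ∃ n, P n ∧ ¬ P (n + 1) := by
  by_contra! H
  exact hN (Nat.rec h0 (fun n => H n) N)

/-- A grading of a space by the natural numbers `1, …, N`, given by its projections, together with
an operator of degree `-1` and an operator of degree `1`. -/
structure IsGradedPair {k X : Type*} [Field k] [AddCommGroup X] [Module k X] (N : ℕ)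
    (E : ℕ → Module.End k X) (lam rho : Module.End k X) : Prop where
  mul_self : ∀ p, E p * E p = E p
  mul_of_ne : ∀ p q, p ≠ q → E p * E q = 0
  zero : E 0 = 0
  of_lt : ∀ p, N < p → E p = 0
  sum_eq : ∑ p ∈ Finset.range (N + 1), E p = 1
  lam_mul : ∀ p, lam * E (p + 1) = E p * lam
  rho_mul : ∀ p, rho * E p = E (p + 1) * rho

/-! ### Line quivers: two shift operators on a graded space -/

namespace IsGradedPair

variable {k X : Type*} [Field k] [AddCommGroup X] [Module k X] {N : ℕ}
  {E : ℕ → Module.End k X} {lam rho : Module.End k X}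

/-- The operators attached to a graded pair. -/
def operators (E : ℕ → Module.End k X) (lam rho : Module.End k X) : Set (Module.End k X) :=
  {lam, rho} ∪ Set.range E

theorem mem_invariantSubspaces {U : Submodule k X} :
    U ∈ invariantSubspaces (operators E lam rho) ↔
      (∀ p, ∀ x ∈ U, E p x ∈ U) ∧ (∀ x ∈ U, lam x ∈ U) ∧ ∀ x ∈ U, rho x ∈ U := by
  refine ⟨fun h => ⟨fun p => h _ (Or.inr ⟨p, rfl⟩), h _ (by simp [operators]),
    h _ (by simp [operators])⟩, ?_⟩
  rintro ⟨h1, h2, h3⟩ f ((rfl | rfl) | ⟨p, rfl⟩)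
  exacts [h2, h3, h1 p]

section

variable (h : IsGradedPair N E lam rho)
include h

theorem proj_self (p : ℕ) (x : X) : E p (E p x) = E p x := LinearMap.congr_fun (h.mul_self p) x

theorem proj_of_ne {p q : ℕ} (hpq : p ≠ q) (x : X) : E p (E q x) = 0 :=
  LinearMap.congr_fun (h.mul_of_ne p q hpq) x

theorem lam_proj (p : ℕ) (x : X) : lam (E (p + 1) x) = E p (lam x) :=
  LinearMap.congr_fun (h.lam_mul p) x

theorem rho_proj (p : ℕ) (x : X) : rho (E p x) = E (p + 1) (rho x) :=
  LinearMap.congr_fun (h.rho_mul p) x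

theorem rho_pow_proj (n p : ℕ) (x : X) : (rho ^ n) (E p x) = E (p + n) ((rho ^ n) x) := by
  induction n with
  | zero => rfl
  | succ n ih =>
    rw [pow_succ', Module.End.mul_apply, Module.End.mul_apply, ih, h.rho_proj, add_assoc]

theorem lam_pow_proj (n p : ℕ) (x : X) : (lam ^ n) (E (p + n) x) = E p ((lam ^ n) x) := by
  induction n generalizing p with
  | zero => rfl
  | succ n ih =>
    rw [pow_succ', Module.End.mul_apply, Module.End.mul_apply, ← h.lam_proj, ← ih,
      add_right_comm, add_assoc]

theorem sum_proj (x : X) : x = ∑ p ∈ Finset.range (N + 1), E p x := by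
  conv_lhs => rw [← Module.End.one_apply (R := k) x, ← h.sum_eq]
  simp

theorem dual : IsGradedPair N (fun p => (E p).dualMap) rho.dualMap lam.dualMap where
  mul_self p := congrArg LinearMap.dualMap (h.mul_self p)
  mul_of_ne p q hpq := (congrArg LinearMap.dualMap (h.mul_of_ne q p hpq.symm)).trans (map_zero
    (Module.Dual.transpose (R := k)))
  zero := by rw [h.zero]; exact map_zero (Module.Dual.transpose (R := k))
  of_lt p hp := by rw [h.of_lt p hp]; exact map_zero (Module.Dual.transpose (R := k))
  sum_eq := (map_sum (Module.Dual.transpose (R := k)) _ _).symm.trans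
    ((congrArg LinearMap.dualMap h.sum_eq).trans LinearMap.dualMap_id)
  lam_mul p := congrArg LinearMap.dualMap (h.rho_mul p).symm
  rho_mul p := congrArg LinearMap.dualMap (h.lam_mul p).symm

/-- All maps point towards the degree `c`. Extremal choices on both sides produce a string of
vectors through a vector `s` of degree `c` that is a direct summand, hence the whole space; every
nonzero invariant subspace then contains `s`. -/
theorem isUniformFor_of_ne_zero {c : ℕ} (hρ : ∀ p ≥ c, ∀ x, rho (E p x) = 0)
    (hlam : ∀ p ≤ c, ∀ x, lam (E p x) = 0) (hc : E c ≠ 0)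
    (hX : IsIndecomposableFor (invariantSubspaces (operators E lam rho))) :
    IsUniformFor (invariantSubspaces (operators E lam rho)) := by
  -- A string from the left that cannot be lengthened. For `a ≥ c` the truncated difference is `0`,
  -- and `E 0 = 0`.
  obtain ⟨a, ha, ha'⟩ := exists_and_not_succ (P := fun a => rho ^ a * E (c - a) ≠ 0) (N := c)
    (by simpa using hc) (by simp [h.zero])
  -- Among the vectors of degree `c` reached from the left in `a` steps, some are reached from the
  -- right in `b` steps, but no nonzero one in `b + 1` steps.
  obtain ⟨b, hb, hb'⟩ := exists_and_not_succ
    (P := fun b => LinearMap.range (rho ^ a * E (c - a)) ⊓ LinearMap.range (lam ^ b * E (c + b)) ≠ ⊥)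
    (N := N + 1) (by
      have hle : LinearMap.range (rho ^ a * E (c - a)) ≤ LinearMap.range (E c) := by
        rintro _ ⟨x, rfl⟩
        have hac : a ≤ c := by
          by_contra hlt
          exact ha (by rw [Nat.sub_eq_zero_of_le (by omega), h.zero, mul_zero])
        refine ⟨(rho ^ a) x, ?_⟩
        rw [Module.End.mul_apply, h.rho_pow_proj, Nat.sub_add_cancel hac]
      simp only [pow_zero, one_mul, add_zero]
      rw [inf_eq_left.2 hle]
      exact fun h0 => ha (LinearMap.range_eq_bot.1 h0))
    (by simp [h.of_lt (c + (N + 1)) (by omega)])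
  simp only [ne_eq, not_not] at ha' hb'
  have hac : a < c := by
    by_contra hlt
    exact ha (by rw [Nat.sub_eq_zero_of_le (by omega), h.zero, mul_zero])
  obtain ⟨d, rfl⟩ : ∃ d, c = d + a := ⟨c - a, by omega⟩
  rw [Nat.add_sub_cancel] at ha hb hb'
  obtain ⟨s, ⟨⟨x₀, hx₀⟩, ⟨y₀, hy₀⟩⟩, hs⟩ := (Submodule.ne_bot_iff _).1 hb
  obtain ⟨x, hx, hxs⟩ : ∃ x, E d x = x ∧ (rho ^ a) x = s := ⟨E d x₀, h.proj_self _ _, hx₀⟩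
  obtain ⟨y, hy, hys⟩ : ∃ y, E (d + a + b) y = y ∧ (lam ^ b) y = s :=
    ⟨E (d + a + b) y₀, h.proj_self _ _, hy₀⟩
  have hs' : s ∉ LinearMap.range (lam ^ (b + 1) * E (d + a + (b + 1))) := fun hmem => hs <| by
    rw [← Submodule.mem_bot k, ← hb']
    exact ⟨⟨x₀, hx₀⟩, hmem⟩
  -- The functional is nonzero on `s` and kills everything that comes from beyond the right end of
  -- the string.
  obtain ⟨φ₀, hφ₀, hφ₁⟩ := Submodule.exists_le_ker_of_notMem hs'
  obtain ⟨φ, hφs, hφ⟩ : ∃ φ : X →ₗ[k] k, φ s = 1 ∧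
      ∀ z, φ ((lam ^ (b + 1)) (E (d + a + (b + 1)) z)) = 0 := by
    refine ⟨(φ₀ s)⁻¹ • φ₀, by simp [hφ₀], fun z => ?_⟩
    rw [LinearMap.smul_apply, show φ₀ ((lam ^ (b + 1)) (E (d + a + (b + 1)) z)) = 0 from hφ₁ ⟨z, rfl⟩,
      smul_zero]
  -- `u p` is the vector of the string in degree `p`, and `P p` carries degree `p` to the central
  -- degree `d + a`; the functionals dual to the `u p` are the `φ ∘ P p`.
  let u : ℕ → X := fun p => if p ≤ d + a then (rho ^ (p - d)) x else (lam ^ (d + a + b - p)) y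
  let P : ℕ → Module.End k X := fun p =>
    if p ≤ d + a then rho ^ (d + a - p) * E p else lam ^ (p - (d + a)) * E p
  have huL : ∀ p ≤ d + a, u p = (rho ^ (p - d)) x := fun p hp => if_pos hp
  have huR : ∀ p, d + a ≤ p → u p = (lam ^ (d + a + b - p)) y := fun p hp => by
    rcases hp.eq_or_lt with rfl | hp
    · rw [huL _ le_rfl, Nat.add_sub_cancel_left, Nat.add_sub_cancel_left, hxs, hys]
    · exact if_neg (by omega)
  have hPL : ∀ p ≤ d + a, ∀ z, P p z = (rho ^ (d + a - p)) (E p z) := fun p hp z => by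
    simp only [P, if_pos hp, Module.End.mul_apply]
  have hPR : ∀ p, d + a ≤ p → ∀ z, P p z = (lam ^ (p - (d + a))) (E p z) := fun p hp z => by
    rcases hp.eq_or_lt with rfl | hp
    · rw [hPL _ le_rfl, Nat.sub_self, pow_zero, pow_zero]
    · simp only [P, if_neg (show ¬ p ≤ d + a by omega), Module.End.mul_apply]
  have hPE : ∀ p z, P p (E p z) = P p z := fun p z => by
    rcases le_total p (d + a) with hp | hp
    · rw [hPL p hp, hPL p hp, h.proj_self]
    · rw [hPR p hp, hPR p hp, h.proj_self]
  have hPE' : ∀ p q, p ≠ q → ∀ z, P p (E q z) = 0 := fun p q hpq z => by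
    rcases le_total p (d + a) with hp | hp
    · rw [hPL p hp, h.proj_of_ne hpq, map_zero]
    · rw [hPR p hp, h.proj_of_ne hpq, map_zero]
  let I := Finset.Icc d (d + a + b)
  have hI : ∀ p, p ∈ I ↔ d ≤ p ∧ p ≤ d + a + b := fun p => Finset.mem_Icc
  have hEu : ∀ p ∈ I, E p (u p) = u p := fun p hp => by
    rw [hI] at hp
    rcases le_total p (d + a) with hpc | hpc
    · obtain ⟨t, rfl⟩ := Nat.exists_eq_add_of_le hp.1
      rw [huL _ hpc, Nat.add_sub_cancel_left, ← h.rho_pow_proj, hx]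
    · obtain ⟨t, ht⟩ := Nat.exists_eq_add_of_le hp.2
      rw [huR _ hpc, ht, Nat.add_sub_cancel_left, ← h.lam_pow_proj, ← ht, hy]
  have hPu : ∀ p ∈ I, P p (u p) = s := fun p hp => by
    rcases le_total p (d + a) with hpc | hpc
    · rw [hPL _ hpc, hEu p hp, huL _ hpc, ← Module.End.mul_apply, ← pow_add,
        show d + a - p + (p - d) = a by rw [hI] at hp; omega, hxs]
    · rw [hPR _ hpc, hEu p hp, huR _ hpc, ← Module.End.mul_apply, ← pow_add,
        show p - (d + a) + (d + a + b - p) = b by rw [hI] at hp; omega, hys]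
  have hspan : Submodule.span k (u '' I) ∈ invariantSubspaces (operators E lam rho) := by
    have hmem : ∀ p ∈ I, u p ∈ Submodule.span k (u '' I) := fun p hp =>
      Submodule.subset_span ⟨p, hp, rfl⟩
    rw [mem_invariantSubspaces]
    refine ⟨fun q => apply_mem_span_of_forall ?_, apply_mem_span_of_forall ?_,
      apply_mem_span_of_forall ?_⟩ <;> rintro _ ⟨p, hp, rfl⟩
    · rcases eq_or_ne q p with rfl | hqp
      · rw [hEu q hp]
        exact hmem q hp
      · rw [← hEu p hp, h.proj_of_ne hqp]
        exact zero_mem _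
    · rcases le_or_gt p (d + a) with hpc | hpc
      · rw [← hEu p hp, hlam p hpc]
        exact zero_mem _
      · rw [Finset.mem_coe, hI] at hp
        convert hmem (p - 1) ((hI _).2 (by omega)) using 1
        rw [huR p hpc.le, huR (p - 1) (by omega), ← Module.End.mul_apply, ← pow_succ']
        congr 2
        omega
    · rcases le_or_gt (d + a) p with hpc | hpc
      · rw [← hEu p hp, hρ p hpc]
        exact zero_mem _
      · rw [Finset.mem_coe, hI] at hp
        convert hmem (p + 1) ((hI _).2 (by omega)) using 1
        rw [huL p hpc.le, huL (p + 1) (by omega), ← Module.End.mul_apply, ← pow_succ']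
        congr 2
        omega
  -- Shifting the argument changes `P p` into a neighbouring `P q`. Past the left end the result
  -- vanishes by the choice of `a`, past the right end by the choice of `φ`.
  have hker : (⨅ p ∈ I, LinearMap.ker (φ ∘ₗ P p)) ∈
      invariantSubspaces (operators E lam rho) := by
    rw [mem_invariantSubspaces]
    simp only [Submodule.mem_iInf, LinearMap.mem_ker, LinearMap.comp_apply]
    refine ⟨fun q z hz p hp => ?_, fun z hz p hp => ?_, fun z hz p hp => ?_⟩
    · rcases eq_or_ne p q with rfl | hpq
      · rw [hPE]
        exact hz p hp
      · rw [hPE' p q hpq, map_zero]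
    · rw [hI] at hp
      rcases le_or_gt (d + a) p with hpc | hpc
      · have : P p (lam z) = P (p + 1) z := by
          rw [hPR _ hpc, hPR _ (by omega), ← h.lam_proj, ← Module.End.mul_apply, ← pow_succ]
          congr 2
          omega
        rw [this]
        rcases hp.2.eq_or_lt with rfl | hlt
        · rw [hPR _ (by omega), ← hφ z]
          congr 3
          omega
        · exact hz _ ((hI _).2 (by omega))
      · rw [hPL _ hpc.le, ← h.lam_proj, hlam _ (by omega), map_zero, map_zero]
    · rw [hI] at hp
      obtain ⟨q, rfl⟩ : ∃ q, p = q + 1 := ⟨p - 1, by omega⟩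
      rcases le_or_gt (q + 1) (d + a) with hpc | hpc
      · have : P (q + 1) (rho z) = (rho ^ (d + a - q)) (E q z) := by
          rw [hPL _ hpc, ← h.rho_proj, ← Module.End.mul_apply, ← pow_succ]
          congr 2
          omega
        rw [this]
        rcases hp.1.eq_or_lt with hlt | hlt
        · rw [show d + a - q = a + 1 by omega, show q = d + a - (a + 1) by omega,
            ← Module.End.mul_apply, ha', LinearMap.zero_apply, map_zero]
        · rw [← hPL _ (by omega)]
          exact hz _ ((hI _).2 (by omega))
      · rw [hPR _ hpc.le, ← h.rho_proj, hρ _ (by omega), map_zero, map_zero]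
  have hsum := hX.eq_sum (s := I) (x := u) (ψ := fun p => φ ∘ₗ P p) ⟨d, (hI d).2 (by omega)⟩
    (fun p hp => by rw [LinearMap.comp_apply, hPu p hp, hφs])
    (fun p hp q hq hpq => by rw [LinearMap.comp_apply, ← hEu q hq, hPE' p q hpq, map_zero])
    hspan hker
  have hmem : ∀ U ∈ invariantSubspaces (operators E lam rho), U ≠ ⊥ → s ∈ U := by
    intro U hU hne
    obtain ⟨z, hz, hz0⟩ := (Submodule.ne_bot_iff _).1 hne
    obtain ⟨p, hp, hpz⟩ : ∃ p ∈ I, (φ ∘ₗ P p) z ≠ 0 := by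
      by_contra! hall
      exact hz0 ((hsum z).trans (Finset.sum_eq_zero fun p hp => by rw [hall p hp, zero_smul]))
    have hPz : P p z = (φ ∘ₗ P p) z • s := by
      conv_lhs => rw [hsum z]
      rw [map_sum, Finset.sum_eq_single_of_mem p hp, map_smul, hPu p hp]
      intro q hq hqp
      rw [map_smul, ← hEu q hq, hPE' p q hqp.symm, smul_zero]
    rw [mem_invariantSubspaces] at hU
    have hpow : ∀ f : Module.End k X, (∀ z ∈ U, f z ∈ U) → ∀ n, ∀ z ∈ U, (f ^ n) z ∈ U := by
      intro f hf n
      induction n with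
      | zero => exact fun z hz => hz
      | succ n ih =>
        intro z hz
        rw [pow_succ', Module.End.mul_apply]
        exact hf _ (ih z hz)
    have hPU : P p z ∈ U := by
      rcases le_total p (d + a) with hpc | hpc
      · rw [hPL _ hpc]
        exact hpow _ hU.2.2 _ _ (hU.1 _ _ hz)
      · rw [hPR _ hpc]
        exact hpow _ hU.2.1 _ _ (hU.1 _ _ hz)
    rw [hPz] at hPU
    exact (Submodule.smul_mem_iff _ hpz).1 hPU
  intro U hU W hW hUW
  by_contra! hne
  apply hs
  rw [← Submodule.mem_bot k, ← hUW]
  exact ⟨hmem U hU hne.1, hmem W hW hne.2⟩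

/-- If the degree `c` is empty, the projection to the degrees below `c` commutes with all operators,
so the space lies on one side of `c`. The centre is then moved to the nearest occupied degree. -/
theorem isUniformFor {c : ℕ} (hρ : ∀ p ≥ c, ∀ x, rho (E p x) = 0)
    (hlam : ∀ p ≤ c, ∀ x, lam (E p x) = 0)
    (hX : IsIndecomposableFor (invariantSubspaces (operators E lam rho))) :
    IsUniformFor (invariantSubspaces (operators E lam rho)) := by
  have := hX.1
  have hne : ∃ p, E p ≠ 0 := by
    by_contra! h0
    obtain ⟨x, hx⟩ := exists_ne (0 : X)
    apply hx
    rw [h.sum_proj x]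
    exact Finset.sum_eq_zero fun p _ => by rw [h0 p, LinearMap.zero_apply]
  by_cases hc : E c = 0
  · have hmul : ∀ q, E q * ∑ p ∈ Finset.range c, E p = if q < c then E q else 0 := fun q => by
      rw [Finset.mul_sum]
      split_ifs with hq
      · rw [Finset.sum_eq_single_of_mem q (Finset.mem_range.2 hq) fun p _ hp =>
          h.mul_of_ne q p hp.symm, h.mul_self]
      · exact Finset.sum_eq_zero fun p hp => h.mul_of_ne q p (by
          have := Finset.mem_range.1 hp
          omega)
    have hmul' : ∀ q, (∑ p ∈ Finset.range c, E p) * E q = if q < c then E q else 0 := fun q => by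
      rw [Finset.sum_mul]
      split_ifs with hq
      · rw [Finset.sum_eq_single_of_mem q (Finset.mem_range.2 hq) fun p _ hp =>
          h.mul_of_ne p q hp, h.mul_self]
      · exact Finset.sum_eq_zero fun p hp => h.mul_of_ne p q (by
          have := Finset.mem_range.1 hp
          omega)
    have hidem : (∑ p ∈ Finset.range c, E p) * ∑ p ∈ Finset.range c, E p =
        ∑ p ∈ Finset.range c, E p := by
      rw [Finset.sum_mul]
      exact Finset.sum_congr rfl fun p hp => by rw [hmul, if_pos (Finset.mem_range.1 hp)]
    rcases hX.eq_zero_or_eq_one hidem (by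
      rintro f ((rfl | rfl) | ⟨q, rfl⟩)
      · rw [Finset.mul_sum, Finset.sum_mul]
        refine Finset.sum_congr rfl fun p hp => ?_
        have hpc := Finset.mem_range.1 hp
        rw [← h.lam_mul]
        ext x
        exact (hlam p hpc.le x).trans (hlam (p + 1) hpc x).symm
      -- Shifting the index is harmless because `E 0` and `E c` both vanish.
      · have h1 : ∑ p ∈ Finset.range c, E (p + 1) = ∑ p ∈ Finset.range c, E p := by
          have := Finset.sum_range_succ' E c
          rw [Finset.sum_range_succ, hc, h.zero, add_zero, add_zero] at this
          exact this.symm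
        rw [← h1, Finset.sum_mul, h1, Finset.mul_sum]
        exact Finset.sum_congr rfl fun p _ => h.rho_mul p
      · rw [hmul, hmul']) with h0 | h1
    · have hz : ∀ p < c, E p = 0 := fun p hp => by
        have := hmul p
        rw [h0, mul_zero, if_pos hp] at this
        exact this.symm
      classical
      refine h.isUniformFor_of_ne_zero (c := Nat.find hne) (fun p _ x => ?_) (fun p hp x => ?_)
        (Nat.find_spec hne) hX
      · rcases le_or_gt c p with hcp | hcp
        · exact hρ p hcp x
        · rw [hz p hcp, LinearMap.zero_apply, map_zero]
      · cases p with
        | zero => rw [h.zero, LinearMap.zero_apply, map_zero]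
        | succ p =>
          rw [h.lam_proj, not_not.1 (Nat.find_min hne (Nat.lt_of_succ_le hp)),
            LinearMap.zero_apply]
    · have hz : ∀ p ≥ c, E p = 0 := fun p hp => by
        have := hmul p
        rw [h1, mul_one, if_neg (by omega)] at this
        exact this
      -- `n` is the last occupied degree, the new centre.
      obtain ⟨n, ⟨q, hnq, hq⟩, hn⟩ := exists_and_not_succ (P := fun n => ∃ q ≥ n, E q ≠ 0)
        (hne.imp fun p hp => ⟨Nat.zero_le p, hp⟩) (N := N + 1) (by
          rintro ⟨q, hq, hq'⟩
          exact hq' (h.of_lt q hq))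
      push Not at hn
      refine h.isUniformFor_of_ne_zero (c := n) (fun p hp x => ?_) (fun p _ x => ?_) (fun hn0 => ?_)
        hX
      · rw [h.rho_proj, hn (p + 1) (by omega), LinearMap.zero_apply]
      · rcases le_or_gt p c with hcp | hcp
        · exact hlam p hcp x
        · rw [hz p hcp.le, LinearMap.zero_apply, map_zero]
      · rcases hnq.eq_or_lt with rfl | hlt
        · exact hq hn0
        · exact hq (hn q hlt)
  · exact h.isUniformFor_of_ne_zero hρ hlam hc hX

/-- Transposition exchanges the two shifts and reverses all maps, so maps pointing away from `c`
become maps pointing towards it. -/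
theorem isHollowFor [FiniteDimensional k X] {c : ℕ} (hρ : ∀ p < c, ∀ x, rho (E p x) = 0)
    (hlam : ∀ p > c, ∀ x, lam (E p x) = 0)
    (hX : IsIndecomposableFor (invariantSubspaces (operators E lam rho))) :
    IsHollowFor (invariantSubspaces (operators E lam rho)) := by
  have hO : LinearMap.dualMap '' operators E lam rho =
      operators (fun p => (E p).dualMap) rho.dualMap lam.dualMap := by
    rw [operators, operators, Set.image_union, Set.image_pair, Set.pair_comm, ← Set.range_comp]
    rfl
  refine isHollowFor_of_dual hX ?_
  rw [hO]
  refine h.dual.isUniformFor (c := c) (fun p hp φ => ?_) fun p hp φ => ?_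
  · ext x
    change φ (E p (lam x)) = 0
    rw [← h.lam_proj, hlam _ (by omega), map_zero]
  · ext x
    change φ (E p (rho x)) = 0
    cases p with
    | zero => rw [h.zero, LinearMap.zero_apply, map_zero]
    | succ p => rw [← h.rho_proj, hρ _ (by omega), map_zero]

end

end IsGradedPair

/-! ### Indecomposable torsion modules over a principal ideal domain -/

section PrincipalIdealDomain

variable {R : Type u} [CommRing R] [IsDomain R] [IsPrincipalIdealRing R]

/-- The submodules correspond to the ideals containing `p ^ n`; these are generated by powers of `p`
and form a chain. -/
theorem isUniformModule_quotient_span_pow {p : R} (hp : Irreducible p) (n : ℕ) :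
    IsUniformModule R (R ⧸ Submodule.span R {p ^ n}) := by
  have key : ∀ U : Submodule R (R ⧸ Submodule.span R {p ^ n}), ∃ i,
      U.comap (Submodule.span R {p ^ n}).mkQ = Submodule.span R {p ^ i} := by
    intro U
    obtain ⟨a, ha⟩ := (IsPrincipalIdealRing.principal
      (U.comap (Submodule.span R {p ^ n}).mkQ)).principal
    have hmem : p ^ n ∈ Submodule.span R {a} := by
      rw [← ha, Submodule.mem_comap, Submodule.mkQ_apply,
        (Submodule.Quotient.mk_eq_zero _).2 (Submodule.mem_span_singleton_self _)]
      exact zero_mem U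
    obtain ⟨i, -, hi⟩ := (dvd_prime_pow hp.prime n).1 (Ideal.mem_span_singleton.1 hmem)
    exact ⟨i, ha.trans (Ideal.span_singleton_eq_span_singleton.2 hi)⟩
  have hle : ∀ U W : Submodule R (R ⧸ Submodule.span R {p ^ n}), ∀ i j, i ≤ j →
      U.comap (Submodule.span R {p ^ n}).mkQ = Submodule.span R {p ^ i} →
      W.comap (Submodule.span R {p ^ n}).mkQ = Submodule.span R {p ^ j} → W ≤ U := by
    intro U W i j hij hU hW
    rw [← Submodule.comap_le_comap_iff_of_surjective (Submodule.mkQ_surjective _), hU, hW]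
    exact Ideal.span_singleton_le_span_singleton.2 (pow_dvd_pow p hij)
  intro U W hUW
  obtain ⟨i, hi⟩ := key U
  obtain ⟨j, hj⟩ := key W
  rcases le_total i j with hij | hij
  · exact Or.inr (by rwa [inf_eq_right.2 (hle U W i j hij hi hj)] at hUW)
  · exact Or.inl (by rwa [inf_eq_left.2 (hle W U j i hij hj hi)] at hUW)

/-- By the structure theorem a nonzero primary cyclic summand splits off, and indecomposability
makes the projection to it injective. -/
theorem IsIndecomposableModule.isUniformModule_of_isTorsion {M : Type v} [AddCommGroup M]
    [Module R M] [Module.Finite R M] (hM : Module.IsTorsion R M)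
    (h : IsIndecomposableModule R M) : IsUniformModule R M := by
  classical
  obtain ⟨ι, _, p, hp, n, ⟨e⟩⟩ := Module.equiv_directSum_of_isTorsion hM
  have hnt := h.1
  obtain ⟨i, hi⟩ : ∃ i, ∃ x, e x i ≠ 0 := by
    by_contra! h0
    obtain ⟨x, hx⟩ := exists_ne (0 : M)
    exact hx (e.map_eq_zero_iff.1 (DFinsupp.ext fun i => h0 i x))
  let π : M →ₗ[R] R ⧸ Submodule.span R {p i ^ n i} := DirectSum.component R ι _ i ∘ₗ e.toLinearMap
  let κ : (R ⧸ Submodule.span R {p i ^ n i}) →ₗ[R] M :=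
    e.symm.toLinearMap ∘ₗ DirectSum.lof R ι (fun i => R ⧸ Submodule.span R {p i ^ n i}) i
  have hπκ : ∀ x, π (κ x) = x := fun x => by
    simp [π, κ, DirectSum.component.lof_self]
  rcases h.2 (LinearMap.range κ) (LinearMap.ker π) ⟨by
      rw [Submodule.disjoint_def]
      rintro _ ⟨x, rfl⟩ hx
      rw [LinearMap.mem_ker, hπκ] at hx
      rw [hx, map_zero], by
      rw [codisjoint_iff, eq_top_iff]
      intro x _
      refine Submodule.mem_sup.2 ⟨κ (π x), ⟨_, rfl⟩, x - κ (π x), ?_, by abel⟩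
      rw [LinearMap.mem_ker, map_sub, hπκ, sub_self]⟩ with h0 | h0
  · obtain ⟨x, hx⟩ := hi
    refine absurd ?_ hx
    have : κ (π x) = 0 := by
      rw [← Submodule.mem_bot R, ← h0]
      exact ⟨_, rfl⟩
    change π x = 0
    rw [← hπκ (π x), this, map_zero]
  · exact (isUniformModule_quotient_span_pow (hp i) (n i)).of_injective π (LinearMap.ker_eq_bot.1 h0)

end PrincipalIdealDomain

/-- A space with one operator is a `k[T]`-module, which is torsion in finite dimension. -/
theorem isUniformFor_of_singleton {k Y : Type*} [Field k] [AddCommGroup Y] [Module k Y]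
    [FiniteDimensional k Y] {T : Module.End k Y}
    (h : IsIndecomposableFor (invariantSubspaces {T})) :
    IsUniformFor (invariantSubspaces {T}) := by
  let e := Module.AEval.mapSubmodule k Y T
  have hmem : ∀ U : Submodule k Y, U ∈ invariantSubspaces {T} ↔
      U ∈ (Algebra.lsmul k k Y T).invtSubmodule := fun U => by
    simp [invariantSubspaces, Module.End.mem_invtSubmodule, SetLike.le_def]
  have hind : IsIndecomposableModule (Polynomial k) (Module.AEval' T) := by
    refine ⟨h.1, fun U W hc => ?_⟩
    have hc' := e.symm.isCompl hc
    refine (h.2 _ ((hmem _).2 (e.symm U).2) _ ((hmem _).2 (e.symm W).2) ⟨?_, ?_⟩).imp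
      (fun h0 => ?_) fun h0 => ?_
    · rw [disjoint_iff]
      exact congrArg Subtype.val hc'.inf_eq_bot
    · rw [codisjoint_iff]
      exact congrArg Subtype.val hc'.sup_eq_top
    · exact (map_eq_bot_iff e.symm).1 (Subtype.ext h0)
    · exact (map_eq_bot_iff e.symm).1 (Subtype.ext h0)
  intro U hU W hW hUW
  refine (hind.isUniformModule_of_isTorsion
    (Module.AEval.isTorsion_of_finiteDimensional k Y T) (e ⟨U, (hmem U).1 hU⟩)
    (e ⟨W, (hmem W).1 hW⟩) ?_).imp (fun h0 => ?_) fun h0 => ?_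
  · rw [← map_inf, map_eq_bot_iff]
    exact Subtype.ext hUW
  · exact congrArg Subtype.val ((map_eq_bot_iff e).1 h0)
  · exact congrArg Subtype.val ((map_eq_bot_iff e).1 h0)

/-- A grading of a space by a finite set, given by its projections, together with an operator that
is homogeneous with respect to a permutation of the degrees. -/
structure IsCyclicGrading {k X ι : Type*} [Field k] [AddCommGroup X] [Module k X] [Fintype ι]
    (s : Equiv.Perm ι) (E : ι → Module.End k X) (σ : Module.End k X) : Prop where
  mul_self : ∀ i, E i * E i = E i
  mul_of_ne : ∀ i j, i ≠ j → E i * E j = 0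
  sum_eq : ∑ i, E i = 1
  mul : ∀ i, σ * E i = E (s i) * σ

/-! ### Cyclic quivers: one shift operator on a cyclically graded space -/

namespace IsCyclicGrading

variable {k X ι : Type*} [Field k] [AddCommGroup X] [Module k X] [Fintype ι]
  {s : Equiv.Perm ι} {E : ι → Module.End k X} {σ : Module.End k X}

/-- The operators attached to a cyclic grading. -/
def operators (E : ι → Module.End k X) (σ : Module.End k X) : Set (Module.End k X) :=
  {σ} ∪ Set.range E

omit [Fintype ι] in
theorem mem_invariantSubspaces {U : Submodule k X} :
    U ∈ invariantSubspaces (operators E σ) ↔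
      (∀ i, ∀ x ∈ U, E i x ∈ U) ∧ ∀ x ∈ U, σ x ∈ U := by
  refine ⟨fun h => ⟨fun p => h _ (Or.inr ⟨p, rfl⟩), h _ (Or.inl rfl)⟩, ?_⟩
  rintro ⟨h1, h2⟩ f (rfl | ⟨p, rfl⟩)
  exacts [h2, h1 p]

section

variable (h : IsCyclicGrading s E σ)
include h

theorem proj_self (i : ι) (x : X) : E i (E i x) = E i x := LinearMap.congr_fun (h.mul_self i) x

theorem proj_of_ne {i j : ι} (hij : i ≠ j) (x : X) : E i (E j x) = 0 :=
  LinearMap.congr_fun (h.mul_of_ne i j hij) x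

theorem pow_proj (n : ℕ) (i : ι) (x : X) : (σ ^ n) (E i x) = E (s^[n] i) ((σ ^ n) x) := by
  induction n with
  | zero => rfl
  | succ n ih =>
    rw [pow_succ', Module.End.mul_apply, Module.End.mul_apply, ih, Function.iterate_succ_apply']
    exact LinearMap.congr_fun (h.mul _) _

theorem sum_proj (x : X) : x = ∑ i, E i x := by
  conv_lhs => rw [← Module.End.one_apply (R := k) x, ← h.sum_eq]
  simp

theorem eq_zero {x : X} (hx : ∀ i, E i x = 0) : x = 0 :=
  (h.sum_proj x).trans (Finset.sum_eq_zero fun i _ => hx i)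

theorem dual : IsCyclicGrading s.symm (fun i => (E i).dualMap) σ.dualMap where
  mul_self i := congrArg LinearMap.dualMap (h.mul_self i)
  mul_of_ne i j hij := (congrArg LinearMap.dualMap (h.mul_of_ne j i hij.symm)).trans (map_zero
    (Module.Dual.transpose (R := k)))
  sum_eq := (map_sum (Module.Dual.transpose (R := k)) _ _).symm.trans
    ((congrArg LinearMap.dualMap h.sum_eq).trans LinearMap.dualMap_id)
  mul i := by
    have := congrArg LinearMap.dualMap (h.mul (s.symm i))
    rw [s.apply_symm_apply] at this
    exact this.symm

/-- A longest nonzero string `x, σ x, …, σ ^ m x` with homogeneous `x` splits off, hence is a basis,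
and every nonzero invariant subspace contains `σ ^ m x`. -/
theorem isUniformFor_of_pow_eq_zero {N : ℕ} (hN : σ ^ N = 0)
    (hX : IsIndecomposableFor (invariantSubspaces (operators E σ))) :
    IsUniformFor (invariantSubspaces (operators E σ)) := by
  have := hX.1
  obtain ⟨m, hm, hm'⟩ := exists_and_not_succ (P := fun n => σ ^ n ≠ 0) (N := N)
    (by rw [pow_zero]; exact one_ne_zero) (by simpa using hN)
  rw [not_not] at hm'
  have hzero : ∀ n, m < n → ∀ z, (σ ^ n) z = 0 := fun n hn z => by
    obtain ⟨t, rfl⟩ := Nat.exists_eq_add_of_lt hn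
    rw [show m + t + 1 = t + (m + 1) by omega, pow_add, hm', mul_zero, LinearMap.zero_apply]
  obtain ⟨i, x, hx, hxm⟩ : ∃ i x, E i x = x ∧ (σ ^ m) x ≠ 0 := by
    by_contra! h0
    apply hm
    ext z
    rw [h.sum_proj z, map_sum, LinearMap.zero_apply]
    exact Finset.sum_eq_zero fun i _ => h0 i _ (h.proj_self i z)
  have hli : LinearIndependent k fun l : Fin (m + 1) => (σ ^ (l : ℕ)) x := by
    rw [Fintype.linearIndependent_iff]
    intro c hc
    suffices hall : ∀ n : ℕ, ∀ l : Fin (m + 1), (l : ℕ) = n → c l = 0 from fun l => hall _ l rfl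
    intro n
    induction n using Nat.strong_induction_on with
    | _ n ih =>
      intro l hl
      subst hl
      have := congrArg (σ ^ (m - l)) hc
      rw [map_zero, map_sum, Finset.sum_eq_single l] at this
      · rw [map_smul, ← Module.End.mul_apply, ← pow_add, Nat.sub_add_cancel (by omega)] at this
        exact (smul_eq_zero.1 this).resolve_right hxm
      · intro j _ hj
        rcases lt_or_gt_of_ne (Fin.val_ne_of_ne hj) with hlt | hlt
        · rw [ih j hlt j rfl, zero_smul, map_zero]
        · rw [map_smul, ← Module.End.mul_apply, ← pow_add, hzero _ (by omega), smul_zero]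
      · simp
  -- The string may wind around the cycle several times, so the degree does not separate its
  -- members; `φ` also has to kill the earlier ones.
  obtain ⟨φ, hφm, hφ⟩ : ∃ φ : X →ₗ[k] k, φ ((σ ^ m) x) = 1 ∧ ∀ l < m, φ ((σ ^ l) x) = 0 := by
    have hnot := hli.notMem_span_image (s := {l | (l : ℕ) < m}) (x := Fin.last m) (by simp)
    obtain ⟨φ₀, h1, h2⟩ := Submodule.exists_le_ker_of_notMem hnot
    rw [Fin.val_last] at h1
    refine ⟨(φ₀ ((σ ^ m) x))⁻¹ • φ₀, by simp [h1], fun l hl => ?_⟩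
    have : φ₀ ((σ ^ l) x) = 0 := h2 (Submodule.subset_span ⟨⟨l, by omega⟩, hl, rfl⟩)
    rw [LinearMap.smul_apply, this, smul_zero]
  have hEx : ∀ n, E (s^[n] i) ((σ ^ n) x) = (σ ^ n) x := fun n => by rw [← h.pow_proj, hx]
  let ψ : ℕ → X →ₗ[k] k := fun l => φ ∘ₗ E (s^[m] i) ∘ₗ (σ ^ (m - l))
  have hψ : ∀ l z, ψ l z = φ (E (s^[m] i) ((σ ^ (m - l)) z)) := fun l z => rfl
  have hψu : ∀ l ∈ Finset.range (m + 1), ∀ n, ψ l ((σ ^ n) x) = if l = n then 1 else 0 := by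
    intro l hl n
    have hl' := Finset.mem_range.1 hl
    rw [hψ, ← Module.End.mul_apply (σ ^ (m - l)), ← pow_add]
    split_ifs with hln
    · rw [show m - l + n = m by omega, hEx, hφm]
    · by_cases hi : s^[m] i = s^[m - l + n] i
      · rw [hi, hEx]
        rcases lt_or_gt_of_ne hln with hlt | hlt
        · rw [hzero _ (by omega), map_zero]
        · exact hφ _ (by omega)
      · rw [← hEx (m - l + n), h.proj_of_ne hi, map_zero]
  have hsum := hX.eq_sum (s := Finset.range (m + 1)) (x := fun l => (σ ^ l) x) (ψ := ψ)
    Finset.nonempty_range_add_one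
    (fun l hl => by rw [hψu l hl, if_pos rfl]) (fun l hl n _ hln => by rw [hψu l hl, if_neg hln])
    (by
      have hmem : ∀ n, (σ ^ n) x ∈ Submodule.span k
          ((fun l => (σ ^ l) x) '' Finset.range (m + 1)) := fun n => by
        rcases lt_or_ge m n with hn | hn
        · rw [hzero n hn]
          exact zero_mem _
        · exact Submodule.subset_span ⟨n, by simpa using Nat.lt_succ_of_le hn, rfl⟩
      rw [mem_invariantSubspaces]
      refine ⟨fun j => apply_mem_span_of_forall ?_, apply_mem_span_of_forall ?_⟩ <;>
        rintro _ ⟨n, -, rfl⟩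
      · dsimp only
        by_cases hj : j = s^[n] i
        · rw [hj, hEx]
          exact hmem n
        · rw [← hEx n, h.proj_of_ne hj]
          exact zero_mem _
      · dsimp only
        rw [← Module.End.mul_apply, ← pow_succ']
        exact hmem (n + 1))
    (by
      rw [mem_invariantSubspaces]
      simp only [Submodule.mem_iInf, LinearMap.mem_ker, Finset.mem_range]
      refine ⟨fun j z hz l hl => ?_, fun z hz l hl => ?_⟩
      · rw [hψ, h.pow_proj]
        by_cases hj : s^[m] i = s^[m - l] j
        · rw [← hj, h.proj_self]
          exact hz l hl
        · rw [h.proj_of_ne hj, map_zero]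
      · rw [hψ, ← Module.End.mul_apply (σ ^ (m - l)), ← pow_succ]
        cases l with
        | zero => rw [hzero _ (by omega), map_zero, map_zero]
        | succ l =>
          rw [show m - (l + 1) + 1 = m - l by omega]
          exact hz l (by omega))
  have hmem : ∀ U ∈ invariantSubspaces (operators E σ), U ≠ ⊥ → (σ ^ m) x ∈ U := by
    intro U hU hne
    obtain ⟨z, hz, hz0⟩ := (Submodule.ne_bot_iff _).1 hne
    rw [mem_invariantSubspaces] at hU
    have hpow : ∀ n, (σ ^ n) z ∈ U := fun n => by
      induction n with
      | zero => exact hz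
      | succ n ih =>
        rw [pow_succ', Module.End.mul_apply]
        exact hU.2 _ ih
    -- The last nonzero iterate of `z` is killed by `σ`. The functionals `ψ l` with `l < m` factor
    -- through `σ`, so only the coefficient of `σ ^ m x` remains.
    obtain ⟨n, hn, hn'⟩ := exists_and_not_succ (P := fun n => (σ ^ n) z ≠ 0) (N := N) hz0
      (by rw [hN]; simp)
    rw [not_not, pow_succ', Module.End.mul_apply] at hn'
    have hy : (σ ^ n) z = ψ m ((σ ^ n) z) • (σ ^ m) x := by
      conv_lhs => rw [hsum ((σ ^ n) z)]
      refine Finset.sum_eq_single_of_mem m (by simp) fun l hl hlm => ?_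
      have hl' := Finset.mem_range.1 hl
      rw [hψ, show m - l = m - l - 1 + 1 by omega, pow_succ, Module.End.mul_apply, hn', map_zero,
        map_zero, map_zero, zero_smul]
    refine (Submodule.smul_mem_iff U (fun h0 => hn ?_)).1 (hy ▸ hpow n)
    rw [hy, h0, zero_smul]
  intro U hU W hW hUW
  by_contra! hne
  apply hxm
  rw [← Submodule.mem_bot k, ← hUW]
  exact ⟨hmem U hU hne.1, hmem W hW hne.2⟩

/-- All degrees are identified with one of them, `Y`, by powers of `σ`; what is left is the
monodromy `T` on `Y`, so indecomposability passes to `(Y, T)` and uniformity comes back. -/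
theorem isUniformFor_of_injective [FiniteDimensional k X] (hs : ∀ i j, ∃ n, s^[n] i = j)
    (hσ : Function.Injective σ) (hX : IsIndecomposableFor (invariantSubspaces (operators E σ))) :
    IsUniformFor (invariantSubspaces (operators E σ)) := by
  classical
  have hnt := hX.1
  have hinj : ∀ n : ℕ, Function.Injective ⇑(σ ^ n) := fun n => by
    rw [Module.End.coe_pow]
    exact hσ.iterate n
  obtain ⟨x₁, hx₁⟩ := exists_ne (0 : X)
  obtain ⟨i, hi⟩ : ∃ i, E i x₁ ≠ 0 := by
    by_contra! h0
    exact hx₁ (h.eq_zero h0)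
  let Y := LinearMap.range (E i)
  have hY : ∀ y : Y, E i y = y := by
    rintro ⟨_, x, rfl⟩
    exact h.proj_self i x
  let π : X →ₗ[k] Y := (E i).rangeRestrict
  have hπ : ∀ x, (π x : X) = E i x := fun x => rfl
  have hπy : ∀ y : Y, π y = y := fun y => Subtype.ext (hY y)
  let t := Function.minimalPeriod s i
  let T : Module.End k Y := π ∘ₗ (σ ^ t) ∘ₗ Y.subtype
  have hT : ∀ y : Y, (T y : X) = (σ ^ t) y := fun y => by
    change E i ((σ ^ t) y) = _
    conv_lhs => rw [← Function.iterate_minimalPeriod (f := s) (x := i)]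
    rw [← h.pow_proj, hY]
  have hTpow : ∀ n, ∀ y : Y, ((T ^ n) y : X) = (σ ^ (t * n)) y := fun n y => by
    induction n with
    | zero => rfl
    | succ n ih =>
      rw [pow_succ', Module.End.mul_apply, hT, ih, ← Module.End.mul_apply, ← pow_add, mul_add_one,
        add_comm]
  have hkill : ∀ x : X, (∀ n, π ((σ ^ n) x) = 0) → x = 0 := by
    intro x hx
    refine h.eq_zero fun j => ?_
    obtain ⟨n, hn⟩ := hs j i
    apply hinj n
    rw [h.pow_proj, hn, map_zero, ← hπ, hx n]
    rfl
  have hinv : ∀ V ∈ invariantSubspaces {T}, ∀ n, ∀ y ∈ V, (T ^ n) y ∈ V := by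
    intro V hV n
    induction n with
    | zero => exact fun y hy => hy
    | succ n ih =>
      intro y hy
      rw [pow_succ', Module.End.mul_apply]
      exact hV T rfl _ (ih y hy)
  have hYind : IsIndecomposableFor (invariantSubspaces {T}) := by
    refine ⟨⟨⟨E i x₁, x₁, rfl⟩, 0, fun h0 => hi (congrArg Subtype.val h0)⟩, fun V hV V' hV' hc => ?_⟩
    -- The invariant subspace of `X` induced by `V`: all vectors whose components of degree `i` stay
    -- in `V` under every power of `σ`.
    let L : Submodule k Y → Submodule k X := fun V => ⨅ n, V.comap (π ∘ₗ (σ ^ n))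
    have hL : ∀ V x, x ∈ L V ↔ ∀ n, π ((σ ^ n) x) ∈ V := fun V x => by
      simp only [L, Submodule.mem_iInf, Submodule.mem_comap, LinearMap.comp_apply]
    have hLinv : ∀ V, L V ∈ invariantSubspaces (operators E σ) := by
      intro V
      rw [mem_invariantSubspaces]
      simp only [hL]
      refine ⟨fun j x hx n => ?_, fun x hx n => ?_⟩
      · have : π ((σ ^ n) (E j x)) = if i = s^[n] j then π ((σ ^ n) x) else 0 := by
          apply Subtype.ext
          rw [hπ, h.pow_proj]
          split_ifs with hij
          · rw [← hij, h.proj_self, hπ]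
          · rw [h.proj_of_ne hij]
            rfl
        rw [this]
        split_ifs
        exacts [hx n, zero_mem _]
      · rw [← Module.End.mul_apply, ← pow_succ]
        exact hx (n + 1)
    have hmemL : ∀ V ∈ invariantSubspaces {T}, ∀ y ∈ V, (y : X) ∈ L V := by
      intro V hV y hy
      rw [hL]
      intro n
      -- A homogeneous vector returns to degree `i` only after multiples of the period, where `σ`
      -- acts through a power of `T`.
      by_cases hn : i = s^[n] i
      · obtain ⟨r, rfl⟩ := (Function.isPeriodicPt_iff_minimalPeriod_dvd (f := s)).1 hn.symm
        rw [← hTpow, hπy]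
        exact hinv V hV r y hy
      · have : π ((σ ^ n) y) = 0 := Subtype.ext <| by
          rw [hπ, ← hY y, h.pow_proj, h.proj_of_ne hn]
          rfl
        rw [this]
        exact zero_mem V
    have hcompl : IsCompl (L V) (L V') := by
      constructor
      · rw [Submodule.disjoint_def]
        intro x hx hx'
        rw [hL] at hx hx'
        exact hkill x fun n => Submodule.disjoint_def.1 hc.disjoint _ (hx n) (hx' n)
      · rw [codisjoint_iff, eq_top_iff]
        intro x _
        rw [h.sum_proj x]
        refine Submodule.sum_mem _ fun j _ => ?_
        obtain ⟨n, hn⟩ := hs i j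
        obtain ⟨z, rfl⟩ := (LinearMap.injective_iff_surjective.1 (hinj n)) x
        rw [← hn, ← h.pow_proj]
        have hpow : ∀ V, ∀ x ∈ L V, (σ ^ n) x ∈ L V := by
          intro V x hx
          rw [hL] at hx ⊢
          intro r
          rw [← Module.End.mul_apply, ← pow_add]
          exact hx _
        obtain ⟨y, hy, y', hy', hyy⟩ := Submodule.mem_sup.1
          (hc.sup_eq_top ▸ Submodule.mem_top : π z ∈ V ⊔ V')
        rw [← hπ, ← hyy, Submodule.coe_add, map_add]
        exact Submodule.add_mem_sup (hpow _ _ (hmemL V hV y hy)) (hpow _ _ (hmemL V' hV' y' hy'))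
    have hbot : ∀ V ∈ invariantSubspaces {T}, L V = ⊥ → V = ⊥ := by
      intro V hV h0
      rw [Submodule.eq_bot_iff]
      intro y hy
      have := hmemL V hV y hy
      rw [h0, Submodule.mem_bot] at this
      exact Subtype.ext this
    exact (hX.2 _ (hLinv V) _ (hLinv V') hcompl).imp (hbot V hV) (hbot V' hV')
  have hres : ∀ U ∈ invariantSubspaces (operators E σ), (∀ n, ∀ x ∈ U, (σ ^ n) x ∈ U) ∧
      U.comap Y.subtype ∈ invariantSubspaces {T} ∧ (U.comap Y.subtype = ⊥ → U = ⊥) := by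
    intro U hU
    rw [mem_invariantSubspaces] at hU
    have hpow : ∀ n, ∀ x ∈ U, (σ ^ n) x ∈ U := fun n => by
      induction n with
      | zero => exact fun x hx => hx
      | succ n ih =>
        intro x hx
        rw [pow_succ', Module.End.mul_apply]
        exact hU.2 _ (ih x hx)
    refine ⟨hpow, ?_, fun h0 => ?_⟩
    · rintro _ rfl y hy
      rw [Submodule.mem_comap, Submodule.subtype_apply] at hy ⊢
      rw [hT]
      exact hpow t y hy
    · rw [Submodule.eq_bot_iff]
      intro x hx
      refine hkill x fun n => ?_
      have : π ((σ ^ n) x) ∈ U.comap Y.subtype := hU.1 i _ (hpow n x hx)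
      rwa [h0, Submodule.mem_bot] at this
  intro U hU W hW hUW
  refine (isUniformFor_of_singleton hYind _ (hres U hU).2.1 _ (hres W hW).2.1 ?_).imp
    (hres U hU).2.2 (hres W hW).2.2
  rw [← Submodule.comap_inf, hUW, Submodule.comap_bot, Submodule.ker_subtype]

/-- Fitting's lemma for `σ`: kernel and range of a high power are invariant and complementary, so
`σ` is injective or nilpotent. -/
theorem isUniformFor [FiniteDimensional k X] (hs : ∀ i j, ∃ n, s^[n] i = j)
    (hX : IsIndecomposableFor (invariantSubspaces (operators E σ))) :
    IsUniformFor (invariantSubspaces (operators E σ)) := by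
  obtain ⟨N, hN, hc⟩ := (Filter.eventually_gt_atTop 0 |>.and
    σ.eventually_isCompl_ker_pow_range_pow).exists
  rcases hX.2 (LinearMap.ker (σ ^ N)) (by
      rw [mem_invariantSubspaces]
      simp only [LinearMap.mem_ker]
      refine ⟨fun i x hx => ?_, fun x hx => ?_⟩
      · rw [h.pow_proj, hx, map_zero]
      · rw [← Module.End.mul_apply, ← pow_succ, pow_succ', Module.End.mul_apply, hx, map_zero])
    (LinearMap.range (σ ^ N)) (by
      rw [mem_invariantSubspaces]
      refine ⟨?_, ?_⟩
      · rintro i _ ⟨x, rfl⟩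
        -- The range is homogeneous because the degree shift is invertible.
        refine ⟨E (s.symm^[N] i) x, ?_⟩
        rw [h.pow_proj, (Function.LeftInverse.iterate s.apply_symm_apply N) i]
      · rintro _ ⟨x, rfl⟩
        exact ⟨σ x, by rw [← Module.End.mul_apply, ← Module.End.mul_apply, ← pow_succ, pow_succ']⟩)
    hc with h0 | h0
  · refine h.isUniformFor_of_injective hs ?_ hX
    have hinj := LinearMap.ker_eq_bot.1 h0
    rw [Module.End.coe_pow, ← Nat.succ_pred_eq_of_pos hN, Function.iterate_succ] at hinj
    exact hinj.of_comp
  · exact h.isUniformFor_of_pow_eq_zero (LinearMap.range_eq_bot.1 h0) hX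

theorem isHollowFor [FiniteDimensional k X] (hs : ∀ i j, ∃ n, s^[n] i = j)
    (hX : IsIndecomposableFor (invariantSubspaces (operators E σ))) :
    IsHollowFor (invariantSubspaces (operators E σ)) := by
  have hO : LinearMap.dualMap '' operators E σ =
      operators (fun i => (E i).dualMap) σ.dualMap := by
    rw [operators, operators, Set.image_union, Set.image_singleton, ← Set.range_comp]
    rfl
  refine isHollowFor_of_dual hX ?_
  rw [hO]
  refine h.dual.isUniformFor fun i j => ?_
  obtain ⟨n, hn⟩ := hs j i
  exact ⟨n, by rw [← hn, (Function.LeftInverse.iterate s.symm_apply_apply n) j]⟩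

end

end IsCyclicGrading

/-! ### Submodules as subspaces invariant under vertices and arrows -/

section PathOperators

variable (k : Type w) {Q : Type u} [Field k] [Quiver.{v} Q] [Fintype Q]
  (X : Type*) [AddCommGroup X] [Module k X] [Module (PathAlgebra k Q) X]
  [IsScalarTower k (PathAlgebra k Q) X]

/-- The action of a trivial path. -/
noncomputable def vertexEnd (a : Q) : Module.End k X :=
  Algebra.lsmul k k X (PathAlgebra.ofPath k (Path.nil : Path a a))

/-- The action of an arrow. -/
noncomputable def arrowEnd (e : Arrow Q) : Module.End k X :=
  Algebra.lsmul k k X (PathAlgebra.ofPath k e.2.2.toPath)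

/-- The actions of the trivial paths and of the arrows. -/
def pathOperators (Q : Type u) [Quiver.{v} Q] [Fintype Q] [Module (PathAlgebra k Q) X]
    [IsScalarTower k (PathAlgebra k Q) X] : Set (Module.End k X) :=
  Set.range (vertexEnd k X : Q → Module.End k X) ∪ Set.range (arrowEnd k X : Arrow Q → _)

theorem vertexEnd_mul_self (a : Q) : vertexEnd k X a * vertexEnd k X a = vertexEnd k X a := by
  rw [vertexEnd, ← map_mul, PathAlgebra.ofPath_mul_ofPath, Path.comp_nil]

theorem vertexEnd_mul_of_ne {a b : Q} (h : a ≠ b) : vertexEnd k X a * vertexEnd k X b = 0 := by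
  rw [vertexEnd, vertexEnd, ← map_mul, PathAlgebra.ofPath_mul_ofPath_of_ne _ _ h.symm, map_zero]

theorem sum_vertexEnd : ∑ a : Q, vertexEnd k X a = 1 := by
  simp only [vertexEnd]
  rw [← map_sum, ← PathAlgebra.one_def, map_one]

theorem arrowEnd_mul_vertexEnd (e : Arrow Q) : arrowEnd k X e * vertexEnd k X e.1 = arrowEnd k X e := by
  rw [arrowEnd, vertexEnd, ← map_mul, PathAlgebra.ofPath_mul_ofPath, Path.nil_comp]

theorem arrowEnd_mul_vertexEnd_of_ne {e : Arrow Q} {a : Q} (h : e.1 ≠ a) :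
    arrowEnd k X e * vertexEnd k X a = 0 := by
  rw [arrowEnd, vertexEnd, ← map_mul, PathAlgebra.ofPath_mul_ofPath_of_ne _ _ h.symm, map_zero]

theorem vertexEnd_mul_arrowEnd (e : Arrow Q) :
    vertexEnd k X e.2.1 * arrowEnd k X e = arrowEnd k X e := by
  rw [arrowEnd, vertexEnd, ← map_mul, PathAlgebra.ofPath_mul_ofPath, Path.comp_nil]

theorem vertexEnd_mul_arrowEnd_of_ne {e : Arrow Q} {a : Q} (h : e.2.1 ≠ a) :
    vertexEnd k X a * arrowEnd k X e = 0 := by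
  rw [arrowEnd, vertexEnd, ← map_mul, PathAlgebra.ofPath_mul_ofPath_of_ne _ _ h, map_zero]

theorem restrictScalars_mem_invariantSubspaces (U : Submodule (PathAlgebra k Q) X) :
    U.restrictScalars k ∈ invariantSubspaces (pathOperators k X Q) := by
  rintro _ (⟨a, rfl⟩ | ⟨e, rfl⟩) x hx
  · exact U.smul_mem _ hx
  · exact U.smul_mem _ hx

theorem exists_restrictScalars_eq {U : Submodule k X}
    (hU : U ∈ invariantSubspaces (pathOperators k X Q)) :
    ∃ V : Submodule (PathAlgebra k Q) X, V.restrictScalars k = U :=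
  ⟨Submodule.ofInvariant U (fun a => hU _ (Or.inl ⟨a, rfl⟩))
    fun a b e => hU _ (Or.inr ⟨⟨a, b, e⟩, rfl⟩), rfl⟩

theorem IsIndecomposableModule.isIndecomposableFor {X : Type w} [AddCommGroup X] [Module k X]
    [Module (PathAlgebra k Q) X] [IsScalarTower k (PathAlgebra k Q) X]
    (h : IsIndecomposableModule (PathAlgebra k Q) X) :
    IsIndecomposableFor (invariantSubspaces (pathOperators k X Q)) := by
  refine ⟨h.1, fun U hU W hW hc => ?_⟩
  obtain ⟨U, rfl⟩ := exists_restrictScalars_eq k X hU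
  obtain ⟨W, rfl⟩ := exists_restrictScalars_eq k X hW
  have hdisj := hc.inf_eq_bot
  have hcod := hc.sup_eq_top
  rw [← Submodule.restrictScalars_inf, Submodule.restrictScalars_eq_bot_iff] at hdisj
  rw [← Submodule.restrictScalars_sup, Submodule.restrictScalars_eq_top_iff] at hcod
  exact (h.2 U W ⟨disjoint_iff.2 hdisj, codisjoint_iff.2 hcod⟩).imp
    (Submodule.restrictScalars_eq_bot_iff k _ _).2 (Submodule.restrictScalars_eq_bot_iff k _ _).2

theorem IsUniformFor.isUniformModule
    (h : IsUniformFor (invariantSubspaces (pathOperators k X Q))) :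
    IsUniformModule (PathAlgebra k Q) X := by
  intro U W hUW
  refine (h _ (restrictScalars_mem_invariantSubspaces k X U) _
    (restrictScalars_mem_invariantSubspaces k X W) ?_).imp
    (Submodule.restrictScalars_eq_bot_iff k _ _).1 (Submodule.restrictScalars_eq_bot_iff k _ _).1
  rw [← Submodule.restrictScalars_inf, hUW, Submodule.restrictScalars_bot]

theorem IsHollowFor.isHollowModule
    (h : IsHollowFor (invariantSubspaces (pathOperators k X Q))) :
    IsHollowModule (PathAlgebra k Q) X := by
  intro U W hUW
  refine (h _ (restrictScalars_mem_invariantSubspaces k X U) _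
    (restrictScalars_mem_invariantSubspaces k X W) ?_).imp
    (Submodule.restrictScalars_eq_top_iff k _ _).1 (Submodule.restrictScalars_eq_top_iff k _ _).1
  rw [← Submodule.restrictScalars_sup, hUW, Submodule.restrictScalars_top]

/-- An indecomposable module is supported on one connected component. -/
theorem IsIndecomposableFor.exists_vertexEnd_eq_zero
    (h : IsIndecomposableFor (invariantSubspaces (pathOperators k X Q))) {κ : Type*} (c : Q → κ)
    (hc : ∀ e : Arrow Q, c e.1 = c e.2.1) : ∃ i, ∀ a, c a ≠ i → vertexEnd k X a = 0 := by
  classical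
  have hnt := h.1
  obtain ⟨b, hb⟩ : ∃ b : Q, vertexEnd k X b ≠ 0 := by
    by_contra! h0
    have := sum_vertexEnd k X (Q := Q)
    rw [Finset.sum_eq_zero fun a _ => h0 a] at this
    exact zero_ne_one this
  -- The projection to the component of `b`. It commutes with the arrows, as both ends of an arrow
  -- lie in the same component, and it is nonzero by the choice of `b`.
  let ε : Module.End k X := ∑ a with c a = c b, vertexEnd k X a
  have hε : ∀ f : Module.End k X, ∀ a, f * vertexEnd k X a = f →
      (∀ a', a ≠ a' → f * vertexEnd k X a' = 0) → f * ε = if c a = c b then f else 0 := by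
    intro f a ha ha'
    simp only [ε]
    rw [Finset.mul_sum]
    split_ifs with hab
    · rw [Finset.sum_eq_single_of_mem a (by simpa using hab) fun a' _ hne => ha' a' hne.symm, ha]
    · exact Finset.sum_eq_zero fun a' ha'' => ha' a' (by
        rintro rfl
        exact hab (by simpa using ha''))
  have hε' : ∀ f : Module.End k X, ∀ a, vertexEnd k X a * f = f →
      (∀ a', a ≠ a' → vertexEnd k X a' * f = 0) → ε * f = if c a = c b then f else 0 := by
    intro f a ha ha'
    simp only [ε]
    rw [Finset.sum_mul]
    split_ifs with hab
    · rw [Finset.sum_eq_single_of_mem a (by simpa using hab) fun a' _ hne => ha' a' hne.symm, ha]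
    · exact Finset.sum_eq_zero fun a' ha'' => ha' a' (by
        rintro rfl
        exact hab (by simpa using ha''))
  have hεv : ∀ a, vertexEnd k X a * ε = if c a = c b then vertexEnd k X a else 0 := fun a =>
    hε _ a (vertexEnd_mul_self k X a) fun a' h => vertexEnd_mul_of_ne k X h
  refine ⟨c b, fun a ha => ?_⟩
  rcases h.eq_zero_or_eq_one (ε := ε) (by
      conv_lhs => rw [show ε = ∑ a with c a = c b, vertexEnd k X a from rfl, Finset.sum_mul]
      exact Finset.sum_congr rfl fun a ha => by
        rw [hεv, if_pos (by simpa using ha)]) (by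
      rintro _ (⟨a, rfl⟩ | ⟨e, rfl⟩)
      · rw [hεv, hε' _ a (vertexEnd_mul_self k X a) fun a' h => vertexEnd_mul_of_ne k X h.symm]
      · rw [hε _ e.1 (arrowEnd_mul_vertexEnd k X e) fun a' h =>
          arrowEnd_mul_vertexEnd_of_ne k X h, hε' _ e.2.1 (vertexEnd_mul_arrowEnd k X e) fun a' h =>
          vertexEnd_mul_arrowEnd_of_ne k X h, hc e]) with h0 | h1
  · have := hεv b
    rw [h0, mul_zero, if_pos rfl] at this
    exact absurd this.symm hb
  · have := hεv a
    rwa [h1, mul_one, if_neg ha] at this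

end PathOperators

/-! ### Relabelling the vertices of a component by positions -/

section Positions

variable (k : Type w) {Q : Type u} [Field k] [Quiver.{v} Q] [Fintype Q]
  (X : Type*) [AddCommGroup X] [Module k X]
  [Module (PathAlgebra k Q) X] [IsScalarTower k (PathAlgebra k Q) X] (S : Set Q) {ι : Type*}
  (pos : Q → ι)

open Classical in
/-- The projection to the vertices in a given position. -/
noncomputable def positionEnd (p : ι) : Module.End k X :=
  ∑ a with a ∈ S ∧ pos a = p, vertexEnd k X a

variable {S pos}

/-- Positions are injective on the component, so at an occupied position the defining sum has one
term. -/
theorem positionEnd_eq_vertexEnd (hpos : Set.InjOn pos S) {a : Q} (ha : a ∈ S) :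
    positionEnd k X S pos (pos a) = vertexEnd k X a := by
  classical
  rw [positionEnd]
  convert Finset.sum_singleton (vertexEnd k X) a
  ext b
  simp only [Finset.mem_filter, Finset.mem_univ, true_and, Finset.mem_singleton]
  exact ⟨fun h => hpos h.1 ha h.2, by rintro rfl; exact ⟨ha, rfl⟩⟩

theorem positionEnd_eq_zero {p : ι} (hp : ∀ a ∈ S, pos a ≠ p) : positionEnd k X S pos p = 0 := by
  classical
  refine Finset.sum_eq_zero fun a ha => ?_
  rw [Finset.mem_filter] at ha
  exact absurd ha.2.2 (hp a ha.2.1)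

theorem positionEnd_mul_self (hpos : Set.InjOn pos S) (p : ι) :
    positionEnd k X S pos p * positionEnd k X S pos p = positionEnd k X S pos p := by
  by_cases hp : ∃ a ∈ S, pos a = p
  · obtain ⟨a, ha, rfl⟩ := hp
    rw [positionEnd_eq_vertexEnd k X hpos ha, vertexEnd_mul_self]
  · push Not at hp
    rw [positionEnd_eq_zero k X hp, mul_zero]

theorem positionEnd_mul_of_ne (hpos : Set.InjOn pos S) {p q : ι} (hpq : p ≠ q) :
    positionEnd k X S pos p * positionEnd k X S pos q = 0 := by
  by_cases hp : ∃ a ∈ S, pos a = p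
  · by_cases hq : ∃ a ∈ S, pos a = q
    · obtain ⟨a, ha, rfl⟩ := hp
      obtain ⟨b, hb, rfl⟩ := hq
      rw [positionEnd_eq_vertexEnd k X hpos ha, positionEnd_eq_vertexEnd k X hpos hb,
        vertexEnd_mul_of_ne k X fun hab => hpq (congrArg pos hab)]
    · push Not at hq
      rw [positionEnd_eq_zero k X hq, mul_zero]
  · push Not at hp
    rw [positionEnd_eq_zero k X hp, zero_mul]

theorem sum_positionEnd (hS : ∀ a ∉ S, vertexEnd k X a = 0) {P : Finset ι}
    (hP : ∀ a ∈ S, pos a ∈ P) : ∑ p ∈ P, positionEnd k X S pos p = 1 := by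
  classical
  rw [← sum_vertexEnd k X (Q := Q), ← Finset.sum_filter_of_ne (s := Finset.univ)
    (p := fun a => a ∈ S) fun a _ ha => not_not.1 fun h => ha (hS a h),
    ← Finset.sum_fiberwise_of_maps_to (t := P) (g := pos) fun a ha => hP a (by simpa using ha)]
  refine Finset.sum_congr rfl fun p _ => ?_
  rw [positionEnd, Finset.filter_filter]

variable [∀ a b : Q, Finite (a ⟶ b)]

instance : Finite (Arrow Q) := inferInstanceAs (Finite (Σ a b : Q, (a ⟶ b)))

variable (S pos) in
open Classical in
/-- The sum of the arrows between positions in a given relation. -/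
noncomputable def shiftEnd (r : ι → ι → Prop) : Module.End k X :=
  letI := Fintype.ofFinite (Arrow Q)
  ∑ e : Arrow Q with e.1 ∈ S ∧ r (pos e.1) (pos e.2.1), arrowEnd k X e

open Classical in
theorem shiftEnd_mul_positionEnd (r : ι → ι → Prop) (p : ι) :
    letI := Fintype.ofFinite (Arrow Q)
    shiftEnd k X S pos r * positionEnd k X S pos p =
      ∑ e : Arrow Q with (e.1 ∈ S ∧ r (pos e.1) (pos e.2.1)) ∧ pos e.1 = p, arrowEnd k X e := by
  let _ := Fintype.ofFinite (Arrow Q)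
  rw [shiftEnd, Finset.sum_mul, ← Finset.filter_filter _ fun e : Arrow Q => pos e.1 = p,
    Finset.sum_filter fun e : Arrow Q => pos e.1 = p]
  refine Finset.sum_congr rfl fun e he => ?_
  rw [Finset.mem_filter] at he
  rw [positionEnd, Finset.mul_sum]
  split_ifs with hp
  · rw [Finset.sum_eq_single_of_mem e.1 (by simp [hp, he.2.1]) fun a _ ha =>
      arrowEnd_mul_vertexEnd_of_ne k X ha.symm, arrowEnd_mul_vertexEnd]
  · refine Finset.sum_eq_zero fun a ha => arrowEnd_mul_vertexEnd_of_ne k X ?_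
    rintro rfl
    exact hp (by simpa [he.2.1] using ha)

open Classical in
theorem positionEnd_mul_shiftEnd (hS : ∀ e : Arrow Q, e.1 ∈ S → e.2.1 ∈ S) (r : ι → ι → Prop)
    (p : ι) :
    letI := Fintype.ofFinite (Arrow Q)
    positionEnd k X S pos p * shiftEnd k X S pos r =
      ∑ e : Arrow Q with (e.1 ∈ S ∧ r (pos e.1) (pos e.2.1)) ∧ pos e.2.1 = p, arrowEnd k X e := by
  let _ := Fintype.ofFinite (Arrow Q)
  rw [shiftEnd, Finset.mul_sum, ← Finset.filter_filter _ fun e : Arrow Q => pos e.2.1 = p,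
    Finset.sum_filter fun e : Arrow Q => pos e.2.1 = p]
  refine Finset.sum_congr rfl fun e he => ?_
  rw [Finset.mem_filter] at he
  rw [positionEnd, Finset.sum_mul]
  split_ifs with hp
  · rw [Finset.sum_eq_single_of_mem e.2.1 (by simp [hp, hS e he.2.1]) fun a _ ha =>
      vertexEnd_mul_arrowEnd_of_ne k X ha.symm, vertexEnd_mul_arrowEnd]
  · refine Finset.sum_eq_zero fun a ha => vertexEnd_mul_arrowEnd_of_ne k X ?_
    rintro rfl
    exact hp (by simpa [hS e he.2.1] using ha)

theorem shiftEnd_mul_positionEnd_eq (hS : ∀ e : Arrow Q, e.1 ∈ S → e.2.1 ∈ S)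
    {r : ι → ι → Prop} {p q : ι}
    (hr : ∀ e : Arrow Q, e.1 ∈ S → r (pos e.1) (pos e.2.1) → (pos e.1 = p ↔ pos e.2.1 = q)) :
    shiftEnd k X S pos r * positionEnd k X S pos p =
      positionEnd k X S pos q * shiftEnd k X S pos r := by
  rw [shiftEnd_mul_positionEnd, positionEnd_mul_shiftEnd k X hS]
  congr 1
  ext e
  simp only [Finset.mem_filter, Finset.mem_univ, true_and]
  exact and_congr_right fun he => hr e he.1 he.2

theorem shiftEnd_mul_positionEnd_eq_zero {r : ι → ι → Prop} {p : ι}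
    (hr : ∀ e : Arrow Q, e.1 ∈ S → pos e.1 = p → ¬ r p (pos e.2.1)) :
    shiftEnd k X S pos r * positionEnd k X S pos p = 0 := by
  rw [shiftEnd_mul_positionEnd]
  refine Finset.sum_eq_zero fun e he => ?_
  simp only [Finset.mem_filter, Finset.mem_univ, true_and] at he
  exact absurd (he.2 ▸ he.1.2) (hr e he.1.1 he.2)

/-- Recovers a single arrow from the summed operator: its source and a functional relation `r`
determine its target, and there are no parallel arrows. -/
theorem shiftEnd_mul_positionEnd_eq_arrowEnd (hS : ∀ e : Arrow Q, e.1 ∈ S → e.2.1 ∈ S)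
    (hpos : Set.InjOn pos S) (hsub : ∀ a b : Q, Subsingleton (a ⟶ b)) {r : ι → ι → Prop}
    (hr : ∀ p q q', r p q → r p q' → q = q') {e : Arrow Q} (he : e.1 ∈ S)
    (her : r (pos e.1) (pos e.2.1)) :
    shiftEnd k X S pos r * positionEnd k X S pos (pos e.1) = arrowEnd k X e := by
  rw [shiftEnd_mul_positionEnd]
  let _ := Fintype.ofFinite (Arrow Q)
  convert Finset.sum_singleton (arrowEnd k X) e
  ext e'
  simp only [Finset.mem_filter, Finset.mem_univ, true_and, Finset.mem_singleton]
  refine ⟨?_, by rintro rfl; exact ⟨⟨he, her⟩, rfl⟩⟩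
  rintro ⟨⟨he', hr'⟩, hp⟩
  obtain ⟨a, b, e⟩ := e
  obtain ⟨a', b', e'⟩ := e'
  obtain rfl : a' = a := hpos he' he hp
  obtain rfl : b' = b := hpos (hS _ he') (hS _ he) (hr _ _ _ hr' her)
  rw [Subsingleton.elim e e']

/-- Vertex and arrow operators on the component are products of position and shift operators, and
conversely the latter are sums of the former; off the component everything acts as zero. -/
theorem invariantSubspaces_pathOperators_eq (hS : ∀ a ∉ S, vertexEnd k X a = 0)
    (hSa : ∀ e : Arrow Q, e.1 ∈ S → e.2.1 ∈ S) (hpos : Set.InjOn pos S)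
    (hsub : ∀ a b : Q, Subsingleton (a ⟶ b)) {R : Set (ι → ι → Prop)}
    (hR : ∀ r ∈ R, ∀ p q q', r p q → r p q' → q = q')
    (hR' : ∀ e : Arrow Q, e.1 ∈ S → ∃ r ∈ R, r (pos e.1) (pos e.2.1)) :
    invariantSubspaces (pathOperators k X Q) =
      invariantSubspaces (shiftEnd k X S pos '' R ∪ Set.range (positionEnd k X S pos)) := by
  classical
  ext U
  constructor
  · rintro hU _ (⟨r, -, rfl⟩ | ⟨p, rfl⟩) x hx
    · rw [shiftEnd, LinearMap.sum_apply]
      exact Submodule.sum_mem _ fun e _ => hU _ (Or.inr ⟨e, rfl⟩) x hx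
    · rw [positionEnd, LinearMap.sum_apply]
      exact Submodule.sum_mem _ fun a _ => hU _ (Or.inl ⟨a, rfl⟩) x hx
  · rintro hU _ (⟨a, rfl⟩ | ⟨e, rfl⟩) x hx
    · by_cases ha : a ∈ S
      · rw [← positionEnd_eq_vertexEnd k X hpos ha]
        exact hU _ (Or.inr ⟨_, rfl⟩) x hx
      · rw [hS a ha]
        exact zero_mem U
    · by_cases he : e.1 ∈ S
      · obtain ⟨r, hr, her⟩ := hR' e he
        rw [← shiftEnd_mul_positionEnd_eq_arrowEnd k X hSa hpos hsub (hR r hr) he her]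
        exact hU _ (Or.inl ⟨r, hr, rfl⟩) _ (hU _ (Or.inr ⟨_, rfl⟩) x hx)
      · rw [← arrowEnd_mul_vertexEnd, hS _ he, mul_zero]
        exact zero_mem U

end Positions

/-! ### Components of line and cycle type -/

section Positions

variable (k : Type w) {Q : Type u} [Field k] [Quiver.{v} Q] [Fintype Q]
  [∀ a b : Q, Finite (a ⟶ b)] {X : Type w} [AddCommGroup X] [Module k X]
  [Module (PathAlgebra k Q) X] [IsScalarTower k (PathAlgebra k Q) X] {S : Set Q}

theorem isGradedPair_shiftEnd {pos : Q → ℕ} {N : ℕ} (hS : ∀ a ∉ S, vertexEnd k X a = 0)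
    (hSa : ∀ e : Arrow Q, e.1 ∈ S → e.2.1 ∈ S) (hpos : Set.InjOn pos S)
    (hN : ∀ a ∈ S, 1 ≤ pos a ∧ pos a ≤ N) :
    IsGradedPair N (positionEnd k X S pos) (shiftEnd k X S pos fun i j => i = j + 1)
      (shiftEnd k X S pos fun i j => j = i + 1) where
  mul_self := positionEnd_mul_self k X hpos
  mul_of_ne p q := positionEnd_mul_of_ne k X hpos
  zero := positionEnd_eq_zero k X fun a ha h => by
    have := hN a ha
    omega
  of_lt p hp := positionEnd_eq_zero k X fun a ha h => by
    have := hN a ha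
    omega
  sum_eq := sum_positionEnd k X hS fun a ha => by
    have := hN a ha
    rw [Finset.mem_range]
    omega
  lam_mul p := shiftEnd_mul_positionEnd_eq k X hSa fun e _ h => by omega
  rho_mul p := shiftEnd_mul_positionEnd_eq k X hSa fun e _ h => by omega

theorem invariantSubspaces_eq_of_line {pos : Q → ℕ} (hS : ∀ a ∉ S, vertexEnd k X a = 0)
    (hSa : ∀ e : Arrow Q, e.1 ∈ S → e.2.1 ∈ S) (hpos : Set.InjOn pos S)
    (hsub : ∀ a b : Q, Subsingleton (a ⟶ b))
    (harr : ∀ e : Arrow Q, e.1 ∈ S → pos e.1 = pos e.2.1 + 1 ∨ pos e.2.1 = pos e.1 + 1) :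
    invariantSubspaces (pathOperators k X Q) = invariantSubspaces (IsGradedPair.operators
      (positionEnd k X S pos) (shiftEnd k X S pos fun i j => i = j + 1)
      (shiftEnd k X S pos fun i j => j = i + 1)) := by
  rw [invariantSubspaces_pathOperators_eq k X hS hSa hpos hsub
    (R := {fun i j => i = j + 1, fun i j => j = i + 1}), Set.image_pair]
  · rfl
  · rintro r (rfl | rfl) p q q' h h' <;> omega
  · intro e he
    rcases harr e he with h | h
    exacts [⟨_, Or.inl rfl, h⟩, ⟨_, Or.inr rfl, h⟩]

/-- `harr` says that all arrows join neighbouring positions and point towards `c`. The hollow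
version after it has them pointing away from `c`. -/
theorem isUniformFor_of_line {pos : Q → ℕ} {N : ℕ} (hS : ∀ a ∉ S, vertexEnd k X a = 0)
    (hSa : ∀ e : Arrow Q, e.1 ∈ S → e.2.1 ∈ S) (hpos : Set.InjOn pos S)
    (hN : ∀ a ∈ S, 1 ≤ pos a ∧ pos a ≤ N) (hsub : ∀ a b : Q, Subsingleton (a ⟶ b)) {c : ℕ}
    (harr : ∀ e : Arrow Q, e.1 ∈ S → (pos e.2.1 = pos e.1 + 1 ∧ pos e.2.1 ≤ c) ∨
      (pos e.1 = pos e.2.1 + 1 ∧ c ≤ pos e.2.1))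
    (hX : IsIndecomposableFor (invariantSubspaces (pathOperators k X Q))) :
    IsUniformFor (invariantSubspaces (pathOperators k X Q)) := by
  rw [invariantSubspaces_eq_of_line k hS hSa hpos hsub fun e he => by
    have := harr e he
    omega] at hX ⊢
  refine (isGradedPair_shiftEnd k hS hSa hpos hN).isUniformFor (c := c) (fun p hp x => ?_)
    (fun p hp x => ?_) hX
  · refine LinearMap.congr_fun (shiftEnd_mul_positionEnd_eq_zero k X fun e he hep h => ?_) x
    have := harr e he
    omega
  · refine LinearMap.congr_fun (shiftEnd_mul_positionEnd_eq_zero k X fun e he hep h => ?_) x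
    have := harr e he
    omega

theorem isHollowFor_of_line [Module.Finite k X] {pos : Q → ℕ} {N : ℕ}
    (hS : ∀ a ∉ S, vertexEnd k X a = 0)
    (hSa : ∀ e : Arrow Q, e.1 ∈ S → e.2.1 ∈ S) (hpos : Set.InjOn pos S)
    (hN : ∀ a ∈ S, 1 ≤ pos a ∧ pos a ≤ N) (hsub : ∀ a b : Q, Subsingleton (a ⟶ b)) {c : ℕ}
    (harr : ∀ e : Arrow Q, e.1 ∈ S → (pos e.1 = pos e.2.1 + 1 ∧ pos e.1 ≤ c) ∨
      (pos e.2.1 = pos e.1 + 1 ∧ c ≤ pos e.1))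
    (hX : IsIndecomposableFor (invariantSubspaces (pathOperators k X Q))) :
    IsHollowFor (invariantSubspaces (pathOperators k X Q)) := by
  rw [invariantSubspaces_eq_of_line k hS hSa hpos hsub fun e he => by
    have := harr e he
    omega] at hX ⊢
  refine (isGradedPair_shiftEnd k hS hSa hpos hN).isHollowFor (c := c) (fun p hp x => ?_)
    (fun p hp x => ?_) hX
  · refine LinearMap.congr_fun (shiftEnd_mul_positionEnd_eq_zero k X fun e he hep h => ?_) x
    have := harr e he
    omega
  · refine LinearMap.congr_fun (shiftEnd_mul_positionEnd_eq_zero k X fun e he hep h => ?_) x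
    have := harr e he
    omega

theorem isUniformFor_and_isHollowFor_of_cycle [Module.Finite k X] {n : ℕ} {pos : Q → Fin (n + 1)}
    (hS : ∀ a ∉ S, vertexEnd k X a = 0) (hSa : ∀ e : Arrow Q, e.1 ∈ S → e.2.1 ∈ S)
    (hpos : Set.InjOn pos S) (hsub : ∀ a b : Q, Subsingleton (a ⟶ b))
    (harr : ∀ e : Arrow Q, e.1 ∈ S → pos e.2.1 = pos e.1 + 1)
    (hX : IsIndecomposableFor (invariantSubspaces (pathOperators k X Q))) :
    IsUniformFor (invariantSubspaces (pathOperators k X Q)) ∧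
      IsHollowFor (invariantSubspaces (pathOperators k X Q)) := by
  have hinv : invariantSubspaces (pathOperators k X Q) = invariantSubspaces
      (IsCyclicGrading.operators (positionEnd k X S pos)
        (shiftEnd k X S pos fun i j => j = i + 1)) := by
    rw [invariantSubspaces_pathOperators_eq k X hS hSa hpos hsub (R := {fun i j => j = i + 1}),
      Set.image_singleton]
    · rfl
    · rintro r rfl p q q' h h'
      exact h.trans h'.symm
    · exact fun e he => ⟨_, rfl, harr e he⟩
  have hgr : IsCyclicGrading (Equiv.addRight (1 : Fin (n + 1))) (positionEnd k X S pos)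
      (shiftEnd k X S pos fun i j => j = i + 1) :=
    { mul_self := positionEnd_mul_self k X hpos
      mul_of_ne := fun p q => positionEnd_mul_of_ne k X hpos
      sum_eq := sum_positionEnd k X hS fun a _ => Finset.mem_univ _
      mul := fun i => shiftEnd_mul_positionEnd_eq k X hSa fun e _ h => by
        rw [h, Equiv.coe_addRight, add_left_inj] }
  have hs : ∀ i j : Fin (n + 1), ∃ m, (Equiv.addRight (1 : Fin (n + 1)))^[m] i = j := fun i j => by
    have hval : ∀ m, ((Equiv.addRight (1 : Fin (n + 1)))^[m] i : ℕ) = (i + m) % (n + 1) := by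
      intro m
      induction m with
      | zero => exact (Nat.mod_eq_of_lt i.2).symm
      | succ m ih =>
        rw [Function.iterate_succ_apply']
        change (((Equiv.addRight (1 : Fin (n + 1)))^[m] i + 1 : Fin (n + 1)) : ℕ) = _
        rw [Fin.val_add, ih, Fin.val_one', ← Nat.add_mod, add_assoc]
    refine ⟨n + 1 - i + j, Fin.ext ?_⟩
    rw [hval, show (i + (n + 1 - i + j) : ℕ) = j + (n + 1) by omega, Nat.add_mod_right,
      Nat.mod_eq_of_lt j.2]
  rw [hinv] at hX ⊢
  exact ⟨hgr.isUniformFor hs hX, hgr.isHollowFor hs hX⟩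

end Positions

/-! ### Indecomposable modules over the four types of quivers -/

section DisjointUnion

variable {k : Type w} {Q : Type u} [Field k] [Quiver.{v} Q] [Fintype Q]
  [∀ a b : Q, Finite (a ⟶ b)]

theorem BasicQuiver.sigma_vertex_ext {n : ℕ} {B : Fin n → BasicQuiver} :
    ∀ {x y : Σ i, (B i).Vertex}, x.1 = y.1 → x.2.val = y.2.val → x = y := by
  rintro ⟨i, p, hp⟩ ⟨j, q, hq⟩ h h'
  obtain rfl : i = j := h
  obtain rfl : p = q := h'
  rfl

/-- Indecomposable modules over a disjoint union of basic quivers are uniform or hollow. -/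
theorem IsDisjointUnionOf.exists_kind {T : Set QuiverKind} (h : IsDisjointUnionOf T Q)
    {X : FDMod k (PathAlgebra k Q)} (hX : IsIndecomposableModule (PathAlgebra k Q) X) :
    ∃ κ ∈ T, (κ ≠ .Λ → IsUniformModule (PathAlgebra k Q) X) ∧
      (κ ≠ .V → IsHollowModule (PathAlgebra k Q) X) := by
  obtain ⟨n, B, hB, F, ⟨hFinj, -⟩, hF⟩ := h
  have hX' := hX.isIndecomposableFor k
  have hsub : ∀ a b : Q, Subsingleton (a ⟶ b) := fun a b =>
    have := disjointUnionHom_subsingleton B (F.obj a) (F.obj b)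
    (hF a b).1.subsingleton
  have hrel : ∀ e : Arrow Q, (F.obj e.1).1 = (F.obj e.2.1).1 ∧
      (B (F.obj e.1).1).HasArrow (F.obj e.1).2.val (F.obj e.2.1).2.val := fun e =>
    (nonempty_disjointUnionHom_iff B).1 ⟨F.map e.2.2⟩
  obtain ⟨i, hi⟩ := hX'.exists_vertexEnd_eq_zero k X (fun a => (F.obj a).1) fun e => (hrel e).1
  let S : Set Q := {a | (F.obj a).1 = i}
  let pos : Q → ℕ := fun a => (F.obj a).2.val
  have hS : ∀ a ∉ S, vertexEnd k X a = 0 := hi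
  have hSa : ∀ e : Arrow Q, e.1 ∈ S → e.2.1 ∈ S := fun e he => (hrel e).1.symm.trans he
  have hpos : Set.InjOn pos S := fun a ha b hb hab =>
    hFinj (BasicQuiver.sigma_vertex_ext (Eq.trans ha (Eq.symm hb)) hab)
  have hmem : ∀ a ∈ S, pos a ∈ (B i).vertices := fun a ha =>
    (show (F.obj a).1 = i from ha) ▸ (F.obj a).2.mem
  have harr : ∀ e : Arrow Q, e.1 ∈ S → (B i).HasArrow (pos e.1) (pos e.2.1) := fun e he =>
    (show (F.obj e.1).1 = i from he) ▸ (hrel e).2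
  refine ⟨(B i).kind, hB i, ?_⟩
  generalize B i = C at hmem harr
  cases C with
  | L m hm =>
    simp only [BasicQuiver.vertices, Finset.mem_Icc, BasicQuiver.HasArrow] at hmem harr
    -- A linearly oriented line points towards its last vertex `m` and away from its first vertex
    -- `1`, so both line lemmas apply.
    refine ⟨fun _ => (isUniformFor_of_line k hS hSa hpos hmem hsub (c := m) (fun e he => ?_)
      hX').isUniformModule, fun _ => (isHollowFor_of_line k hS hSa hpos hmem hsub (c := 1)
      (fun e he => ?_) hX').isHollowModule⟩
    · exact Or.inl ⟨harr e he, (hmem _ (hSa e he)).2⟩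
    · exact Or.inr ⟨harr e he, (hmem _ he).1⟩
  | Δ m =>
    simp only [BasicQuiver.vertices, Finset.mem_Icc, BasicQuiver.HasArrow] at hmem harr
    -- Labels are at most `m`, so reading them in `Fin (m + 1)` loses nothing and turns the arrow
    -- relation into adding `1`.
    have hval : ∀ a ∈ S, (Fin.ofNat (m + 1) (pos a) : ℕ) = pos a := fun a ha =>
      Nat.mod_eq_of_lt (Nat.lt_succ_of_le (hmem a ha).2)
    have := isUniformFor_and_isHollowFor_of_cycle k (pos := fun a => Fin.ofNat (m + 1) (pos a))
      hS hSa (fun a ha b hb hab => hpos ha hb (by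
        rw [← hval a ha, ← hval b hb]
        exact congrArg Fin.val hab)) hsub (fun e he => by
        apply Fin.ext
        rw [hval _ (hSa e he), harr e he, Fin.val_add, hval _ he, Fin.val_one', Nat.add_mod_mod])
      hX'
    exact ⟨fun _ => this.1.isUniformModule, fun _ => this.2.isHollowModule⟩
  | V m x hm hx =>
    simp only [BasicQuiver.vertices, Finset.mem_Icc, BasicQuiver.HasArrow] at hmem harr
    exact ⟨fun _ => (isUniformFor_of_line k hS hSa hpos hmem hsub (c := x) harr
      hX').isUniformModule, fun h => absurd rfl h⟩
  | Λ m y hm hy =>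
    simp only [BasicQuiver.vertices, Finset.mem_Icc, BasicQuiver.HasArrow] at hmem harr
    exact ⟨fun h => absurd rfl h, fun _ => (isHollowFor_of_line k hS hSa hpos hmem hsub (c := y)
      harr hX').isHollowModule⟩

end DisjointUnion

/-! ### Consequences for `D_r` of uniform and hollow modules and of extensions -/

section Counting

variable {k : Type w} {A : Type u} [Field k] [Ring A] [Algebra k A]

theorem IsUniformModule.isIndecomposableModule {M : Type w} [AddCommGroup M] [Module A M]
    [Nontrivial M] (h : IsUniformModule A M) : IsIndecomposableModule A M :=
  ⟨inferInstance, fun U W hc => h U W hc.inf_eq_bot⟩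

theorem IsHollowModule.isIndecomposableModule {M : Type w} [AddCommGroup M] [Module A M]
    [Nontrivial M] (h : IsHollowModule A M) : IsIndecomposableModule A M := by
  refine ⟨inferInstance, fun U W hc => (h U W hc.sup_eq_top).symm.imp (fun h0 => ?_) fun h0 => ?_⟩
  · exact eq_bot_of_isCompl_top (h0 ▸ hc)
  · exact eq_bot_of_top_isCompl (h0 ▸ hc)

theorem IsUniformModule.numIndecomposables_le {M : Type w} [AddCommGroup M] [Module A M]
    [IsArtinian A M] [IsNoetherian A M] (h : IsUniformModule A M) :
    numIndecomposables A M ≤ 1 := by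
  rcases subsingleton_or_nontrivial M with _ | _
  · rw [numIndecomposables_of_subsingleton]
    exact zero_le_one
  · rw [numIndecomposables_of_isIndecomposableModule h.isIndecomposableModule]

theorem IsHollowModule.numIndecomposables_le {M : Type w} [AddCommGroup M] [Module A M]
    [IsArtinian A M] [IsNoetherian A M] (h : IsHollowModule A M) :
    numIndecomposables A M ≤ 1 := by
  rcases subsingleton_or_nontrivial M with _ | _
  · rw [numIndecomposables_of_subsingleton]
    exact zero_le_one
  · rw [numIndecomposables_of_isIndecomposableModule h.isIndecomposableModule]

theorem FDMod.s_sub_le (h : ∀ X : FDMod k A, IsIndecomposableModule A X → IsUniformModule A X)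
    (X : FDMod k A) (U : Submodule A X) : (X.sub U).s ≤ X.s :=
  numIndecomposables_submodule_le (fun V hV => h (X.sub V) hV) U

theorem FDMod.s_quot_le (h : ∀ X : FDMod k A, IsIndecomposableModule A X → IsHollowModule A X)
    (X : FDMod k A) (U : Submodule A X) : (X.quot U).s ≤ X.s :=
  numIndecomposables_quotient_le (fun V hV => h (X.sub V) hV) U

variable [Finite k] [Algebra.FiniteType k A]

/-- For `r = 1` only an indecomposable middle term can violate closure. If it is uniform its
submodules have at most one summand, if it is hollow its quotients do, so the property may vary with
the module. -/
theorem hallDIsSubring_one_of_isUniformModule_or_isHollowModule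
    (h : ∀ X : FDMod k A, IsIndecomposableModule A X → IsUniformModule A X ∨ IsHollowModule A X) :
    HallDIsSubring k A 1 := by
  rw [hallDIsSubring_iff]
  intro X U hU hq
  by_contra hX
  rcases subsingleton_or_nontrivial X with hX0 | hX0
  · have : Subsingleton (X.sub U) := inferInstanceAs (Subsingleton U)
    have : (X.sub U).s = 0 := numIndecomposables_of_subsingleton
    omega
  · have h1 : X.s = 1 := by
      have : 0 < X.s := numIndecomposables_pos
      omega
    rcases h X (isIndecomposableModule_of_numIndecomposables h1) with hu | hh
    · have h2 : IsUniformModule A (X.sub U) := hu.of_injective U.subtype U.injective_subtype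
      have : (X.sub U).s ≤ 1 := h2.numIndecomposables_le
      omega
    · have h2 : IsHollowModule A (X.quot U) := hh.of_surjective U.mkQ U.mkQ_surjective
      have : (X.quot U).s ≤ 1 := h2.numIndecomposables_le
      omega

/-- The sum of `r` copies has exactly `r` summands in the middle and at least `2 * r ≥ r + 1` on
each side. -/
theorem HasExtension.not_hallDIsSubring (h : HasExtension k A 1 2 2) {r : ℕ} (hr : 1 ≤ r) :
    ¬ HallDIsSubring k A r := by
  rw [hallDIsSubring_iff]
  intro hD
  obtain ⟨X, U, h1, h2, h3⟩ := h.mul r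
  have := hD X U (by omega) (by omega)
  omega

/-- Take `r - 1` copies of `h` and one of `h'`: the middle term has `r` summands, the submodule at
least `2 * r - 1` and the quotient at least `r + 1`. Here `2 ≤ r` gives `2 * r - 1 ≥ r + 1`. -/
theorem HasExtension.not_hallDIsSubring_of_two_le (h : HasExtension k A 1 2 1)
    (h' : HasExtension k A 1 1 2) {r : ℕ} (hr : 2 ≤ r) : ¬ HallDIsSubring k A r := by
  rw [hallDIsSubring_iff]
  intro hD
  obtain ⟨X, U, h1, h2, h3⟩ := (h.mul (r - 1)).add h'
  have := hD X U (by omega) (by omega)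
  omega

theorem HallDIsIdeal.hallDIsSubring {r : ℕ} (h : HallDIsIdeal k A r) : HallDIsSubring k A r :=
  (hallDIsSubring_iff k A r).2 fun X U hU _ => (hallDIsIdeal_iff k A r).1 h X U (Or.inl hU)

end Counting

/-! ### The three parts of the theorem -/

section Quivers

variable {k : Type w} {Q : Type u} [Field k] [Quiver.{v} Q] [Fintype Q]

theorem hasExtension_of_hasPeak (h : HasPeak fun a b : Q => Nonempty (a ⟶ b)) :
    HasExtension k (PathAlgebra k Q) 1 2 1 := by
  obtain ⟨a, b, c, hbc, ⟨e⟩, ⟨f⟩⟩ := h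
  exact LabelledGraph.hasExtension_of_peak k (e₁ := ⟨a, b, e⟩) (e₂ := ⟨a, c, f⟩) rfl
    fun h => hbc (congrArg (fun x : Arrow Q => x.2.1) h)

theorem hasExtension_of_hasPeak_flip (h : HasPeak fun b a : Q => Nonempty (a ⟶ b)) :
    HasExtension k (PathAlgebra k Q) 1 1 2 := by
  obtain ⟨a, b, c, hbc, ⟨e⟩, ⟨f⟩⟩ := h
  exact LabelledGraph.hasExtension_of_deep k (e₁ := ⟨b, a, e⟩) (e₂ := ⟨c, a, f⟩) rfl
    fun h => hbc (congrArg (fun x : Arrow Q => x.1) h)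

/-- Two parallel arrows form the shortest zigzag: one is the middle step, the other is used at both
turns. -/
theorem subsingleton_of_not_hasExtension (h : ¬ HasExtension k (PathAlgebra k Q) 1 2 2) (a b : Q) :
    Subsingleton (a ⟶ b) := by
  refine ⟨fun e f => ?_⟩
  by_contra hef
  have hne : (⟨a, b, f⟩ : Arrow Q) ≠ ⟨a, b, e⟩ := fun h' => hef (by simpa using h'.symm)
  exact h (LabelledGraph.hasExtension_of_zigzag k (m := 0) (p := fun _ => ⟨a, b, e⟩) (by simp)
    (by rfl) (by rfl) hne hne)

theorem isTame_of_not_hasExtension (h : ¬ HasExtension k (PathAlgebra k Q) 1 2 2) :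
    IsTame fun a b : Q => Nonempty (a ⟶ b) where
  out_le_two := by
    rintro a b b' c ⟨e⟩ ⟨e'⟩ hbb ⟨f⟩
    by_contra! hc
    exact h (LabelledGraph.hasExtension_of_threeOut k (e₁ := ⟨a, b, e⟩) (e₂ := ⟨a, b', e'⟩)
      (e₃ := ⟨a, c, f⟩) rfl rfl (fun h' => hbb (congrArg (fun x : Arrow Q => x.2.1) h'))
      (fun h' => hc.1 (congrArg (fun x : Arrow Q => x.2.1) h').symm)
      fun h' => hc.2 (congrArg (fun x : Arrow Q => x.2.1) h').symm)
  in_le_two := by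
    rintro a b b' c ⟨e⟩ ⟨e'⟩ hbb ⟨f⟩
    by_contra! hc
    exact h (LabelledGraph.hasExtension_of_threeIn k (b₁ := ⟨b, a, e⟩) (b₂ := ⟨b', a, e'⟩)
      (b₃ := ⟨c, a, f⟩) rfl rfl (fun h' => hbb (congrArg (fun x : Arrow Q => x.1) h'))
      (fun h' => hc.1 (congrArg (fun x : Arrow Q => x.1) h').symm)
      fun h' => hc.2 (congrArg (fun x : Arrow Q => x.1) h').symm)
  not_in := by
    rintro a b b' z ⟨e⟩ ⟨e'⟩ hbb ⟨f⟩
    exact h (LabelledGraph.hasExtension_of_oneInTwoOut k (b := ⟨z, a, f⟩) (a₁ := ⟨a, b, e⟩)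
      (a₂ := ⟨a, b', e'⟩) rfl rfl fun h' => hbb (congrArg (fun x : Arrow Q => x.2.1) h'))
  not_out := by
    rintro a b b' z ⟨e⟩ ⟨e'⟩ hbb ⟨f⟩
    exact h (LabelledGraph.hasExtension_of_twoInOneOut k (b₁ := ⟨b, a, e⟩) (b₂ := ⟨b', a, e'⟩)
      (a := ⟨a, z, f⟩) rfl rfl fun h' => hbb (congrArg (fun x : Arrow Q => x.1) h'))
  no_zigzag := by
    rintro m v b z hv ⟨e⟩ hb ⟨f⟩
    by_contra hz
    have hp : ∀ i, ∃ p : Arrow Q, i ≤ m → p.1 = v i ∧ p.2.1 = v (i + 1) := fun i => by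
      by_cases hi : i ≤ m
      · exact ⟨⟨v i, v (i + 1), (hv i hi).some⟩, fun _ => ⟨rfl, rfl⟩⟩
      · exact ⟨⟨_, _, e⟩, fun h' => absurd h' hi⟩
    choose p hp using hp
    refine h (LabelledGraph.hasExtension_of_zigzag k (m := m) (p := p) (a := ⟨v 0, b, e⟩)
      (b := ⟨z, v (m + 1), f⟩) (fun i hi => ?_) (hp 0 (Nat.zero_le m)).1.symm (hp m le_rfl).2.symm
      (fun h' => hb ?_) fun h' => hz ?_)
    · rw [(hp i hi.le).2, (hp (i + 1) hi).1]
    · exact (congrArg (fun x : Arrow Q => x.2.1) h').trans (hp 0 (Nat.zero_le m)).2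
    · exact (congrArg (fun x : Arrow Q => x.1) h').trans (hp m le_rfl).1

variable [Finite k] [∀ a b : Q, Finite (a ⟶ b)]

theorem isDisjointUnionOf_of_hallDIsSubring {r : ℕ} (hr : 1 ≤ r)
    (h : HallDIsSubring k (PathAlgebra k Q) r) {T : Set QuiverKind} (hL : .L ∈ T) (hΔ : .Δ ∈ T)
    (hΛ : .Λ ∈ T ∨ ¬ HasPeak fun a b : Q => Nonempty (a ⟶ b))
    (hV : .V ∈ T ∨ ¬ HasPeak fun b a : Q => Nonempty (a ⟶ b)) : IsDisjointUnionOf T Q :=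
  have hE : ¬ HasExtension k (PathAlgebra k Q) 1 2 2 := fun hE => hE.not_hallDIsSubring hr h
  isDisjointUnionOf_of_isTame (subsingleton_of_not_hasExtension hE) (isTame_of_not_hasExtension hE)
    T hL hΔ hΛ hV

theorem forall_hallDIsIdeal_iff :
    (∀ r : ℕ, 1 ≤ r → HallDIsIdeal k (PathAlgebra k Q) r) ↔ IsDisjointUnionOf {.L, .Δ} Q := by
  constructor
  · intro h
    have h1 := (hallDIsIdeal_iff k (PathAlgebra k Q) 1).1 (h 1 le_rfl)
    refine isDisjointUnionOf_of_hallDIsSubring le_rfl (h 1 le_rfl).hallDIsSubring (by simp)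
      (by simp) (Or.inr fun hp => ?_) (Or.inr fun hp => ?_)
    · obtain ⟨X, U, hX, hU, -⟩ := hasExtension_of_hasPeak (k := k) hp
      have := h1 X U (Or.inl hU)
      omega
    · obtain ⟨X, U, hX, -, hU⟩ := hasExtension_of_hasPeak_flip (k := k) hp
      have := h1 X U (Or.inr hU)
      omega
  · intro h r _
    have hX : ∀ X : FDMod k (PathAlgebra k Q), IsIndecomposableModule (PathAlgebra k Q) X →
        IsUniformModule (PathAlgebra k Q) X ∧ IsHollowModule (PathAlgebra k Q) X := by
      intro X hX
      obtain ⟨κ, hκ, h1, h2⟩ := h.exists_kind hX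
      rcases hκ with rfl | rfl <;> exact ⟨h1 (by simp), h2 (by simp)⟩
    rw [hallDIsIdeal_iff]
    rintro X U (hU | hU)
    · exact hU.trans (FDMod.s_sub_le (fun X h => (hX X h).1) X U)
    · exact hU.trans (FDMod.s_quot_le (fun X h => (hX X h).2) X U)

theorem hallDIsSubring_one_iff :
    HallDIsSubring k (PathAlgebra k Q) 1 ↔ IsDisjointUnionOf {.L, .Δ, .V, .Λ} Q := by
  constructor
  · exact fun h => isDisjointUnionOf_of_hallDIsSubring le_rfl h (by simp) (by simp)
      (Or.inl (by simp)) (Or.inl (by simp))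
  · intro h
    refine hallDIsSubring_one_of_isUniformModule_or_isHollowModule fun X hX => ?_
    obtain ⟨κ, -, h1, h2⟩ := h.exists_kind hX
    by_cases hκ : κ = .Λ
    · exact Or.inr (h2 (by simp [hκ]))
    · exact Or.inl (h1 hκ)

theorem hallDIsSubring_of_isDisjointUnionOf
    (h : IsDisjointUnionOf {.L, .Δ, .V} Q ∨ IsDisjointUnionOf {.L, .Δ, .Λ} Q) (r : ℕ) :
    HallDIsSubring k (PathAlgebra k Q) r := by
  rw [hallDIsSubring_iff]
  intro X U hU hq
  rcases h with h | h
  · refine hU.trans (FDMod.s_sub_le (fun X hX => ?_) X U)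
    obtain ⟨κ, hκ, h1, -⟩ := h.exists_kind hX
    rcases hκ with rfl | rfl | rfl <;> exact h1 (by simp)
  · refine hq.trans (FDMod.s_quot_le (fun X hX => ?_) X U)
    obtain ⟨κ, hκ, -, h2⟩ := h.exists_kind hX
    rcases hκ with rfl | rfl | rfl <;> exact h2 (by simp)

/-- For `r ≥ 2` the quiver cannot have both a vertex with two successors and one with two
predecessors, so `Λ` and `V` do not occur together. -/
theorem isDisjointUnionOf_or_of_hallDIsSubring {r : ℕ} (hr : 2 ≤ r)
    (h : HallDIsSubring k (PathAlgebra k Q) r) :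
    IsDisjointUnionOf {.L, .Δ, .V} Q ∨ IsDisjointUnionOf {.L, .Δ, .Λ} Q := by
  by_cases hp : HasPeak fun a b : Q => Nonempty (a ⟶ b)
  · refine Or.inr (isDisjointUnionOf_of_hallDIsSubring (by omega) h (by simp) (by simp)
      (Or.inl (by simp)) (Or.inr fun hd => ?_))
    exact (hasExtension_of_hasPeak hp).not_hallDIsSubring_of_two_le
      (hasExtension_of_hasPeak_flip hd) hr h
  · exact Or.inl (isDisjointUnionOf_of_hallDIsSubring (by omega) h (by simp) (by simp)
      (Or.inr hp) (Or.inl (by simp)))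

end Quivers

theorem theoremT (k : Type w) [Field k] [Finite k]
    (Q : Type u) [Quiver.{v} Q] [Fintype Q] [∀ a b : Q, Finite (a ⟶ b)] :
    ((∀ r : ℕ, 1 ≤ r → HallDIsIdeal k (PathAlgebra k Q) r) ↔
      IsDisjointUnionOf {.L, .Δ} Q) ∧
    (HallDIsSubring k (PathAlgebra k Q) 1 ↔
      IsDisjointUnionOf {.L, .Δ, .V, .Λ} Q) ∧
    List.TFAE
      [∀ r : ℕ, 1 ≤ r → HallDIsSubring k (PathAlgebra k Q) r,
        ∃ r : ℕ, 2 ≤ r ∧ HallDIsSubring k (PathAlgebra k Q) r,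
        IsDisjointUnionOf {.L, .Δ, .V} Q ∨ IsDisjointUnionOf {.L, .Δ, .Λ} Q] := by
  refine ⟨forall_hallDIsIdeal_iff, hallDIsSubring_one_iff, ?_⟩
  tfae_have 1 → 2 := fun h => ⟨2, le_rfl, h 2 one_le_two⟩
  tfae_have 2 → 3 := fun ⟨r, hr, h⟩ => isDisjointUnionOf_or_of_hallDIsSubring hr h
  tfae_have 3 → 1 := fun h r _ => hallDIsSubring_of_isDisjointUnionOf h r
  tfae_finish
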